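/- **Fair Max-Min diversification.** An instance consists of a universe $\mathcal U$ of $n$ elements with a pseudometric $d:\mathcal U\times\mathcal U\to\mathbb R_{\ge 0}$ (that is, $d(u,u)=0$, $d(u,v)=d(v,u)$ and $d(u,v)\le d(u,w)+d(w,v)$), a partition of $\mathcal U$ into $m$ pairwise disjoint classes $\mathcal U_1,\dots,\mathcal U_m$, and non-negative integers $k_1,\dots,k_m$ with $k_i\le|\mathcal U_i|$; put $k=\sum_i k_i$. A set $\mathcal S\subseteq\mathcal U$ is *fair* if $|\mathcal S\cap\mathcal U_i|=k_i$ for all $i$. Its diversity is $\operatorname{div}(\mathcal S)=\min_{u,v\in\mathcal S,\,u\ne v}d(u,v)$ (read as $\infty$ if $|\mathcal S|\le 1$), and $\ell^*_{\mathrm{fair}}$ is the maximum of $\operatorname{div}(\mathcal S)$ over all fair sets $\mathcal S$. **Theorem.** There is a $\tfrac1{3m-1}$-approximation algorithm for this problem that runs in time $O(kn+k^2m^2\log(km))$. Precisely: there are a single deterministic real-RAM program and a constant $C$ such that, for all $n$, $m$ and every instance, the program terminates and outputs a fair set $\mathcal S$ with $$\operatorname{div}(\mathcal S)\ \ge\ \frac{\ell^*_{\mathrm{fair}}}{3m-1},$$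 and, if $k\ge 1$, it makes at most $C\,\bigl(kn+k^2m^2\log(km)\bigr)$ steps. Here the program works on arrays of natural numbers and of reals, initially zero; a step is an assignment or a test, built from a bounded number of elementary operations: array accesses, addition, (truncated) subtraction and comparison of natural numbers, field operations and comparison of reals, conversion of a natural number to a real, and reading from the input $n$, $m$, some $k_i$, the class of an element, or the distance of two elements. -/

import Mathlib

open scoped ENNReal

noncomputable section

namespace FairDiv

/-! ### The problem -/

/-- An instance of Fair Max-Min diversification: a universe of `n` elements (named `0, …, n-1`)
with a pseudometric, a partition of the universe into `m` classes (given by the class, or colour,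
of each element), and a non-negative integer for each class. -/
structure Instance (n m : ℕ) where
  dist : Fin n → Fin n → ℝ
  dist_nonneg : ∀ u v, 0 ≤ dist u v
  dist_self : ∀ u, dist u u = 0
  dist_comm : ∀ u v, dist u v = dist v u
  dist_triangle : ∀ u v w, dist u v ≤ dist u w + dist w v
  color : Fin n → Fin m
  quota : Fin m → ℕ

namespace Instance

variable {n m : ℕ} (I : Instance n m)

/-- The class `U_i`. -/
def group (i : Fin m) : Finset (Fin n) := Finset.univ.filter fun u => I.color u = i

/-- `k = k_1 + ⋯ + k_m`. -/
def k : ℕ := ∑ i, I.quota i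

/-- The fairness constraints: `|S ∩ U_i| = k_i` for all `i`. -/
def IsFair (S : Finset (Fin n)) : Prop := ∀ i, (S ∩ I.group i).card = I.quota i

/-- `div(S)`, the minimum distance between two distinct elements of `S`
(`∞` if there are no two distinct elements). -/
def div (S : Finset (Fin n)) : ℝ≥0∞ :=
  ⨅ u ∈ S, ⨅ v ∈ S, ⨅ _ : u ≠ v, ENNReal.ofReal (I.dist u v)

/-- The optimum fair diversity. -/
def opt : ℝ≥0∞ := ⨆ S : Finset (Fin n), ⨆ _ : I.IsFair S, I.div S

end Instance

/-! ### The machine model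

A real RAM in structured form. The memory consists of arrays of natural numbers and arrays of
real numbers, named by natural numbers and indexed by natural numbers; a scalar variable is an
array used at the single index `0`. Natural numbers can be added, subtracted and compared; real
numbers can be added, subtracted, multiplied, divided and compared; a natural number can be
converted to a real number but not conversely. A program has no real constants. The instance is
read-only; reading a colour, a fairness constraint or a distance is an elementary operation. -/

/-- Expressions of natural number type. -/
inductive NExp : Type
  | lit (c : ℕ)
  /-- entry `i` of the array `a` of natural numbers -/
  | get (a : ℕ) (i : NExp)
  | add (x y : NExp)
  /-- truncated subtraction -/
  | sub (x y : NExp)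
  /-- the number `n` of elements -/
  | numElems
  /-- the number `m` of classes -/
  | numClasses
  /-- the colour of an element -/
  | color (u : NExp)
  /-- the fairness constraint of a class -/
  | quota (i : NExp)

/-- Expressions of real type. -/
inductive RExp : Type
  /-- entry `i` of the array `a` of reals -/
  | get (a : ℕ) (i : NExp)
  | ofNat (x : NExp)
  | add (x y : RExp)
  | sub (x y : RExp)
  | mul (x y : RExp)
  | div (x y : RExp)
  /-- the distance of two elements -/
  | dist (u v : NExp)

/-- Tests. -/
inductive BExp : Type
  | nlt (x y : NExp)
  | rlt (x y : RExp)
  | not (b : BExp)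
  | and (b c : BExp)

/-- Programs. -/
inductive Prog : Type
  | skip
  /-- write `x` to entry `i` of the array `a` of natural numbers -/
  | nset (a : ℕ) (i x : NExp)
  /-- write `x` to entry `i` of the array `a` of reals -/
  | rset (a : ℕ) (i : NExp) (x : RExp)
  | seq (p q : Prog)
  | ite (b : BExp) (p q : Prog)
  | loop (b : BExp) (p : Prog)

/-- The contents of the memory. -/
structure Store where
  nat : ℕ → ℕ → ℕ
  real : ℕ → ℕ → ℝ

namespace Store

/-- All memory cells contain `0` at the start. -/
def init : Store := ⟨fun _ _ => 0, fun _ _ => 0⟩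

/-- Overwrite one natural number. -/
def setNat (s : Store) (a i x : ℕ) : Store :=
  { s with nat := Function.update s.nat a (Function.update (s.nat a) i x) }

/-- Overwrite one real number. -/
def setReal (s : Store) (a i : ℕ) (x : ℝ) : Store :=
  { s with real := Function.update s.real a (Function.update (s.real a) i x) }

/-- The set that a final memory represents: array `0` of natural numbers holds its
characteristic vector. -/
def output (s : Store) (n : ℕ) : Finset (Fin n) :=
  Finset.univ.filter fun u => s.nat 0 u = 1

end Store

section Semantics

variable {n m : ℕ} (I : Instance n m)

/-- Value of an expression of natural number type; reading the input out of range gives `0`. -/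
def NExp.eval (s : Store) : NExp → ℕ
  | .lit c => c
  | .get a i => s.nat a (i.eval s)
  | .add x y => x.eval s + y.eval s
  | .sub x y => x.eval s - y.eval s
  | .numElems => n
  | .numClasses => m
  | .color u => if h : u.eval s < n then (I.color ⟨u.eval s, h⟩ : ℕ) else 0
  | .quota i => if h : i.eval s < m then I.quota ⟨i.eval s, h⟩ else 0

/-- Value of an expression of real type; reading the input out of range gives `0`. -/
def RExp.eval (s : Store) : RExp → ℝ
  | .get a i => s.real a (i.eval I s)
  | .ofNat x => (x.eval I s : ℝ)
  | .add x y => x.eval s + y.eval s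
  | .sub x y => x.eval s - y.eval s
  | .mul x y => x.eval s * y.eval s
  | .div x y => x.eval s / y.eval s
  | .dist u v =>
      if h : u.eval I s < n ∧ v.eval I s < n then
        I.dist ⟨u.eval I s, h.1⟩ ⟨v.eval I s, h.2⟩
      else 0

/-- Truth of a test. -/
def BExp.Holds (s : Store) : BExp → Prop
  | .nlt x y => x.eval I s < y.eval I s
  | .rlt x y => x.eval I s < y.eval I s
  | .not b => ¬ b.Holds s
  | .and b c => b.Holds s ∧ c.Holds s

/-- `Runs I p s s' t`: on the instance `I`, the program `p` started with memory `s` terminates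
with memory `s'` after `t` steps. Each executed assignment, each evaluated test and each `skip`
counts as one step; an expression in a fixed program consists of a fixed number of elementary
operations, so `t` is the number of elementary operations up to a factor that depends on the
program only. -/
inductive Runs : Prog → Store → Store → ℕ → Prop
  | skip (s : Store) : Runs .skip s s 1
  | nset (a : ℕ) (i x : NExp) (s : Store) :
      Runs (.nset a i x) s (s.setNat a (i.eval I s) (x.eval I s)) 1
  | rset (a : ℕ) (i : NExp) (x : RExp) (s : Store) :
      Runs (.rset a i x) s (s.setReal a (i.eval I s) (x.eval I s)) 1
  | seq {p q : Prog} {s s' s'' : Store} {t t' : ℕ} :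
      Runs p s s' t → Runs q s' s'' t' → Runs (.seq p q) s s'' (t + t')
  | ite_true {b : BExp} {p q : Prog} {s s' : Store} {t : ℕ} :
      b.Holds I s → Runs p s s' t → Runs (.ite b p q) s s' (t + 1)
  | ite_false {b : BExp} {p q : Prog} {s s' : Store} {t : ℕ} :
      ¬ b.Holds I s → Runs q s s' t → Runs (.ite b p q) s s' (t + 1)
  | loop_done {b : BExp} {p : Prog} {s : Store} :
      ¬ b.Holds I s → Runs (.loop b p) s s 1
  | loop_step {b : BExp} {p : Prog} {s s' s'' : Store} {t t' : ℕ} :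
      b.Holds I s → Runs p s s' t → Runs (.loop b p) s' s'' t' →
      Runs (.loop b p) s s'' (t + t' + 1)

/-- Programs are deterministic: final memory and number of steps are unique. -/
theorem Runs.unique {p : Prog} {s s₁ s₂ : Store} {t₁ t₂ : ℕ}
    (h₁ : Runs I p s s₁ t₁) (h₂ : Runs I p s s₂ t₂) : s₁ = s₂ ∧ t₁ = t₂ := by
  induction h₁ generalizing s₂ t₂ with
  | skip => cases h₂; exact ⟨rfl, rfl⟩
  | nset => cases h₂; exact ⟨rfl, rfl⟩
  | rset => cases h₂; exact ⟨rfl, rfl⟩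
  | seq _ _ ihp ihq =>
    cases h₂ with
    | seq hp hq =>
      obtain ⟨rfl, rfl⟩ := ihp hp
      obtain ⟨rfl, rfl⟩ := ihq hq
      exact ⟨rfl, rfl⟩
  | ite_true hb _ ih =>
    cases h₂ with
    | ite_true _ hp => obtain ⟨rfl, rfl⟩ := ih hp; exact ⟨rfl, rfl⟩
    | ite_false hb' _ => exact absurd hb hb'
  | ite_false hb _ ih =>
    cases h₂ with
    | ite_true hb' _ => exact absurd hb' hb
    | ite_false _ hq => obtain ⟨rfl, rfl⟩ := ih hq; exact ⟨rfl, rfl⟩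
  | loop_done hb =>
    cases h₂ with
    | loop_done _ => exact ⟨rfl, rfl⟩
    | loop_step hb' _ _ => exact absurd hb' hb
  | loop_step hb _ _ ihp ihl =>
    cases h₂ with
    | loop_done hb' => exact absurd hb hb'
    | loop_step _ hp hl =>
      obtain ⟨rfl, rfl⟩ := ihp hp
      obtain ⟨rfl, rfl⟩ := ihl hl
      exact ⟨rfl, rfl⟩

end Semantics

end FairDiv

end

/-! Fix a threshold `t > 0`. From each class take a net: points pairwise at distance at least `m t`
that come within `m t` of the whole class, unless there are already `k` of them. Join net points of
any classes at distance less than `t`. No path contains two points of one class: a segment between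
two such points with no other repeated class has at most `m` edges, hence spans less than `m t`. So
a component contains at most one point of each class and has diameter at most `(m - 1) t`
(`col_injOn_path`, `dist_le_of_reachable`), while points of different components are at least `t`
apart. Giving each class as many components as its quota demands, no component twice, yields a fair
set of diversity at least `t`.

Conversely, if a fair set has diversity at least `(3m - 1) t`, moving its elements to nearby net
points keeps them in different components, because `m t + (m - 1) t + m t = (3m - 1) t`. Hall's
condition `Rich` follows (`rich_of_fair`). Augmenting paths either complete the assignment or
exhibit a set of classes violating Hall's condition (`PrimOrder.not_rich`), so a test at `t` decides
`Rich` exactly.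

It remains to find `lo < hi` such that `lo` passes or is `0`, and no `t` in `(lo, hi]` passes; then
the optimum is at most `(3m - 1) lo` (`opt_le_of_not_passes`). One run of farthest point sampling,
with `k` rounds in each class, serves all thresholds: the net for `t` consists of the samples whose
radius is at least `m t` (`Good`), so it changes only at the at most `k m` numbers `rad p / m`. Once
the net is fixed, Prim's order turns the components for every `t` into runs that start at the keys
not below `t` (`PrimOrder.reachable_iff`), so only the keys matter. Hence two binary searches, first
among the radii, then among the keys.

Sampling takes `O(k (n + m))` steps. A test runs Prim's algorithm on at most `k m` points, then at
most `k` breadth first searches that scan at most `k m` positions for each of `m` classes: `O(k²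
m²)`. A median found by brute force costs no more, and there are `O(log (k m))` rounds. If `k ≤ 1`
or `lo = 0`, every fair set is good enough. -/

namespace FairDiv

/-! ### Reasoning about programs -/

namespace Instance

variable {n m : ℕ} (I : Instance n m)

/-- The distance as a function of natural numbers, `0` out of range. -/
noncomputable def d (u v : ℕ) : ℝ := if h : u < n ∧ v < n then I.dist ⟨u, h.1⟩ ⟨v, h.2⟩ else 0

/-- The colour as a function of natural numbers, `0` out of range. -/
def col (u : ℕ) : ℕ := if h : u < n then (I.color ⟨u, h⟩ : ℕ) else 0

/-- The quota as a function of natural numbers, `0` out of range. -/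
def quo (i : ℕ) : ℕ := if h : i < m then I.quota ⟨i, h⟩ else 0

theorem d_nonneg (u v : ℕ) : 0 ≤ I.d u v := by
  unfold d; split_ifs
  · exact I.dist_nonneg _ _
  · exact le_rfl

theorem d_self (u : ℕ) : I.d u u = 0 := by
  unfold d; split_ifs
  · exact I.dist_self _
  · rfl

theorem d_comm (u v : ℕ) : I.d u v = I.d v u := by
  unfold d
  by_cases h : u < n ∧ v < n
  · rw [dif_pos h, dif_pos h.symm]; exact I.dist_comm _ _
  · rw [dif_neg h, dif_neg fun h' => h h'.symm]

theorem d_triangle {u v w : ℕ} (hw : w < n) : I.d u v ≤ I.d u w + I.d w v := by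
  by_cases h : u < n ∧ v < n
  · unfold d
    rw [dif_pos h, dif_pos ⟨h.1, hw⟩, dif_pos ⟨hw, h.2⟩]
    exact I.dist_triangle _ _ _
  · have : I.d u v = 0 := dif_neg h
    rw [this]
    exact add_nonneg (I.d_nonneg _ _) (I.d_nonneg _ _)

theorem d_coe (u v : Fin n) : I.d u v = I.dist u v := by simp [d]

theorem col_coe (u : Fin n) : I.col u = I.color u := by simp [col]

theorem quo_coe (i : Fin m) : I.quo i = I.quota i := by simp [quo]

theorem col_lt {u : ℕ} (h : u < n) : I.col u < m := by
  unfold col; rw [dif_pos h]; exact (I.color ⟨u, h⟩).2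

theorem sum_quo : ∑ i ∈ Finset.range m, I.quo i = I.k := by
  rw [Finset.sum_range]; simp [quo, k]

end Instance

namespace Store

variable (s : Store)

@[simp] theorem nat_setNat_self (a i x : ℕ) :
    (s.setNat a i x).nat a = Function.update (s.nat a) i x := by simp [setNat]

@[simp] theorem nat_setNat_of_ne {a b : ℕ} (h : b ≠ a) (i x : ℕ) :
    (s.setNat a i x).nat b = s.nat b := by simp [setNat, h]

@[simp] theorem real_setNat (a i x : ℕ) : (s.setNat a i x).real = s.real := rfl

@[simp] theorem real_setReal_self (a i : ℕ) (x : ℝ) :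
    (s.setReal a i x).real a = Function.update (s.real a) i x := by simp [setReal]

@[simp] theorem real_setReal_of_ne {a b : ℕ} (h : b ≠ a) (i : ℕ) (x : ℝ) :
    (s.setReal a i x).real b = s.real b := by simp [setReal, h]

@[simp] theorem nat_setReal (a i : ℕ) (x : ℝ) : (s.setReal a i x).nat = s.nat := rfl

end Store

section Eval

variable {n m : ℕ} (I : Instance n m) (s : Store)

@[simp] theorem NExp.eval_lit (c : ℕ) : (NExp.lit c).eval I s = c := rfl
@[simp] theorem NExp.eval_get (a : ℕ) (i : NExp) :
    (NExp.get a i).eval I s = s.nat a (i.eval I s) := rfl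
@[simp] theorem NExp.eval_add (x y : NExp) :
    (NExp.add x y).eval I s = x.eval I s + y.eval I s := rfl
@[simp] theorem NExp.eval_sub (x y : NExp) :
    (NExp.sub x y).eval I s = x.eval I s - y.eval I s := rfl
@[simp] theorem NExp.eval_numClasses : NExp.numClasses.eval I s = m := rfl
@[simp] theorem NExp.eval_color (u : NExp) :
    (NExp.color u).eval I s = I.col (u.eval I s) := rfl
@[simp] theorem NExp.eval_quota (i : NExp) :
    (NExp.quota i).eval I s = I.quo (i.eval I s) := rfl
@[simp] theorem RExp.eval_get (a : ℕ) (i : NExp) :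
    (RExp.get a i).eval I s = s.real a (i.eval I s) := rfl
@[simp] theorem RExp.eval_ofNat (x : NExp) : (RExp.ofNat x).eval I s = (x.eval I s : ℝ) := rfl
@[simp] theorem RExp.eval_add (x y : RExp) :
    (RExp.add x y).eval I s = x.eval I s + y.eval I s := rfl
@[simp] theorem RExp.eval_sub (x y : RExp) :
    (RExp.sub x y).eval I s = x.eval I s - y.eval I s := rfl
@[simp] theorem RExp.eval_mul (x y : RExp) :
    (RExp.mul x y).eval I s = x.eval I s * y.eval I s := rfl
@[simp] theorem RExp.eval_div (x y : RExp) :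
    (RExp.div x y).eval I s = x.eval I s / y.eval I s := rfl
@[simp] theorem RExp.eval_dist (u v : NExp) :
    (RExp.dist u v).eval I s = I.d (u.eval I s) (v.eval I s) := rfl
@[simp] theorem BExp.holds_nlt (x y : NExp) :
    (BExp.nlt x y).Holds I s ↔ x.eval I s < y.eval I s := Iff.rfl
@[simp] theorem BExp.holds_rlt (x y : RExp) :
    (BExp.rlt x y).Holds I s ↔ x.eval I s < y.eval I s := Iff.rfl
@[simp] theorem BExp.holds_not (b : BExp) : (BExp.not b).Holds I s ↔ ¬ b.Holds I s := Iff.rfl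
@[simp] theorem BExp.holds_and (b c : BExp) :
    (BExp.and b c).Holds I s ↔ b.Holds I s ∧ c.Holds I s := Iff.rfl

end Eval

/-- The arrays of natural numbers that a program may write to. -/
def Prog.natWrites : Prog → List ℕ
  | .skip => []
  | .nset a _ _ => [a]
  | .rset _ _ _ => []
  | .seq p q => p.natWrites ++ q.natWrites
  | .ite _ p q => p.natWrites ++ q.natWrites
  | .loop _ p => p.natWrites

/-- The arrays of reals that a program may write to. -/
def Prog.realWrites : Prog → List ℕ
  | .skip => []
  | .nset _ _ _ => []
  | .rset a _ _ => [a]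
  | .seq p q => p.realWrites ++ q.realWrites
  | .ite _ p q => p.realWrites ++ q.realWrites
  | .loop _ p => p.realWrites

/-- Two memories differ only on the arrays that `p` may write to. -/
structure Frame (p : Prog) (s s' : Store) : Prop where
  nat : ∀ a, a ∉ p.natWrites → s'.nat a = s.nat a
  real : ∀ a, a ∉ p.realWrites → s'.real a = s.real a

theorem Frame.refl (p : Prog) (s : Store) : Frame p s s := ⟨fun _ _ => rfl, fun _ _ => rfl⟩

theorem Frame.trans {p : Prog} {s s' s'' : Store} (h : Frame p s s') (h' : Frame p s' s'') :
    Frame p s s'' :=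
  ⟨fun a ha => (h'.nat a ha).trans (h.nat a ha), fun a ha => (h'.real a ha).trans (h.real a ha)⟩

theorem Frame.mono {p q : Prog} {s s' : Store} (h : Frame p s s')
    (hn : p.natWrites ⊆ q.natWrites) (hr : p.realWrites ⊆ q.realWrites) : Frame q s s' :=
  ⟨fun a ha => h.nat a fun h' => ha (hn h'), fun a ha => h.real a fun h' => ha (hr h')⟩

/-! ### Total correctness with step bounds -/

section Rules

variable {n m : ℕ} {I : Instance n m}

/-- Non-interference is read off the syntax: that an array survives a subprogram becomes a decidable
non-membership in its list of writes. -/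
theorem Runs.frame {p : Prog} {s s' : Store} {t : ℕ} (h : Runs I p s s' t) : Frame p s s' := by
  induction h with
  | skip s => exact Frame.refl _ _
  | nset a i x s =>
    exact ⟨fun b hb => Store.nat_setNat_of_ne _ (by simpa [Prog.natWrites] using hb) _ _,
      fun b _ => rfl⟩
  | rset a i x s =>
    exact ⟨fun b _ => rfl,
      fun b hb => Store.real_setReal_of_ne _ (by simpa [Prog.realWrites] using hb) _ _⟩
  | seq _ _ ihp ihq =>
    exact (ihp.mono (List.subset_append_left _ _) (List.subset_append_left _ _)).trans
      (ihq.mono (List.subset_append_right _ _) (List.subset_append_right _ _))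
  | ite_true _ _ ih => exact ih.mono (List.subset_append_left _ _) (List.subset_append_left _ _)
  | ite_false _ _ ih =>
    exact ih.mono (List.subset_append_right _ _) (List.subset_append_right _ _)
  | loop_done _ => exact Frame.refl _ _
  | loop_step _ _ _ ihp ihl =>
    exact Frame.trans (p := .loop _ _) ⟨ihp.nat, ihp.real⟩ ihl

/-- Started with memory `s`, the program `p` terminates within `T` steps with a memory
satisfying `Q`. -/
def Does (I : Instance n m) (p : Prog) (s : Store) (T : ℕ) (Q : Store → Prop) : Prop :=
  ∃ s' t, Runs I p s s' t ∧ t ≤ T ∧ Q s'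

variable {p q : Prog} {s : Store} {T T₁ T₂ : ℕ} {Q R : Store → Prop}

/-- The frame is passed on to the postcondition, so a specification need only speak of the arrays
that its program changes. -/
theorem Does.mono (h : Does I p s T₁ R) (hT : T₁ ≤ T) (hQ : ∀ s', Frame p s s' → R s' → Q s') :
    Does I p s T Q := by
  obtain ⟨s', t, hr, ht, hR⟩ := h
  exact ⟨s', t, hr, ht.trans hT, hQ s' hr.frame hR⟩

theorem Does.le (h : Does I p s T₁ Q) (hT : T₁ ≤ T) : Does I p s T Q :=
  h.mono hT fun _ _ h => h

theorem Does.seq (hp : Does I p s T₁ R)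
    (hq : ∀ s', Frame p s s' → R s' → Does I q s' T₂ Q) : Does I (.seq p q) s (T₁ + T₂) Q := by
  obtain ⟨s', t, hr, ht, hR⟩ := hp
  obtain ⟨s'', t', hr', ht', hQ⟩ := hq s' hr.frame hR
  exact ⟨s'', t + t', hr.seq hr', add_le_add ht ht', hQ⟩

theorem Does.ite {b : BExp} (hp : b.Holds I s → Does I p s T Q)
    (hq : ¬ b.Holds I s → Does I q s T Q) : Does I (.ite b p q) s (T + 1) Q := by
  by_cases hb : b.Holds I s
  · obtain ⟨s', t, hr, ht, hQ⟩ := hp hb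
    exact ⟨s', t + 1, hr.ite_true hb, by omega, hQ⟩
  · obtain ⟨s', t, hr, ht, hQ⟩ := hq hb
    exact ⟨s', t + 1, hr.ite_false hb, by omega, hQ⟩

/-- Weakest precondition of a loop-free program. -/
def Prog.wp (I : Instance n m) : Prog → (Store → Prop) → Store → Prop
  | .skip, Q, s => Q s
  | .nset a i x, Q, s => Q (s.setNat a (i.eval I s) (x.eval I s))
  | .rset a i x, Q, s => Q (s.setReal a (i.eval I s) (x.eval I s))
  | .seq p q, Q, s => p.wp I (q.wp I Q) s
  | .ite b p q, Q, s => (b.Holds I s → p.wp I Q s) ∧ (¬ b.Holds I s → q.wp I Q s)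
  | .loop _ _, _, _ => False

/-- A bound for the number of steps of a loop-free program. -/
def Prog.cost : Prog → ℕ
  | .skip => 1
  | .nset _ _ _ => 1
  | .rset _ _ _ => 1
  | .seq p q => p.cost + q.cost
  | .ite _ p q => p.cost + q.cost + 1
  | .loop _ _ => 0

/-- Loop-free code is verified by symbolic execution, unfolding `Prog.wp`. The cost `0` of a loop is
harmless, since its precondition is `False`. -/
theorem Does.of_wp (h : p.wp I Q s) : Does I p s p.cost Q := by
  induction p generalizing s Q with
  | skip => exact ⟨_, _, .skip s, le_rfl, h⟩
  | nset a i x => exact ⟨_, _, .nset a i x s, le_rfl, h⟩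
  | rset a i x => exact ⟨_, _, .rset a i x s, le_rfl, h⟩
  | seq p q ihp ihq => exact (ihp h).seq fun s' _ h' => ihq h'
  | ite b p q ihp ihq =>
    exact Does.ite (T := p.cost + q.cost) (fun hb => (ihp (h.1 hb)).le (by omega))
      (fun hb => (ihq (h.2 hb)).le (by omega))
  | loop b p => exact h.elim

/-- `V` bounds the number of remaining rounds. Each round pays for the body and one test; the
trailing `1` is the failing test. -/
theorem Does.while {b : BExp} (Inv : Store → Prop) (V : Store → ℕ) (h0 : Inv s)
    (hstep : ∀ s', Frame p s s' → Inv s' → b.Holds I s' →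
      Does I p s' T fun s'' => Inv s'' ∧ V s'' < V s')
    (hQ : ∀ s', Frame p s s' → Inv s' → ¬ b.Holds I s' → Q s') :
    Does I (.loop b p) s (V s * (T + 1) + 1) Q := by
  suffices H : ∀ v s', V s' ≤ v → Frame p s s' → Inv s' →
      Does I (.loop b p) s' (v * (T + 1) + 1) Q from H _ s le_rfl (Frame.refl _ _) h0
  intro v
  induction v with
  | zero =>
    intro s' hv hf hi
    by_cases hb : b.Holds I s'
    · obtain ⟨_, _, _, _, _, h⟩ := hstep s' hf hi hb
      omega
    · exact ⟨s', 1, .loop_done hb, by omega, hQ s' hf hi hb⟩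
  | succ v ih =>
    intro s' hv hf hi
    by_cases hb : b.Holds I s'
    · obtain ⟨s₁, t₁, hr₁, ht₁, hi₁, hv₁⟩ := hstep s' hf hi hb
      obtain ⟨s₂, t₂, hr₂, ht₂, hq⟩ := ih s₁ (by omega) (hf.trans hr₁.frame) hi₁
      exact ⟨s₂, _, .loop_step hb hr₁ hr₂, by rw [Nat.succ_mul]; omega, hq⟩
    · exact ⟨s', 1, .loop_done hb, by omega, hQ s' hf hi hb⟩

/-- A scalar variable of natural number type. -/
abbrev NExp.var (a : ℕ) : NExp := .get a (.lit 0)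

/-- A scalar variable of real type. -/
abbrev RExp.var (a : ℕ) : RExp := .get a (.lit 0)

/-- Assignment to a scalar variable of natural number type. -/
abbrev Prog.nass (a : ℕ) (x : NExp) : Prog := .nset a (.lit 0) x

/-- Assignment to a scalar variable of real type. -/
abbrev Prog.rass (a : ℕ) (x : RExp) : Prog := .rset a (.lit 0) x

/-- Sequential composition of a list of programs. -/
def Prog.block : List Prog → Prog
  | [] => .skip
  | [p] => p
  | p :: q :: l => .seq p (Prog.block (q :: l))

/-- `for v < e do p` -/
def Prog.for (v : ℕ) (e : NExp) (p : Prog) : Prog :=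
  .seq (.nass v (.lit 0)) (.loop (.nlt (.var v) e) (.seq p (.nass v (.add (.var v) (.lit 1)))))

/-- The invariant receives the counter as an argument and must ignore the cell that stores it, so
that incrementing does no damage. A round pays for a test and an increment; the trailing `2` is the
initialisation and the failing test. -/
theorem Does.for {v : ℕ} {e : NExp} {N : ℕ} (Inv : ℕ → Store → Prop)
    (hv : v ∉ p.natWrites)
    (hInv : ∀ j s x, Inv j s → Inv j (s.setNat v 0 x))
    (hN : ∀ s', Frame (.for v e p) s s' → e.eval I s' = N)
    (h0 : Inv 0 s)
    (hstep : ∀ j < N, ∀ s', Frame (.for v e p) s s' → s'.nat v 0 = j → Inv j s' →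
      Does I p s' T (Inv (j + 1)))
    (hQ : ∀ s', Frame (.for v e p) s s' → Inv N s' → Q s') :
    Does I (.for v e p) s (N * (T + 2) + 2) Q := by
  have hsub : ∀ {s'}, Frame (.seq p (.nass v (.add (.var v) (.lit 1)))) (s.setNat v 0 0) s' →
      Frame (.for v e p) s s' := by
    intro s' h
    refine Frame.trans (s' := s.setNat v 0 0) ⟨fun a ha => ?_, fun a _ => rfl⟩
      (h.mono (List.subset_append_right _ _) (List.subset_append_right _ _))
    refine Store.nat_setNat_of_ne _ ?_ _ _
    rintro rfl
    exact ha (List.mem_append_left _ (List.mem_singleton.2 rfl))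
  have h1 : Does I (.nass v (.lit 0)) s 1 (fun s' => s' = s.setNat v 0 0) :=
    ⟨_, _, .nset _ _ _ _, le_rfl, rfl⟩
  refine (h1.seq (T₂ := N * (T + 2) + 1) (Q := Q) ?_).le (by omega)
  rintro _ - rfl
  have := Does.while (I := I) (b := .nlt (.var v) e) (T := T + 1)
    (p := .seq p (.nass v (.add (.var v) (.lit 1)))) (s := s.setNat v 0 0) (Q := Q)
    (fun s' => s'.nat v 0 ≤ N ∧ Inv (s'.nat v 0) s') (fun s' => N - s'.nat v 0)
    ⟨by simp, by simpa using hInv 0 s 0 h0⟩ ?_ ?_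
  · refine this.le ?_
    simp
  · rintro s' hf ⟨-, hi⟩ hb
    have hlt : s'.nat v 0 < N := by
      have := hN s' (hsub hf)
      simp only [BExp.holds_nlt, this] at hb
      simpa using hb
    refine (hstep _ hlt s' (hsub hf) rfl hi).seq (T₂ := 1) ?_
    intro s'' hf' hi'
    refine ⟨_, _, .nset _ _ _ _, le_rfl, ?_⟩
    have hv' : s''.nat v 0 = s'.nat v 0 := by rw [hf'.nat v hv]
    refine ⟨⟨?_, ?_⟩, ?_⟩
    · simp; omega
    · simp only [NExp.eval_lit, NExp.eval_add, NExp.eval_get, hv']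
      have := hInv _ s'' (s'.nat v 0 + 1) hi'
      simpa using this
    · simp; omega
  · rintro s' hf ⟨hle, hi⟩ hb
    have hN' := hN s' (hsub hf)
    have : s'.nat v 0 = N := by
      simp only [BExp.holds_nlt, hN'] at hb
      simp at hb; omega
    exact hQ s' (hsub hf) (this ▸ hi)

end Rules

/-! ### Nets and their components -/

section Net

variable {n m : ℕ} (I : Instance n m) (pt : ℕ → ℕ)

/-- The graph on the points of `Y` that joins points at distance less than `t`. -/
def near (Y : Finset ℕ) (t : ℝ) : SimpleGraph ℕ where
  Adj a b := a ≠ b ∧ a ∈ Y ∧ b ∈ Y ∧ I.d (pt a) (pt b) < t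
  symm.symm _ _ h := ⟨h.1.symm, h.2.2.1, h.2.1, by rw [I.d_comm]; exact h.2.2.2⟩
  loopless.irrefl _ h := h.1 rfl

variable {I pt} {Y : Finset ℕ} {t : ℝ}

theorem near_walk_mem {a b : ℕ} (w : (near I pt Y t).Walk a b) (ha : a ∈ Y) :
    ∀ x ∈ w.support, x ∈ Y := by
  induction w with
  | nil => simpa using ha
  | cons h w ih =>
    intro x hx
    rcases List.mem_cons.1 (by simpa using hx) with rfl | hx
    · exact ha
    · exact ih h.2.2.1 x hx

/-- The strict form for nonempty walks is what contradicts a separation of exactly `m t` in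
`col_injOn_path`. -/
theorem near_walk_dist (hpt : ∀ p ∈ Y, pt p < n) {a b : ℕ} (w : (near I pt Y t).Walk a b) :
    I.d (pt a) (pt b) ≤ w.length * t ∧ (0 < w.length → I.d (pt a) (pt b) < w.length * t) := by
  induction w with
  | nil => simp [I.d_self]
  | @cons a b c h w ih =>
    have h1 := I.d_triangle (u := pt a) (v := pt c) (hpt b h.2.2.1)
    have h2 := h.2.2.2
    have : I.d (pt a) (pt c) < ((w.length : ℝ) + 1) * t := by linarith [ih.1]
    simp only [SimpleGraph.Walk.length_cons, Nat.cast_add, Nat.cast_one]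
    exact ⟨this.le, fun _ => this⟩

/-- `Y` is a set of points such that points of the same colour have distance at least `m t`. -/
structure Sep (I : Instance n m) (pt : ℕ → ℕ) (Y : Finset ℕ) (t : ℝ) : Prop where
  pos : 0 < t
  lt : ∀ p ∈ Y, pt p < n
  sep : ∀ p ∈ Y, ∀ q ∈ Y, p ≠ q → I.col (pt p) = I.col (pt q) → (m : ℝ) * t ≤ I.d (pt p) (pt q)

/-- Pigeonhole: there are only `m` colours, and a walk has one edge fewer than it has vertices. -/
theorem length_lt_of_col_injOn (hY : Sep I pt Y t) {a b : ℕ} {w : (near I pt Y t).Walk a b}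
    (hw : w.IsPath) (ha : a ∈ Y)
    (hinj : ∀ x ∈ w.support, ∀ y ∈ w.support, I.col (pt x) = I.col (pt y) → x = y) :
    w.length < m := by
  have hnd : (w.support.map fun x => I.col (pt x)).Nodup :=
    List.Nodup.map_on hinj hw.support_nodup
  have h1 : (w.support.map fun x => I.col (pt x)).toFinset ⊆ Finset.range m := by
    intro c hc
    simp only [List.mem_toFinset, List.mem_map] at hc
    obtain ⟨x, hx, rfl⟩ := hc
    exact Finset.mem_range.2 (I.col_lt (hY.lt x (near_walk_mem w ha x hx)))
  have h2 := Finset.card_le_card h1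
  rw [List.toFinset_card_of_nodup hnd] at h2
  simp only [List.length_map, SimpleGraph.Walk.length_support, Finset.card_range] at h2
  omega

/-- Induction by prepending a vertex `a`. If a later vertex `x` had the colour of `a`, the part of
the tail up to `x`, whose colours are distinct, would have at most `m - 1` edges. With the first
edge this makes at most `m`, so `a` and `x` would be closer than `m t`. -/
theorem col_injOn_path (hY : Sep I pt Y t) {a b : ℕ} (w : (near I pt Y t).Walk a b)
    (hw : w.IsPath) (ha : a ∈ Y) :
    ∀ x ∈ w.support, ∀ y ∈ w.support, I.col (pt x) = I.col (pt y) → x = y := by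
  induction w with
  | nil => simp
  | @cons a b c h w ih =>
    have hw' := (SimpleGraph.Walk.cons_isPath_iff h w).1 hw
    have ih := ih hw'.1 h.2.2.1
    have key : ∀ x ∈ w.support, I.col (pt a) ≠ I.col (pt x) := by
      intro x hx hc
      have hl := length_lt_of_col_injOn hY (hw'.1.takeUntil hx) h.2.2.1
        fun y hy z hz => ih y (w.support_takeUntil_subset_support hx hy) z
          (w.support_takeUntil_subset_support hx hz)
      have hd := (near_walk_dist hY.lt (SimpleGraph.Walk.cons h (w.takeUntil x hx))).2 (by simp)
      have hs := hY.sep a ha x (near_walk_mem w h.2.2.1 x hx) (fun h' => hw'.2 (h' ▸ hx)) hc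
      have : ((SimpleGraph.Walk.cons h (w.takeUntil x hx)).length : ℝ) ≤ m := by
        exact_mod_cast (by simpa using hl)
      nlinarith [hY.pos]
    intro x hx y hy hxy
    simp only [SimpleGraph.Walk.support_cons, List.mem_cons] at hx hy
    rcases hx with rfl | hx <;> rcases hy with rfl | hy
    · rfl
    · exact absurd hxy (key y hy)
    · exact absurd hxy.symm (key x hx)
    · exact ih x hx y hy hxy

theorem dist_le_of_reachable (hY : Sep I pt Y t) {a b : ℕ} (ha : a ∈ Y)
    (h : (near I pt Y t).Reachable a b) : I.d (pt a) (pt b) ≤ ((m : ℝ) - 1) * t := by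
  obtain ⟨w, hw⟩ := h.exists_isPath
  have h1 := length_lt_of_col_injOn hY hw ha (col_injOn_path hY w hw ha)
  have h2 := (near_walk_dist hY.lt w).1
  have h3 : (w.length : ℝ) + 1 ≤ m := by exact_mod_cast h1
  nlinarith [hY.pos]

theorem eq_of_reachable_of_col (hY : Sep I pt Y t) {a b : ℕ} (ha : a ∈ Y)
    (h : (near I pt Y t).Reachable a b) (hc : I.col (pt a) = I.col (pt b)) : a = b := by
  obtain ⟨w, hw⟩ := h.exists_isPath
  exact col_injOn_path hY w hw ha a w.start_mem_support b w.end_mem_support hc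

/-- No two points of `S` lie in the same component. -/
def Indep (I : Instance n m) (pt : ℕ → ℕ) (Y : Finset ℕ) (t : ℝ) (S : Finset ℕ) : Prop :=
  ∀ p ∈ S, ∀ q ∈ S, (near I pt Y t).Reachable p q → p = q

/-- Hall's condition for assigning components to the classes: the classes in `R` meet at least
as many components as they need. -/
def Rich (I : Instance n m) (pt : ℕ → ℕ) (Y : Finset ℕ) (t : ℝ) : Prop :=
  ∀ R ⊆ Finset.range m, ∃ S ⊆ Y, (∀ p ∈ S, I.col (pt p) ∈ R) ∧ Indep I pt Y t S ∧
    ∑ i ∈ R, I.quo i ≤ S.card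

theorem card_fair {S : Finset (Fin n)} (hS : I.IsFair S) {R : Finset ℕ}
    (hR : R ⊆ Finset.range m) :
    (S.filter fun u : Fin n => I.col u ∈ R).card = ∑ i ∈ R, I.quo i := by
  rw [Finset.card_eq_sum_card_fiberwise (f := fun u : Fin n => I.col u) (t := R)]
  · refine Finset.sum_congr rfl fun i hi => ?_
    have him := Finset.mem_range.1 (hR hi)
    have h1 := hS ⟨i, him⟩
    have h2 : I.quo i = I.quota ⟨i, him⟩ := I.quo_coe ⟨i, him⟩
    rw [h2, ← h1]
    congr 1
    ext u
    simp only [Finset.mem_filter, Finset.mem_inter, Instance.group, Finset.mem_univ, true_and,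
      I.col_coe, Fin.ext_iff]
    constructor
    · rintro ⟨⟨h, -⟩, h'⟩; exact ⟨h, h'⟩
    · rintro ⟨h, h'⟩; exact ⟨⟨h, by rw [h']; exact hi⟩, h'⟩
  · intro u hu
    have hu' : u ∈ S.filter fun u : Fin n => I.col u ∈ R := by exact_mod_cast hu
    exact (Finset.mem_filter.1 hu').2

/-- `Y` is a `t`-net: for each class it contains either `k` points or a point close to every
element of the class. -/
def Covers (I : Instance n m) (pt : ℕ → ℕ) (Y : Finset ℕ) (t : ℝ) : Prop :=
  ∀ c < m, I.k ≤ (Y.filter fun p => I.col (pt p) = c).card ∨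
    ∀ u < n, I.col u = c → ∃ p ∈ Y, I.col (pt p) = c ∧ I.d u (pt p) < m * t

/-- If a class in `R` has `k` points in the net, these lie in `k` different components, which
suffices for all quotas together. Otherwise every class in `R` is covered, and the elements of `S`
in these classes can be moved to net points of their own class. -/
theorem rich_of_fair (hY : Sep I pt Y t) (hcov : Covers I pt Y t) {S : Finset (Fin n)}
    (hS : I.IsFair S) (hd : ∀ u ∈ S, ∀ v ∈ S, u ≠ v → (3 * (m : ℝ) - 1) * t ≤ I.dist u v) :
    Rich I pt Y t := by
  intro R hR
  by_cases hk : ∃ c ∈ R, I.k ≤ (Y.filter fun p => I.col (pt p) = c).card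
  · obtain ⟨c, hc, hk⟩ := hk
    refine ⟨_, Finset.filter_subset _ _, ?_, ?_, le_trans ?_ hk⟩
    · intro p hp
      rw [(Finset.mem_filter.1 hp).2]; exact hc
    · intro p hp q hq h
      rw [Finset.mem_filter] at hp hq
      exact eq_of_reachable_of_col hY hp.1 h (hp.2.trans hq.2.symm)
    · rw [← I.sum_quo]
      exact Finset.sum_le_sum_of_subset hR
  · push Not at hk
    have hf : ∀ u : Fin n, I.col u ∈ R → ∃ p ∈ Y, I.col (pt p) = I.col u ∧
        I.d u (pt p) < m * t := by
      intro u hu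
      rcases hcov _ (Finset.mem_range.1 (hR hu)) with h | h
      · exact absurd h (not_le.2 (hk _ hu))
      · exact h u u.2 rfl
    choose! f hfY hfc hfd using hf
    have hinj : ∀ u ∈ S, ∀ v ∈ S, I.col u ∈ R → I.col v ∈ R →
        (near I pt Y t).Reachable (f u) (f v) → u = v := by
      intro u hu v hv huR hvR h
      by_contra hne
      -- On the way from `u` to `v` through their net points, the two outer pieces are shorter than
      -- `m t` and the middle one is at most `(m - 1) t`, in total less than `(3 m - 1) t`.
      have h1 := hd u hu v hv hne
      have h2 := dist_le_of_reachable hY (hfY u huR) h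
      have h3 := I.d_triangle (u := u) (v := v) (hY.lt _ (hfY u huR))
      have h4 := I.d_triangle (u := pt (f u)) (v := v) (hY.lt _ (hfY v hvR))
      have h5 := hfd u huR
      have h6 := hfd v hvR
      rw [I.d_comm] at h6
      rw [I.d_coe] at h3
      linarith
    refine ⟨(S.filter fun u : Fin n => I.col u ∈ R).image f, ?_, ?_, ?_, ?_⟩
    · intro p hp
      simp only [Finset.mem_image, Finset.mem_filter] at hp
      obtain ⟨u, ⟨-, hu⟩, rfl⟩ := hp
      exact hfY u hu
    · intro p hp
      simp only [Finset.mem_image, Finset.mem_filter] at hp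
      obtain ⟨u, ⟨-, hu⟩, rfl⟩ := hp
      rw [hfc u hu]; exact hu
    · intro p hp q hq h
      simp only [Finset.mem_image, Finset.mem_filter] at hp hq
      obtain ⟨u, ⟨hu, huR⟩, rfl⟩ := hp
      obtain ⟨v, ⟨hv, hvR⟩, rfl⟩ := hq
      rw [hinj u hu v hv huR hvR h]
    · rw [Finset.card_image_of_injOn, card_fair hS hR]
      intro u hu v hv huv
      simp only [Finset.coe_filter, Set.mem_ofPred_eq] at hu hv
      refine hinj u hu.1 v hv.1 hu.2 hv.2 ?_
      have huv : f u = f v := huv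
      rw [huv]

end Net

/-! ### Prim's order -/

section Prim

variable {n m : ℕ} {I : Instance n m} {pt : ℕ → ℕ}

/-- `y 0, …, y (M - 1)` lists the set `Y` in the order in which Prim's algorithm visits it, and
`key j` is the distance of `y j` to its predecessors. -/
structure PrimOrder (I : Instance n m) (pt : ℕ → ℕ) (Y : Finset ℕ) (M : ℕ) (y : ℕ → ℕ)
    (key : ℕ → ℝ) : Prop where
  inj : ∀ a < M, ∀ b < M, y a = y b → a = b
  mem : ∀ p, p ∈ Y ↔ ∃ a < M, y a = p
  att : ∀ j < M, 0 < j → ∃ i < j, I.d (pt (y i)) (pt (y j)) = key j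
  cut : ∀ j < M, 0 < j → ∀ i < j, ∀ l < M, j ≤ l → key j ≤ I.d (pt (y i)) (pt (y l))

/-- Position at which the component of position `j` starts. -/
noncomputable def lab (key : ℕ → ℝ) (t : ℝ) : ℕ → ℕ
  | 0 => 0
  | j + 1 => if key (j + 1) < t then lab key t j else j + 1

variable {Y : Finset ℕ} {M : ℕ} {y : ℕ → ℕ} {key : ℕ → ℝ} {t : ℝ}

theorem lab_le (j : ℕ) : lab key t j ≤ j := by
  induction j with
  | zero => exact le_rfl
  | succ j ih => unfold lab; split_ifs <;> omega

theorem lab_start (j : ℕ) : lab key t j = 0 ∨ t ≤ key (lab key t j) := by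
  induction j with
  | zero => exact Or.inl rfl
  | succ j ih =>
    by_cases h : key (j + 1) < t
    · simp only [lab, if_pos h]; exact ih
    · simp only [lab, if_neg h]; exact Or.inr (not_lt.1 h)

/-- The positions with a common label form an interval that starts at the label itself. -/
theorem lab_eq_of_between {c j : ℕ} (hc : lab key t j ≤ c) (hj : c ≤ j) :
    lab key t c = lab key t j := by
  induction j with
  | zero => rw [Nat.le_zero.1 hj]
  | succ j ih =>
    by_cases h : key (j + 1) < t
    · simp only [lab, if_pos h] at hc ⊢
      rcases Nat.lt_or_ge j c with h' | h'
      · obtain rfl : c = j + 1 := by omega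
        simp [lab, h]
      · exact ih hc h'
    · simp only [lab, if_neg h] at hc
      obtain rfl : c = j + 1 := by omega
      rfl

/-- A position `j` that does not start a run is adjacent to an earlier position `i`. This `i` cannot
precede the start of the run, where a key of at least `t` bounds from below all distances across; so
`i` is in the same run and induction applies. -/
theorem PrimOrder.reachable_lab (h : PrimOrder I pt Y M y key) {j : ℕ} (hj : j < M) :
    (near I pt Y t).Reachable (y (lab key t j)) (y j) := by
  induction j using Nat.strong_induction_on with
  | _ j ih =>
    rcases (lab_le (key := key) (t := t) j).lt_or_eq with hlt | heq
    · have hkey : key j < t := by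
        obtain ⟨j, rfl⟩ := Nat.exists_eq_succ_of_ne_zero (by omega : j ≠ 0)
        by_contra hc
        simp [lab, hc] at hlt
      obtain ⟨i, hij, hi⟩ := h.att j hj (by omega)
      have hli : lab key t j ≤ i := by
        by_contra hlt'
        push Not at hlt'
        rcases lab_start (key := key) (t := t) j with h0 | h0
        · omega
        · have := h.cut (lab key t j) (by omega) (by omega) i hlt' j hj hlt.le
          linarith
      have h1 := ih i hij (by omega)
      rw [lab_eq_of_between hli hij.le] at h1
      refine h1.trans (SimpleGraph.Adj.reachable ⟨?_, ?_, ?_, ?_⟩)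
      · intro he
        have := h.inj i (by omega) j hj he
        omega
      · exact (h.mem _).2 ⟨i, by omega, rfl⟩
      · exact (h.mem _).2 ⟨j, hj, rfl⟩
      · rw [hi]; exact hkey
    · rw [heq]

/-- No edge crosses the start of a run, because the key there is at least `t` and bounds every
distance across by `cut`. -/
theorem PrimOrder.lab_eq_of_adj (h : PrimOrder I pt Y M y key) {a b : ℕ} (ha : a < M) (hb : b < M)
    (hab : I.d (pt (y a)) (pt (y b)) < t) : lab key t a = lab key t b := by
  wlog hle : a ≤ b generalizing a b
  · exact (this hb ha (by rw [I.d_comm]; exact hab) (by omega)).symm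
  refine lab_eq_of_between ?_ hle
  by_contra hlt
  push Not at hlt
  rcases lab_start (key := key) (t := t) b with h0 | h0
  · omega
  · have hl := lab_le (key := key) (t := t) b
    have := h.cut (lab key t b) (by omega) (by omega) a hlt b hb hl
    linarith

theorem PrimOrder.reachable_iff (h : PrimOrder I pt Y M y key) {a b : ℕ} (ha : a < M)
    (hb : b < M) :
    (near I pt Y t).Reachable (y a) (y b) ↔ lab key t a = lab key t b := by
  constructor
  · rintro ⟨w⟩
    suffices H : ∀ {p q : ℕ} (w : (near I pt Y t).Walk p q) (a b : ℕ), a < M → b < M → y a = p →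
        y b = q → lab key t a = lab key t b from H w a b ha hb rfl rfl
    intro p q w
    induction w with
    | nil =>
      intro a b ha hb hap hbp
      rw [h.inj a ha b hb (hap.trans hbp.symm)]
    | @cons u v x hadj w ih =>
      rintro a b ha hb rfl hbp
      obtain ⟨c, hc, rfl⟩ := (h.mem _).1 hadj.2.2.1
      exact (h.lab_eq_of_adj ha hc hadj.2.2.2).trans (ih c b hc hb rfl hbp)
  · intro he
    have h1 := h.reachable_lab (t := t) ha
    rw [he] at h1
    exact h1.symm.trans (h.reachable_lab hb)

theorem lab_congr {t' : ℝ} {j : ℕ} (h : ∀ i, 0 < i → i ≤ j → (key i < t ↔ key i < t')) :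
    lab key t j = lab key t' j := by
  induction j with
  | zero => rfl
  | succ j ih =>
    simp only [lab, h (j + 1) (by omega) le_rfl, ih fun i h0 hi => h i h0 (by omega)]

/-- For a fixed net the components depend on `t` only through the set of keys below `t`. This is why
the keys suffice as candidates. -/
theorem PrimOrder.rich_congr (h : PrimOrder I pt Y M y key) {t' : ℝ}
    (hk : ∀ j < M, 0 < j → (key j < t ↔ key j < t')) (hr : Rich I pt Y t) : Rich I pt Y t' := by
  intro R hR
  obtain ⟨S, hSY, hSR, hi, hc⟩ := hr R hR
  refine ⟨S, hSY, hSR, ?_, hc⟩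
  intro p hp q hq hpq
  refine hi p hp q hq ?_
  obtain ⟨a, ha, rfl⟩ := (h.mem _).1 (hSY hp)
  obtain ⟨b, hb, rfl⟩ := (h.mem _).1 (hSY hq)
  rw [h.reachable_iff ha hb] at hpq ⊢
  rwa [lab_congr fun i h0 hi => hk i (by omega) h0, lab_congr (j := b) fun i h0 hi => hk i (by omega) h0]

end Prim

/-! ### Names of the arrays -/

notation "aK" => (1 : ℕ)
notation "aSlot" => (2 : ℕ)
notation "aP" => (3 : ℕ)
notation "aPt" => (4 : ℕ)
notation "aBest" => (5 : ℕ)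
notation "aM" => (6 : ℕ)
notation "aY" => (7 : ℕ)
notation "aLab" => (8 : ℕ)
notation "aOwn" => (9 : ℕ)
notation "aOk" => (10 : ℕ)
notation "aVis" => (11 : ℕ)
notation "aPar" => (12 : ℕ)
notation "aQue" => (13 : ℕ)
notation "aHead" => (14 : ℕ)
notation "aTail" => (15 : ℕ)
notation "aFound" => (16 : ℕ)
notation "aCur" => (17 : ℕ)
notation "aNc" => (18 : ℕ)
notation "aGo" => (19 : ℕ)
notation "aLess" => (20 : ℕ)
notation "aMore" => (21 : ℕ)
notation "aTot" => (22 : ℕ)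
notation "aHas" => (23 : ℕ)
notation "aArg" => (24 : ℕ)
notation "aTmp" => (25 : ℕ)
notation "aCnt" => (26 : ℕ)
notation "vI" => (30 : ℕ)
notation "vJ" => (31 : ℕ)
notation "vL" => (32 : ℕ)
notation "vQ" => (33 : ℕ)
notation "vA" => (34 : ℕ)
notation "vB" => (35 : ℕ)
notation "rMin" => (0 : ℕ)
notation "rRad" => (1 : ℕ)
notation "rTop" => (2 : ℕ)
notation "rT" => (3 : ℕ)
notation "rKey" => (4 : ℕ)
notation "rTmp" => (5 : ℕ)
notation "rCand" => (6 : ℕ)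
notation "rLo" => (7 : ℕ)
notation "rHi" => (8 : ℕ)
notation "rPiv" => (9 : ℕ)

/-- The points with radius at least `m t`. -/
noncomputable def net (m P : ℕ) (rad : ℕ → ℝ) (t : ℝ) : Finset ℕ :=
  (Finset.range P).filter fun p => (m : ℝ) * t ≤ rad p

theorem mem_net {m P : ℕ} {rad : ℕ → ℝ} {t : ℝ} {p : ℕ} :
    p ∈ net m P rad t ↔ p < P ∧ (m : ℝ) * t ≤ rad p := by simp [net]

/-! ### Listing the net of a threshold -/

section BuildNet

variable {n m : ℕ} {I : Instance n m} {s : Store}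

/-- List the points with radius at least `m t`. -/
def buildNet : Prog := .block [
  .nass aM (.lit 0),
  .for vI (.var aP) (.ite (.rlt (.get rRad (.var vI)) (.mul (.ofNat .numClasses) (.var rT)))
    .skip
    (.block [.nset aY (.var aM) (.var vI), .nass aM (.add (.var aM) (.lit 1))]))]

theorem buildNet_spec :
    Does I buildNet s (10 * (s.nat aP 0 + 1)) fun s' =>
      s'.nat aM 0 ≤ s.nat aP 0 ∧
      (∀ a < s'.nat aM 0, ∀ b < s'.nat aM 0, s'.nat aY a = s'.nat aY b → a = b) ∧
      ∀ p, p ∈ net m (s.nat aP 0) (s.real rRad) (s.real rT 0) ↔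
        ∃ a < s'.nat aM 0, s'.nat aY a = p := by
  have h1 : Does I (.nass aM (.lit 0)) s 1 (fun s' => s'.nat aM 0 = 0) :=
    Does.of_wp (by simp [Prog.wp])
  refine Does.le (h1.seq (T₂ := s.nat aP 0 * (5 + 2) + 2) ?_) (by omega)
  intro s₁ hf₁ hM
  have eP : s₁.nat aP = s.nat aP := hf₁.nat _ (by decide)
  have er : s₁.real = s.real := funext fun a => hf₁.real a (by simp [Prog.realWrites])
  refine Does.for (fun j s' => s'.nat aM 0 ≤ j ∧ (∀ a < s'.nat aM 0, s'.nat aY a < j) ∧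
      (∀ a < s'.nat aM 0, ∀ b < s'.nat aM 0, s'.nat aY a = s'.nat aY b → a = b) ∧
      ∀ p, (p < j ∧ (m : ℝ) * s.real rT 0 ≤ s.real rRad p) ↔ ∃ a < s'.nat aM 0, s'.nat aY a = p)
    (by decide) (fun j s x h => by simpa using h) ?_ ?_ ?_ ?_
  · intro s' hf
    simp [hf.nat aP (by decide), eP]
  · simp [hM]
  · rintro j hj s' hf hv ⟨hM', hlt, hinj, hmem⟩
    have er' : s'.real = s.real :=
      (funext fun a => hf.real a (by simp [Prog.realWrites, Prog.for, Prog.block])).trans er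
    refine (Does.of_wp ?_).le (by decide : _ ≤ 5)
    simp only [Prog.wp, Prog.block, BExp.holds_rlt, RExp.eval_get, NExp.eval_get, NExp.eval_lit,
      RExp.eval_mul, RExp.eval_ofNat, NExp.eval_numClasses, er', hv, NExp.eval_add, not_lt]
    constructor
    · intro hr
      refine ⟨by omega, fun a ha => (hlt a ha).trans (by omega), hinj, fun p => ?_⟩
      rw [← hmem]
      constructor
      · rintro ⟨hp, hr'⟩
        refine ⟨?_, hr'⟩
        rcases Nat.lt_succ_iff_lt_or_eq.1 hp with h | rfl
        · exact h
        · linarith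
      · rintro ⟨hp, hr'⟩; exact ⟨by omega, hr'⟩
    · intro hr
      simp only [Store.nat_setNat_self, ne_eq, Nat.reduceEqDiff,
        not_false_eq_true, Store.nat_setNat_of_ne, Function.update_self, Function.update_apply]
      set M := s'.nat aM 0
      refine ⟨by omega, ?_, ?_, ?_⟩
      · intro a ha
        split_ifs with h
        · omega
        · have := hlt a (by omega); omega
      · intro a ha b hb hab
        split_ifs at hab with h1 h2 h2
        · omega
        · have := hlt b (by omega); omega
        · have := hlt a (by omega); omega
        · exact hinj a (by omega) b (by omega) hab
      · intro p
        constructor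
        · rintro ⟨hp, hr'⟩
          rcases Nat.lt_succ_iff_lt_or_eq.1 hp with h | rfl
          · obtain ⟨a, ha, hap⟩ := (hmem p).1 ⟨h, hr'⟩
            exact ⟨a, by omega, by rw [if_neg (by omega), hap]⟩
          · exact ⟨M, by omega, by simp⟩
        · rintro ⟨a, ha, hap⟩
          split_ifs at hap with h
          · subst hap; exact ⟨by omega, hr⟩
          · have := (hmem p).2 ⟨a, by omega, hap⟩
            exact ⟨by omega, this.2⟩
  · rintro s' hf ⟨h1, h2, h3, h4⟩
    exact ⟨h1, h3, fun p => by rw [mem_net]; exact h4 p⟩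

end BuildNet

/-! ### Prim's algorithm and the components as runs -/

section Prim

variable {n m : ℕ} {I : Instance n m} {s : Store}

/-- State of Prim's algorithm when `j` points have been visited. -/
structure PrimInv (I : Instance n m) (pt : ℕ → ℕ) (Y : Finset ℕ) (M : ℕ) (j j' : ℕ) (y : ℕ → ℕ)
    (key : ℕ → ℝ) : Prop where
  inj : ∀ a < M, ∀ b < M, y a = y b → a = b
  mem : ∀ p, p ∈ Y ↔ ∃ a < M, y a = p
  att : ∀ i < M, 0 < i → i < j → ∃ i' < i, I.d (pt (y i')) (pt (y i)) = key i
  cut : ∀ i < M, 0 < i → i < j → ∀ i' < i, ∀ l < M, i ≤ l → key i ≤ I.d (pt (y i')) (pt (y l))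
  le : ∀ l < M, j ≤ l → ∀ i < j', key l ≤ I.d (pt (y i)) (pt (y l))
  eq : ∀ l < M, j ≤ l → 0 < j' → ∃ i < j', I.d (pt (y i)) (pt (y l)) = key l

variable {pt : ℕ → ℕ} {Y : Finset ℕ} {M j : ℕ} {y : ℕ → ℕ} {key : ℕ → ℝ}

/-- Midway through a round `j + 1` points are visited, but the keys account only for the first `j`.
The chosen key is minimal among the unvisited points, so it bounds every distance between a visited
and an unvisited point: this is `cut` at the new position. -/
theorem PrimInv.swap (h : PrimInv I pt Y M j j y key) {b : ℕ} (hjb : j ≤ b) (hb : b < M)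
    (hmin : ∀ l < M, j ≤ l → key b ≤ key l) :
    PrimInv I pt Y M (j + 1) j (y ∘ Equiv.swap b j) (key ∘ Equiv.swap b j) := by
  have hlo : ∀ i < j, Equiv.swap b j i = i := fun i hi =>
    Equiv.swap_apply_of_ne_of_ne (by omega) (by omega)
  have hhi : ∀ l < M, j ≤ l → j ≤ Equiv.swap b j l ∧ Equiv.swap b j l < M := by
    intro l hl hjl
    rw [Equiv.swap_apply_def]; split_ifs <;> omega
  have hlt : ∀ l < M, Equiv.swap b j l < M := by
    intro l hl
    rw [Equiv.swap_apply_def]; split_ifs <;> omega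
  have hge : ∀ i l, i ≤ j → i ≤ l → i ≤ Equiv.swap b j l := by
    intro i l h1 h2
    rw [Equiv.swap_apply_def]; split_ifs <;> omega
  refine ⟨?_, ?_, ?_, ?_, ?_, ?_⟩
  · intro a ha c hc hac
    exact (Equiv.swap b j).injective (h.inj _ (hlt a ha) _ (hlt c hc) hac)
  · intro p
    rw [h.mem]
    constructor
    · rintro ⟨a, ha, rfl⟩
      exact ⟨Equiv.swap b j a, hlt a ha, by simp⟩
    · rintro ⟨a, ha, rfl⟩
      exact ⟨Equiv.swap b j a, hlt a ha, rfl⟩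
  · intro i hi h0 hij
    rcases Nat.lt_succ_iff_lt_or_eq.1 hij with hij | rfl
    · obtain ⟨i', hi', he⟩ := h.att i hi h0 hij
      refine ⟨i', hi', ?_⟩
      simpa [hlo i hij, hlo i' (by omega)] using he
    · obtain ⟨i', hi', he⟩ := h.eq b hb hjb h0
      refine ⟨i', hi', ?_⟩
      simpa [hlo i' hi'] using he
  · intro i hi h0 hij i' hi' l hl hil
    rcases Nat.lt_succ_iff_lt_or_eq.1 hij with hij | rfl
    · have := h.cut i hi h0 hij i' hi' _ (hlt l hl) (hge i l hij.le hil)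
      simpa [hlo i hij, hlo i' (by omega)] using this
    · have h1 := hhi l hl hil
      have h2 := h.le _ h1.2 h1.1 i' hi'
      have h3 := hmin _ h1.2 h1.1
      simpa [hlo i' hi'] using h3.trans h2
  · intro l hl hjl i hi
    have h1 := hhi l hl (by omega)
    simpa [hlo i hi] using h.le _ h1.2 h1.1 i hi
  · intro l hl hjl h0
    have h1 := hhi l hl (by omega)
    obtain ⟨i, hi, he⟩ := h.eq _ h1.2 h1.1 h0
    exact ⟨i, hi, by simpa [hlo i hi] using he⟩

open Classical in
-- In round `0` the keys are leftovers without meaning; the guard `0 < j` makes the first visited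
-- point overwrite all of them unconditionally.
theorem PrimInv.relax (h : PrimInv I pt Y M (j + 1) j y key) :
    PrimInv I pt Y M (j + 1) (j + 1) y (fun l => if l < M ∧ j < l ∧
      (0 < j → I.d (pt (y j)) (pt (y l)) < key l) then I.d (pt (y j)) (pt (y l)) else key l) := by
  refine ⟨h.inj, h.mem, ?_, ?_, ?_, ?_⟩
  · intro i hi h0 hij
    simpa [show ¬ j < i by omega] using h.att i hi h0 hij
  · intro i hi h0 hij
    simpa [show ¬ j < i by omega] using h.cut i hi h0 hij
  · intro l hl hjl i hi
    have hle : ∀ i < j, key l ≤ I.d (pt (y i)) (pt (y l)) := fun i hi => h.le l hl hjl i hi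
    rcases Nat.lt_succ_iff_lt_or_eq.1 hi with hi | rfl
    · split_ifs with hc
      · exact (hc.2.2 (by omega)).le.trans (hle i hi)
      · exact hle i hi
    · split_ifs with hc
      · exact le_rfl
      · by_contra hlt
        exact hc ⟨hl, by omega, fun _ => not_le.1 hlt⟩
  · intro l hl hjl _
    split_ifs with hc
    · exact ⟨j, by omega, rfl⟩
    · have h0 : 0 < j := by
        by_contra h0
        exact hc ⟨hl, by omega, fun h => absurd h h0⟩
      obtain ⟨i, hi, he⟩ := h.eq l hl hjl h0
      exact ⟨i, by omega, he⟩

/-- Position of the smallest key at `vJ` or later. -/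
def primArgmin : Prog := .block [
  .nass aArg (.var vJ),
  .for vL (.var aM) (.ite (.and (.nlt (.var vJ) (.var vL))
      (.rlt (.get rKey (.var vL)) (.get rKey (.var aArg))))
    (.nass aArg (.var vL)) .skip)]

theorem primArgmin_spec (hj : s.nat vJ 0 < s.nat aM 0) :
    Does I primArgmin s (6 * s.nat aM 0 + 3) fun s' =>
      s.nat vJ 0 ≤ s'.nat aArg 0 ∧ s'.nat aArg 0 < s.nat aM 0 ∧
      ∀ l < s.nat aM 0, s.nat vJ 0 ≤ l → s.real rKey (s'.nat aArg 0) ≤ s.real rKey l := by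
  have h1 : Does I (.nass aArg (.var vJ)) s 1 (fun s' => s'.nat aArg 0 = s.nat vJ 0) :=
    Does.of_wp (by simp [Prog.wp])
  refine Does.le (h1.seq (T₂ := s.nat aM 0 * (4 + 2) + 2) ?_) (by omega)
  intro s₁ hf₁ hA
  have eM : s₁.nat aM = s.nat aM := hf₁.nat _ (by decide)
  have eJ : s₁.nat vJ = s.nat vJ := hf₁.nat _ (by decide)
  have eK : s₁.real rKey = s.real rKey := hf₁.real _ (by decide)
  -- The loop also runs through the visited positions; until it passes `vJ`, the initial choice `vJ`
  -- needs a clause of its own.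
  refine Does.for (fun l s' => s.nat vJ 0 ≤ s'.nat aArg 0 ∧ s'.nat aArg 0 < s.nat aM 0 ∧
      ∀ l', s.nat vJ 0 ≤ l' → l' < l ∨ l' = s.nat vJ 0 →
        s.real rKey (s'.nat aArg 0) ≤ s.real rKey l')
    (by decide) (fun j s x h => by simpa using h) ?_ ?_ ?_ ?_
  · intro s' hf
    simp [hf.nat aM (by decide), eM]
  · refine ⟨by rw [hA], by rw [hA]; exact hj, fun l' _ h => ?_⟩
    obtain rfl : l' = s.nat vJ 0 := by omega
    rw [hA]
  · rintro l hl s' hf hv ⟨h1, h2, h3⟩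
    have eJ' : s'.nat vJ = s.nat vJ := (hf.nat _ (by decide)).trans eJ
    have eK' : s'.real rKey = s.real rKey := (hf.real _ (by decide)).trans eK
    refine (Does.of_wp ?_).le (by decide : _ ≤ 4)
    simp only [Prog.wp, BExp.holds_and, BExp.holds_nlt, BExp.holds_rlt, RExp.eval_get,
      NExp.eval_get, NExp.eval_lit, eJ', eK', hv]
    constructor
    · rintro ⟨hjl, hk⟩
      simp only [Store.nat_setNat_self, Function.update_self]
      refine ⟨hjl.le, hl, fun l' hjl' hl' => ?_⟩
      by_cases h : l' = l
      · rw [h]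
      · exact hk.le.trans (h3 l' hjl' (by omega))
    · intro hn
      refine ⟨h1, h2, fun l' hjl' hl' => ?_⟩
      by_cases h : l' < l ∨ l' = s.nat vJ 0
      · exact h3 l' hjl' h
      · obtain rfl : l' = l := by omega
        by_contra hc
        exact hn ⟨by omega, not_le.1 hc⟩
  · rintro s' hf ⟨h1, h2, h3⟩
    exact ⟨h1, h2, fun l hl hjl => h3 l hjl (Or.inl hl)⟩

/-- Exchange the positions `vJ` and `aArg`. -/
def primSwap : Prog := .block [
  .nass aTmp (.get aY (.var aArg)),
  .nset aY (.var aArg) (.get aY (.var vJ)),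
  .nset aY (.var vJ) (.var aTmp),
  .rass rTmp (.get rKey (.var aArg)),
  .rset rKey (.var aArg) (.get rKey (.var vJ)),
  .rset rKey (.var vJ) (.var rTmp)]

theorem primSwap_spec :
    Does I primSwap s 6 fun s' =>
      s'.nat aY = s.nat aY ∘ Equiv.swap (s.nat aArg 0) (s.nat vJ 0) ∧
      s'.real rKey = s.real rKey ∘ Equiv.swap (s.nat aArg 0) (s.nat vJ 0) := by
  refine (Does.of_wp ?_).le (by decide : _ ≤ 6)
  have h1 := Equiv.comp_swap_eq_update (s.nat vJ 0) (s.nat aArg 0) (s.nat aY)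
  have h2 := Equiv.comp_swap_eq_update (s.nat vJ 0) (s.nat aArg 0) (s.real rKey)
  rw [Equiv.swap_comm] at h1 h2
  simp [primSwap, Prog.wp, Prog.block, h1, h2]

/-- Update the keys after the point at position `vJ` has been visited. -/
def primRelax : Prog :=
  .for vL (.var aM) (.ite (.and (.nlt (.var vJ) (.var vL)) (.not (.and (.nlt (.lit 0) (.var vJ))
      (.not (.rlt (.dist (.get aPt (.get aY (.var vJ))) (.get aPt (.get aY (.var vL))))
        (.get rKey (.var vL)))))))
    (.rset rKey (.var vL) (.dist (.get aPt (.get aY (.var vJ))) (.get aPt (.get aY (.var vL)))))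
    .skip)

open Classical in
theorem primRelax_spec :
    Does I primRelax s (5 * s.nat aM 0 + 2) fun s' => s'.real rKey = fun l =>
      if l < s.nat aM 0 ∧ s.nat vJ 0 < l ∧ (0 < s.nat vJ 0 →
        I.d (s.nat aPt (s.nat aY (s.nat vJ 0))) (s.nat aPt (s.nat aY l)) < s.real rKey l)
      then I.d (s.nat aPt (s.nat aY (s.nat vJ 0))) (s.nat aPt (s.nat aY l))
      else s.real rKey l := by
  refine (Does.for (N := s.nat aM 0) (T := 3) (fun L s' => s'.real rKey = fun l =>
      if l < L ∧ s.nat vJ 0 < l ∧ (0 < s.nat vJ 0 →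
        I.d (s.nat aPt (s.nat aY (s.nat vJ 0))) (s.nat aPt (s.nat aY l)) < s.real rKey l)
      then I.d (s.nat aPt (s.nat aY (s.nat vJ 0))) (s.nat aPt (s.nat aY l))
      else s.real rKey l) (by decide) (fun j s x h => by simpa using h) ?_ ?_ ?_ ?_).le (by omega)
  · intro s' hf
    simp [hf.nat aM (by decide)]
  · simp
  · intro L hL s' hf hv hi
    refine (Does.of_wp ?_).le (by decide : _ ≤ 3)
    have e1 : s'.nat vJ = s.nat vJ := hf.nat _ (by decide)
    have e2 : s'.nat aPt = s.nat aPt := hf.nat _ (by decide)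
    have e3 : s'.nat aY = s.nat aY := hf.nat _ (by decide)
    have e4 : s'.real rKey L = s.real rKey L := by simp [hi]
    simp only [Prog.wp, BExp.holds_and, BExp.holds_nlt, BExp.holds_not, BExp.holds_rlt,
      RExp.eval_dist, RExp.eval_get, NExp.eval_get, NExp.eval_lit, e1, e2, e3, hv, e4,
      not_and, not_not]
    constructor
    · intro hc
      simp only [Store.real_setReal_self]
      ext l
      by_cases h : l = L
      · subst h; rw [Function.update_self, if_pos ⟨by omega, hc⟩]
      · rw [Function.update_of_ne h, hi]
        have : l < L + 1 ↔ l < L := by omega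
        simp only [this]
    · intro hc
      rw [hi]
      ext l
      by_cases h : l = L
      · subst h
        rw [if_neg (by simp), if_neg (by rintro ⟨-, h1, h2⟩; exact hc h1 h2)]
      · have : l < L + 1 ↔ l < L := by omega
        simp only [this]
  · intro s' hf hi
    exact hi

/-- Prim's algorithm: reorder the points listed in `aY`. -/
def prim : Prog := .for vJ (.var aM) (.block [primArgmin, primSwap, primRelax])

theorem prim_spec {Y : Finset ℕ}
    (hinj : ∀ a < s.nat aM 0, ∀ b < s.nat aM 0, s.nat aY a = s.nat aY b → a = b)
    (hmem : ∀ p, p ∈ Y ↔ ∃ a < s.nat aM 0, s.nat aY a = p) :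
    Does I prim s (20 * (s.nat aM 0 + 1) * (s.nat aM 0 + 1)) fun s' =>
      PrimOrder I (s.nat aPt) Y (s.nat aM 0) (s'.nat aY) (s'.real rKey) := by
  refine (Does.for (N := s.nat aM 0) (T := 11 * s.nat aM 0 + 11) (fun j s' =>
      PrimInv I (s.nat aPt) Y (s.nat aM 0) j j (s'.nat aY) (s'.real rKey))
      (by decide) (fun j s x h => by simpa using h) ?_ ?_ ?_ ?_).le (by nlinarith)
  · intro s' hf
    simp [hf.nat aM (by decide)]
  -- With no point visited the four conditions on the keys are vacuous, so the array of keys need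
  -- not be initialised.
  · exact ⟨hinj, hmem, by omega, by omega, by omega, by omega⟩
  · intro j hj s₀ hf hv hi
    have e1 : s₀.nat aM = s.nat aM := hf.nat _ (by decide)
    have e2 : s₀.nat aPt = s.nat aPt := hf.nat _ (by decide)
    refine Does.le ((primArgmin_spec (by rw [hv, e1]; exact hj)).seq
      (T₂ := 6 + (5 * s.nat aM 0 + 2)) ?_) (by rw [e1]; omega)
    rintro s₁ hf₁ ⟨h1, h2, h3⟩
    have e3 : s₁.nat aY = s₀.nat aY := hf₁.nat _ (by decide)
    have e4 : s₁.real rKey = s₀.real rKey := hf₁.real _ (by decide)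
    have e5 : s₁.nat vJ = s₀.nat vJ := hf₁.nat _ (by decide)
    have e6 : s₁.nat aM = s.nat aM := (hf₁.nat _ (by decide)).trans e1
    have e7 : s₁.nat aPt = s.nat aPt := (hf₁.nat _ (by decide)).trans e2
    rw [hv] at h1 h3
    rw [e1] at h2 h3
    have hi' := hi.swap h1 h2 h3
    refine primSwap_spec.seq ?_
    rintro s₂ hf₂ ⟨h4, h5⟩
    rw [e3, e5, hv] at h4
    rw [e4, e5, hv] at h5
    rw [← h4, ← h5] at hi'
    have e8 : s₂.nat vJ = s₀.nat vJ := (hf₂.nat _ (by decide)).trans e5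
    have e9 : s₂.nat aM = s.nat aM := (hf₂.nat _ (by decide)).trans e6
    have e10 : s₂.nat aPt = s.nat aPt := (hf₂.nat _ (by decide)).trans e7
    refine primRelax_spec.mono (by rw [e9]) ?_
    intro s₃ hf₃ h6
    rw [h6, hf₃.nat aY (by decide), e8, e9, e10, hv]
    exact hi'.relax
  · intro s' hf hi
    exact ⟨hi.inj, hi.mem, fun j hj h0 => hi.att j hj h0 hj, fun j hj h0 => hi.cut j hj h0 hj⟩

/-- Compute the components. -/
def labels : Prog :=
  .for vI (.var aM) (.ite (.and (.nlt (.lit 0) (.var vI)) (.rlt (.get rKey (.var vI)) (.var rT)))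
    (.nset aLab (.var vI) (.get aLab (.sub (.var vI) (.lit 1))))
    (.nset aLab (.var vI) (.var vI)))

theorem labels_spec :
    Does I labels s (5 * s.nat aM 0 + 2) fun s' =>
      ∀ j < s.nat aM 0, s'.nat aLab j = lab (s.real rKey) (s.real rT 0) j := by
  refine (Does.for (N := s.nat aM 0) (T := 3) (fun L s' =>
      ∀ j < L, s'.nat aLab j = lab (s.real rKey) (s.real rT 0) j)
      (by decide) (fun j s x h => by simpa using h) ?_ ?_ ?_ ?_).le (by omega)
  · intro s' hf
    simp [hf.nat aM (by decide)]
  · simp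
  · intro j hj s' hf hv hi
    have e1 : s'.real = s.real := funext fun a => hf.real a (by
      simp [Prog.realWrites, Prog.for])
    refine (Does.of_wp ?_).le (by decide : _ ≤ 3)
    simp only [Prog.wp, BExp.holds_and, BExp.holds_nlt, BExp.holds_rlt, RExp.eval_get,
      NExp.eval_get, NExp.eval_lit, NExp.eval_sub, hv, e1, Store.nat_setNat_self]
    constructor
    · rintro ⟨h0, hk⟩ i hi'
      by_cases h : i = j
      · subst h
        obtain ⟨i, rfl⟩ := Nat.exists_eq_succ_of_ne_zero h0.ne'
        simp only [Function.update_self, Nat.succ_eq_add_one, Nat.add_sub_cancel] at *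
        rw [hi i (by omega), lab, if_pos hk]
      · rw [Function.update_of_ne h]; exact hi i (by omega)
    · intro hc i hi'
      by_cases h : i = j
      · subst h
        rw [Function.update_self]
        cases i with
        | zero => rfl
        | succ i => rw [lab, if_neg fun hk => hc ⟨by omega, hk⟩]
      · rw [Function.update_of_ne h]; exact hi i (by omega)
  · intro s' hf hi
    exact hi

/-- Compute the net for the threshold `rT` and its components. -/
def cluster : Prog := .block [buildNet, prim, labels]

theorem cluster_spec :
    Does I cluster s (40 * (s.nat aP 0 + 1) * (s.nat aP 0 + 1)) fun s' =>
      s'.nat aM 0 ≤ s.nat aP 0 ∧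
      PrimOrder I (s.nat aPt) (net m (s.nat aP 0) (s.real rRad) (s.real rT 0)) (s'.nat aM 0)
        (s'.nat aY) (s'.real rKey) ∧
      ∀ j < s'.nat aM 0, s'.nat aLab j = lab (s'.real rKey) (s.real rT 0) j := by
  refine Does.le (buildNet_spec.seq
    (T₂ := 20 * (s.nat aP 0 + 1) * (s.nat aP 0 + 1) + (5 * s.nat aP 0 + 2)) ?_) (by nlinarith)
  rintro s₁ hf₁ ⟨hM, hinj, hmem⟩
  refine ((prim_spec hinj hmem).le (by gcongr)).seq ?_
  intro s₂ hf₂ hp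
  have e1 : s₂.nat aM = s₁.nat aM := hf₂.nat _ (by decide)
  have e2 : s₁.nat aPt = s.nat aPt := hf₁.nat _ (by decide)
  have e3 : s₂.real rT = s.real rT := (hf₂.real _ (by decide)).trans (hf₁.real _ (by decide))
  refine labels_spec.mono (by rw [e1]; omega) ?_
  intro s₃ hf₃ hl
  rw [hf₃.nat aM (by decide), hf₃.nat aY (by decide), hf₃.real rKey (by decide), e1]
  rw [e2] at hp
  rw [e1, e3] at hl
  exact ⟨hM, hp, hl⟩

end Prim

/-! ### Assigning components to classes -/

section Assign

variable {m M : ℕ} {cl lb own : ℕ → ℕ}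

/-- Number of components that are assigned to the class `c`; `own l = q + 1` means that the
component `l` is represented by the position `q`. -/
def assigned (M : ℕ) (cl own : ℕ → ℕ) (c : ℕ) : ℕ :=
  ((Finset.range M).filter fun l => own l ≠ 0 ∧ cl (own l - 1) = c).card

/-- The component is taken from its former class, if any, and given to the class of `q`. The loss
stands on the left to avoid truncated subtraction. -/
theorem assigned_update {l q : ℕ} (hl : l < M) (c : ℕ) :
    assigned M cl (Function.update own l (q + 1)) c +
      (if own l ≠ 0 ∧ cl (own l - 1) = c then 1 else 0) =
    assigned M cl own c + if cl q = c then 1 else 0 := by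
  have hm := Finset.mem_range.2 hl
  unfold assigned
  rw [Finset.card_filter, Finset.card_filter, ← Finset.add_sum_erase _ _ hm,
    ← Finset.add_sum_erase (Finset.range M) (fun l => if own l ≠ 0 ∧ cl (own l - 1) = c then 1 else 0)
      hm]
  have : ∀ x ∈ (Finset.range M).erase l,
      (if Function.update own l (q + 1) x ≠ 0 ∧ cl (Function.update own l (q + 1) x - 1) = c
        then 1 else 0) = if own x ≠ 0 ∧ cl (own x - 1) = c then 1 else 0 := by
    intro x hx
    rw [Function.update_of_ne (Finset.ne_of_mem_erase hx)]
  rw [Finset.sum_congr rfl this]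
  simp
  omega

/-- Every component is represented by one of its positions. -/
def ValidOwn (M : ℕ) (lb own : ℕ → ℕ) : Prop :=
  ∀ l < M, own l ≠ 0 → own l - 1 < M ∧ lb (own l - 1) = l

theorem ValidOwn.update (h : ValidOwn M lb own) {q : ℕ} (hq : q < M) :
    ValidOwn M lb (Function.update own (lb q) (q + 1)) := by
  intro l hl h0
  by_cases he : l = lb q
  · subst he; simp [hq]
  · rw [Function.update_of_ne he] at h0 ⊢
    exact h l hl h0

theorem sum_assigned (R : Finset ℕ) :
    ∑ c ∈ R, assigned M cl own c =
      ((Finset.range M).filter fun l => own l ≠ 0 ∧ cl (own l - 1) ∈ R).card := by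
  rw [Finset.card_eq_sum_card_fiberwise (f := fun l => cl (own l - 1)) (t := R)]
  · refine Finset.sum_congr rfl fun c hc => ?_
    unfold assigned
    congr 1
    ext l
    simp only [Finset.mem_filter]
    constructor
    · rintro ⟨h1, h2, h3⟩; exact ⟨⟨h1, h2, h3 ▸ hc⟩, h3⟩
    · rintro ⟨⟨h1, h2, -⟩, h3⟩; exact ⟨h1, h2, h3⟩
  · intro l hl
    have hl' : l ∈ (Finset.range M).filter fun l => own l ≠ 0 ∧ cl (own l - 1) ∈ R := by
      exact_mod_cast hl
    exact (Finset.mem_filter.1 hl').2.2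

/-- By `hclosed` every component that meets a class of `R` is already assigned to a class of `R`. So
these classes meet no more components than they own together, which is less than they need. -/
theorem PrimOrder.not_rich {n m : ℕ} {I : Instance n m} {pt : ℕ → ℕ} {Y : Finset ℕ} {y : ℕ → ℕ}
    {key : ℕ → ℝ} {t : ℝ} (h : PrimOrder I pt Y M y key)
    (hlb : ∀ q < M, lb q = lab key t q) {R : Finset ℕ} (hR : R ⊆ Finset.range m)
    (hclosed : ∀ q < M, I.col (pt (y q)) ∈ R →
      own (lb q) ≠ 0 ∧ I.col (pt (y (own (lb q) - 1))) ∈ R)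
    (hle : ∀ c ∈ R, assigned M (fun q => I.col (pt (y q))) own c ≤ I.quo c)
    (hlt : ∃ c ∈ R, assigned M (fun q => I.col (pt (y q))) own c < I.quo c) :
    ¬ Rich I pt Y t := by
  intro hr
  obtain ⟨S, hSY, hSR, hi, hc⟩ := hr R hR
  have h1 := Finset.sum_lt_sum hle hlt
  rw [sum_assigned] at h1
  have hpos : ∀ p ∈ S, ∃ a < M, y a = p := fun p hp => (h.mem p).1 (hSY hp)
  choose! pos hposM hpos using hpos
  have h2 : S.card ≤ ((Finset.range M).filter fun l =>
      own l ≠ 0 ∧ I.col (pt (y (own l - 1))) ∈ R).card := by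
    -- Send each point of `S` to the label of its component; independence makes this injective.
    refine Finset.card_le_card_of_injOn (fun p => lb (pos p)) ?_ ?_
    · intro p hp
      have hp : p ∈ S := hp
      have h3 := hclosed (pos p) (hposM p hp) (by rw [hpos p hp]; exact hSR p hp)
      simp only [Finset.coe_filter, Finset.mem_range, Set.mem_ofPred_eq]
      refine ⟨?_, h3⟩
      rw [hlb _ (hposM p hp)]
      exact (lab_le _).trans_lt (hposM p hp)
    · intro p hp q hq hpq
      have hp : p ∈ S := hp
      have hq : q ∈ S := hq
      have hpq : lb (pos p) = lb (pos q) := hpq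
      rw [hlb _ (hposM p hp), hlb _ (hposM q hq), ← h.reachable_iff (hposM p hp) (hposM q hq),
        hpos p hp, hpos q hq] at hpq
      exact hi p hp q hq hpq
  omega

/-- State of a breadth first search for an augmenting path that starts at the class `que 0`:
`vis c` is the position of `c` in the queue plus one, and `par c` is a position through which
`c` has been reached. -/
structure Bfs (m M : ℕ) (cl lb own : ℕ → ℕ) (vis par que : ℕ → ℕ) (tail : ℕ) : Prop where
  tail_pos : 0 < tail
  vis_le : ∀ c < m, vis c ≠ 0 → vis c ≤ tail ∧ que (vis c - 1) = c
  que_lt : ∀ i < tail, que i < m ∧ vis (que i) = i + 1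
  par : ∀ c < m, 2 ≤ vis c → par c < M ∧ own (lb (par c)) ≠ 0 ∧ cl (own (lb (par c)) - 1) = c ∧
    0 < vis (cl (par c)) ∧ vis (cl (par c)) < vis c

variable {vis par que : ℕ → ℕ} {tail : ℕ}

/-- No class is queued twice, since `vis` recovers its place in the queue. This bounds the number of
rounds of a search. -/
theorem Bfs.tail_le (h : Bfs m M cl lb own vis par que tail) : tail ≤ m := by
  have := Finset.card_le_card_of_injOn (s := Finset.range tail) (t := Finset.range m) que
    (fun i hi => Finset.mem_coe.2 (Finset.mem_range.2
      (h.que_lt i (Finset.mem_range.1 (Finset.mem_coe.1 hi))).1))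
    (fun i hi j hj hij => by
      have h1 := (h.que_lt i (Finset.mem_range.1 (Finset.mem_coe.1 hi))).2
      have h2 := (h.que_lt j (Finset.mem_range.1 (Finset.mem_coe.1 hj))).2
      have hij : que i = que j := hij
      rw [hij] at h1
      omega)
  simpa using this

/-- The new class receives the largest value of `vis`, so `par` always leads to a class visited
strictly earlier, and the walk back ends at the root. -/
theorem Bfs.push (h : Bfs m M cl lb own vis par que tail) {q : ℕ} (hq : q < M)
    (hcq : cl q < m) (hv : vis (cl q) ≠ 0) (ho : own (lb q) ≠ 0)
    (hc : vis (cl (own (lb q) - 1)) = 0) (hm : cl (own (lb q) - 1) < m) :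
    Bfs m M cl lb own (Function.update vis (cl (own (lb q) - 1)) (tail + 1))
      (Function.update par (cl (own (lb q) - 1)) q)
      (Function.update que tail (cl (own (lb q) - 1))) (tail + 1) := by
  generalize he : cl (own (lb q) - 1) = e at *
  have hne : cl q ≠ e := by rintro rfl; exact hv hc
  refine ⟨by omega, ?_, ?_, ?_⟩
  · intro c hcm hv'
    by_cases hce : c = e
    · subst hce; simp
    · rw [Function.update_of_ne hce] at hv' ⊢
      have := h.vis_le c hcm hv'
      rw [Function.update_of_ne (by omega)]
      exact ⟨by omega, this.2⟩
  · intro i hi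
    by_cases hit : i = tail
    · subst hit; simp [hm]
    · have := h.que_lt i (by omega)
      rw [Function.update_of_ne hit]
      refine ⟨this.1, ?_⟩
      rw [Function.update_of_ne, this.2]
      intro h'
      rw [h'] at this
      omega
  · intro c hcm hv'
    by_cases hce : c = e
    · subst hce
      simp only [Function.update_self, Function.update_of_ne hne]
      have := h.vis_le _ hcq hv
      exact ⟨hq, ho, he, by omega, by omega⟩
    · simp only [Function.update_of_ne hce] at hv' ⊢
      obtain ⟨h1, h2, h3, h4, h5⟩ := h.par c hcm hv'
      have : cl (par c) ≠ e := by intro h'; rw [h'] at h4; omega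
      rw [Function.update_of_ne this]
      exact ⟨h1, h2, h3, h4, h5⟩

/-- State while an augmenting path is being switched; `own₀` is the assignment at the start, and
`q` is the position that is going to represent its component. -/
structure Switch (m M : ℕ) (cl lb own₀ vis par own : ℕ → ℕ) (q : ℕ) : Prop where
  valid : ValidOwn M lb own
  lt : q < M
  visited : vis (cl q) ≠ 0
  count : ∀ c, assigned M cl own c = assigned M cl own₀ c +
    if own (lb q) ≠ 0 ∧ cl (own (lb q) - 1) = c then 1 else 0
  path : ∀ c < m, 2 ≤ vis c → vis c ≤ vis (cl q) →
    own (lb (par c)) ≠ 0 ∧ cl (own (lb (par c)) - 1) = c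
  desc : own (lb q) ≠ 0 → vis (cl q) < vis (cl (own (lb q) - 1))

/-- Handing the component of `q` to the class of `q` removes the surplus of its former owner and
moves it to the class of `q`. -/
theorem Switch.count_update {own₀ : ℕ → ℕ} {q : ℕ} (h : Switch m M cl lb own₀ vis par own q)
    (hlb : ∀ q < M, lb q < M) (c : ℕ) :
    assigned M cl (Function.update own (lb q) (q + 1)) c =
      assigned M cl own₀ c + if cl q = c then 1 else 0 := by
  have h1 := assigned_update (cl := cl) (own := own) (q := q) (hlb q h.lt) c
  have h2 := h.count c
  omega

/-- The class of `q` now owns one component too many. It gives up the one through which the search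
reached it, that of `par (cl q)`, to a class visited earlier. -/
theorem Switch.next {own₀ : ℕ → ℕ} {q : ℕ} (h : Switch m M cl lb own₀ vis par own q)
    (hb : Bfs m M cl lb own₀ vis par que tail)
    (hlb : ∀ q < M, lb q < M) (hcl : ∀ q < M, cl q < m) (hv : 2 ≤ vis (cl q)) :
    Switch m M cl lb own₀ vis par (Function.update own (lb q) (q + 1)) (par (cl q)) ∧
      vis (cl (par (cl q))) < vis (cl q) := by
  obtain ⟨h1, -, -, h4, h5⟩ := hb.par _ (hcl q h.lt) hv
  -- The component being reassigned does not occur on the rest of the path: its owner is visited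
  -- later than the class of `q` by `desc`, while the owners still to come are not.
  have hne : ∀ c < m, 2 ≤ vis c → vis c ≤ vis (cl q) → lb (par c) ≠ lb q := by
    intro c hc h2 h3 he
    have h6 := h.path c hc h2 h3
    rw [he] at h6
    have := h.desc h6.1
    rw [h6.2] at this
    omega
  have hpar := h.path _ (hcl q h.lt) hv le_rfl
  have hpq := hne _ (hcl q h.lt) hv le_rfl
  refine ⟨⟨h.valid.update h.lt, h1, by omega, ?_, ?_, ?_⟩, h5⟩
  · intro c
    rw [h.count_update hlb, Function.update_of_ne hpq, hpar.2]
    simp [hpar.1]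
  · intro c hc h2 h3
    rw [Function.update_of_ne (hne c hc h2 (by omega))]
    exact h.path c hc h2 (by omega)
  · rw [Function.update_of_ne hpq, hpar.2]
    exact fun _ => h5

end Assign

/-! ### The program for augmenting paths -/

section Match

variable {n m : ℕ} {I : Instance n m} {s : Store}

/-- The class of the point at a position. -/
def NExp.cls (q : NExp) : NExp := .color (.get aPt (.get aY q))

@[simp] theorem NExp.eval_cls (q : NExp) :
    (NExp.cls q).eval I s = I.col (s.nat aPt (s.nat aY (q.eval I s))) := rfl

/-- Equality of natural numbers. -/
def BExp.neq (x y : NExp) : BExp := .and (.not (.nlt x y)) (.not (.nlt y x))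

@[simp] theorem BExp.holds_neq (x y : NExp) :
    (BExp.neq x y).Holds I s ↔ x.eval I s = y.eval I s := by
  simp only [BExp.neq, BExp.holds_and, BExp.holds_not, BExp.holds_nlt]
  omega

/-- The class that owns the component of the position `vQ`. -/
def ownerCls : NExp := .cls (.sub (.get aOwn (.get aLab (.var vQ))) (.lit 1))

/-- Scan the points of the class at the head of the queue. -/
def bfsScan : Prog :=
  .for vQ (.var aM) (.ite
    (.and (.nlt (.var aFound) (.lit 1)) (.neq (.cls (.var vQ)) (.get aQue (.var aHead))))
    (.ite (.nlt (.lit 0) (.get aOwn (.get aLab (.var vQ))))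
      (.ite (.nlt (.get aVis ownerCls) (.lit 1))
        (.block [
          .nset aVis ownerCls (.add (.var aTail) (.lit 1)),
          .nset aPar ownerCls (.var vQ),
          .nset aQue (.var aTail) ownerCls,
          .nass aTail (.add (.var aTail) (.lit 1))])
        .skip)
      (.block [.nass aFound (.lit 1), .nass aCur (.var vQ)]))
    .skip)

/-- The class of a position, as a function. -/
abbrev clsOf (I : Instance n m) (s : Store) (q : ℕ) : ℕ := I.col (s.nat aPt (s.nat aY q))

/-- The position `q` leads to a visited class. -/
def Closed (cl lb own vis : ℕ → ℕ) (q : ℕ) : Prop :=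
  own (lb q) ≠ 0 ∧ vis (cl (own (lb q) - 1)) ≠ 0

/-- The search has found an augmenting path. -/
def Hit (M : ℕ) (cl lb own vis : ℕ → ℕ) (q : ℕ) : Prop :=
  q < M ∧ own (lb q) = 0 ∧ vis (cl q) ≠ 0

theorem bfsScan_spec {cl lb own : ℕ → ℕ} {M : ℕ} (hcl : clsOf I s = cl) (hlb : s.nat aLab = lb)
    (hown : s.nat aOwn = own) (hM : s.nat aM 0 = M)
    (hclm : ∀ q < M, cl q < m) (hlbM : ∀ q < M, lb q < M) (hval : ValidOwn M lb own)
    (hb : Bfs m M cl lb own (s.nat aVis) (s.nat aPar) (s.nat aQue) (s.nat aTail 0))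
    (hht : s.nat aHead 0 < s.nat aTail 0) (hf0 : s.nat aFound 0 = 0)
    (hc : ∀ i < s.nat aHead 0, ∀ q < M, cl q = s.nat aQue i → Closed cl lb own (s.nat aVis) q) :
    Does I bfsScan s (13 * M + 2) fun s' =>
      Bfs m M cl lb own (s'.nat aVis) (s'.nat aPar) (s'.nat aQue) (s'.nat aTail 0) ∧
      (s.nat aTail 0 ≤ s'.nat aTail 0 ∧ s'.nat aQue 0 = s.nat aQue 0) ∧
      (s'.nat aFound 0 = 0 → ∀ i ≤ s.nat aHead 0, ∀ q < M, cl q = s'.nat aQue i →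
        Closed cl lb own (s'.nat aVis) q) ∧
      (s'.nat aFound 0 ≠ 0 → s'.nat aFound 0 = 1 ∧ Hit M cl lb own (s'.nat aVis) (s'.nat aCur 0)) := by
  refine (Does.for (N := M) (T := 11) (fun Q s' =>
      (Bfs m M cl lb own (s'.nat aVis) (s'.nat aPar) (s'.nat aQue) (s'.nat aTail 0) ∧
      s.nat aTail 0 ≤ s'.nat aTail 0 ∧ s'.nat aQue 0 = s.nat aQue 0) ∧
      (s'.nat aFound 0 = 0 → (∀ i < s.nat aHead 0, ∀ q < M, cl q = s'.nat aQue i →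
        Closed cl lb own (s'.nat aVis) q) ∧
        ∀ q < Q, cl q = s'.nat aQue (s.nat aHead 0) → Closed cl lb own (s'.nat aVis) q) ∧
      (s'.nat aFound 0 ≠ 0 → s'.nat aFound 0 = 1 ∧
        Hit M cl lb own (s'.nat aVis) (s'.nat aCur 0)))
      (by decide) (fun j s x h => by simpa using h) ?_ ?_ ?_ ?_).le (by omega)
  · intro s' hf
    simp [hf.nat aM (by decide), hM]
  · refine ⟨⟨hb, le_rfl, rfl⟩, fun _ => ⟨hc, by omega⟩, fun h => absurd hf0 h⟩
  · rintro q hq s' hf hv ⟨⟨hb', ht, hq0⟩, hcl', hhit⟩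
    have e1 : s'.nat aPt = s.nat aPt := hf.nat _ (by decide)
    have e2 : s'.nat aY = s.nat aY := hf.nat _ (by decide)
    have e3 : s'.nat aLab = lb := (hf.nat _ (by decide)).trans hlb
    have e4 : s'.nat aOwn = own := (hf.nat _ (by decide)).trans hown
    have e5 : s'.nat aHead = s.nat aHead := hf.nat _ (by decide)
    have e6 : ∀ q, I.col (s.nat aPt (s.nat aY q)) = cl q := fun q => congrFun hcl q
    refine (Does.of_wp ?_).le (by decide : _ ≤ 11)
    simp only [Prog.wp, Prog.block, BExp.holds_and, BExp.holds_nlt, BExp.holds_neq, NExp.eval_cls,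
      NExp.eval_get, NExp.eval_lit, NExp.eval_add, NExp.eval_sub, ownerCls, hv, e1, e2, e3, e4,
      e5, e6, Store.nat_setNat_self, Store.nat_setNat_of_ne, ne_eq, Nat.reduceEqDiff,
      not_false_eq_true, Function.update_self]
    set vis := s'.nat aVis
    set que := s'.nat aQue
    -- Visiting further classes preserves closedness, so classes already scanned need not be
    -- reconsidered.
    have hmon : ∀ e q, Closed cl lb own vis q →
        Closed cl lb own (Function.update vis e (s'.nat aTail 0 + 1)) q := by
      intro e q h
      refine ⟨h.1, ?_⟩
      rw [Function.update_apply]; split_ifs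
      · omega
      · exact h.2
    refine ⟨fun h1 => ⟨fun h2 => ⟨fun h3 => ?_, fun h3 => ?_⟩, fun h2 => ?_⟩, fun h1 => ?_⟩
    · have hvq : vis (cl q) ≠ 0 := by
        rw [h1.2, (hb'.que_lt _ (by omega)).2]; omega
      have hem : cl (own (lb q) - 1) < m := hclm _ (hval _ (hlbM q hq) (by omega)).1
      have hf1 : s'.nat aFound 0 = 0 := by omega
      have h4 := hcl' hf1
      refine ⟨⟨hb'.push hq (hclm q hq) hvq (by omega) (by omega) hem, by omega, ?_⟩, ?_, ?_⟩
      · rw [Function.update_of_ne hb'.tail_pos.ne, hq0]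
      · intro _
        constructor
        · intro i hi q' hq' he
          -- The queue is written at its tail, strictly beyond the head, so the scanned entries stay
          -- as they are.
          rw [Function.update_of_ne (by omega)] at he
          exact hmon _ _ (h4.1 i hi q' hq' he)
        · intro q' hq' he
          rw [Function.update_of_ne (by omega)] at he
          by_cases hqq : q' = q
          · subst hqq
            exact ⟨by omega, by simp⟩
          · exact hmon _ _ (h4.2 q' (by omega) he)
      · intro h; exact absurd hf1 h
    · refine ⟨⟨hb', ht, hq0⟩, fun hf1 => ⟨(hcl' hf1).1, fun q' hq' he => ?_⟩, hhit⟩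
      by_cases hqq : q' = q
      · subst hqq
        exact ⟨by omega, by omega⟩
      · exact (hcl' hf1).2 q' (by omega) he
    · refine ⟨⟨hb', ht, hq0⟩, fun h => absurd h (by simp), fun _ => ⟨trivial, hq, by omega, ?_⟩⟩
      rw [h1.2, (hb'.que_lt _ (by omega)).2]; omega
    · refine ⟨⟨hb', ht, hq0⟩, fun hf1 => ⟨(hcl' hf1).1, fun q' hq' he => ?_⟩, hhit⟩
      by_cases hqq : q' = q
      · subst hqq
        exact absurd ⟨by omega, he⟩ h1
      · exact (hcl' hf1).2 q' (by omega) he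
  · rintro s' hf ⟨⟨h1, h2⟩, h3, h4⟩
    refine ⟨h1, h2, fun hf1 i hi q hq he => ?_, h4⟩
    rcases hi.lt_or_eq with h | rfl
    · exact (h3 hf1).1 i h q hq he
    · exact (h3 hf1).2 q hq he

/-- Search for an augmenting path that starts at the class `slot vJ`. -/
def bfs : Prog := .block [
  .for vI .numClasses (.nset aVis (.var vI) (.lit 0)),
  .block [
    .nset aQue (.lit 0) (.get aSlot (.var vJ)),
    .nset aVis (.get aSlot (.var vJ)) (.lit 1),
    .nass aHead (.lit 0),
    .nass aTail (.lit 1),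
    .nass aFound (.lit 0)],
  .loop (.and (.nlt (.var aHead) (.var aTail)) (.nlt (.var aFound) (.lit 1)))
    (.block [bfsScan, .nass aHead (.add (.var aHead) (.lit 1))])]

/-- Each round scans all positions for one dequeued class. As the head stays below the tail, and the
tail at most `m`, there are at most `m` rounds. -/
theorem bfs_spec {cl lb own : ℕ → ℕ} {M r : ℕ} (hcl : clsOf I s = cl) (hlb : s.nat aLab = lb)
    (hown : s.nat aOwn = own) (hM : s.nat aM 0 = M) (hr : s.nat aSlot (s.nat vJ 0) = r)
    (hrm : r < m) (hclm : ∀ q < M, cl q < m) (hlbM : ∀ q < M, lb q < M)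
    (hval : ValidOwn M lb own) :
    Does I bfs s (30 * m * (M + 1)) fun s' =>
      ∃ tail, Bfs m M cl lb own (s'.nat aVis) (s'.nat aPar) (s'.nat aQue) tail ∧
      s'.nat aVis r = 1 ∧
      (s'.nat aFound 0 = 0 → ∀ q < M, s'.nat aVis (cl q) ≠ 0 →
        Closed cl lb own (s'.nat aVis) q) ∧
      (s'.nat aFound 0 ≠ 0 → s'.nat aFound 0 = 1 ∧
        Hit M cl lb own (s'.nat aVis) (s'.nat aCur 0)) := by
  have h1 : Does I (.for vI .numClasses (.nset aVis (.var vI) (.lit 0))) s (m * (1 + 2) + 2)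
      (fun s' => ∀ c < m, s'.nat aVis c = 0) := by
    refine Does.for (fun j s' => ∀ c < j, s'.nat aVis c = 0) (by decide)
      (fun j s x h => by simpa using h) (fun s' _ => rfl) (by omega) ?_ (fun _ _ h => h)
    intro j hj s' hf hv hi
    refine (Does.of_wp ?_).le (by decide : _ ≤ 1)
    simp only [Prog.wp, NExp.eval_get, NExp.eval_lit, hv, Store.nat_setNat_self,
      Function.update_apply]
    intro c hc
    split_ifs with h
    · rfl
    · exact hi c (by omega)
  refine Does.le (h1.seq (T₂ := 5 + (m * (13 * M + 4) + 1)) ?_) (by nlinarith)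
  intro s₁ hf₁ hv₁
  have eJ : s₁.nat vJ = s.nat vJ := hf₁.nat _ (by decide)
  have eS : s₁.nat aSlot = s.nat aSlot := hf₁.nat _ (by decide)
  refine Does.seq (R := fun s' => s'.nat aQue 0 = r ∧ (∀ c < m, s'.nat aVis c ≠ 0 ↔ c = r) ∧
    s'.nat aVis r = 1 ∧ s'.nat aHead 0 = 0 ∧ s'.nat aTail 0 = 1 ∧ s'.nat aFound 0 = 0) ?_ ?_
  · refine (Does.of_wp ?_).le (by decide : _ ≤ 5)
    simp only [Prog.wp, Prog.block, NExp.eval_get, NExp.eval_lit, eJ, eS, hr,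
      Store.nat_setNat_self, Store.nat_setNat_of_ne, ne_eq, Nat.reduceEqDiff,
      not_false_eq_true, Function.update_self, and_true, true_and]
    intro c hc
    rw [Function.update_apply]
    split_ifs with h <;> simp [h, hv₁ c hc]
  rintro s₂ hf₂ ⟨hq, hv, hvr, hh, ht, hfd⟩
  have eY : s₂.nat aY = s.nat aY := (hf₂.nat _ (by decide)).trans (hf₁.nat _ (by decide))
  have eP : s₂.nat aPt = s.nat aPt := (hf₂.nat _ (by decide)).trans (hf₁.nat _ (by decide))
  have eL : s₂.nat aLab = lb :=
    ((hf₂.nat _ (by decide)).trans (hf₁.nat _ (by decide))).trans hlb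
  have eO : s₂.nat aOwn = own :=
    ((hf₂.nat _ (by decide)).trans (hf₁.nat _ (by decide))).trans hown
  have eM : s₂.nat aM 0 = M := by
    rw [hf₂.nat _ (by decide), hf₁.nat _ (by decide), hM]
  have eC : clsOf I s₂ = cl := by rw [← hcl]; funext q; simp only [clsOf, eY, eP]
  refine (Does.while (T := 13 * M + 3) (fun s' =>
      (Bfs m M cl lb own (s'.nat aVis) (s'.nat aPar) (s'.nat aQue) (s'.nat aTail 0) ∧
        s'.nat aQue 0 = r) ∧ s'.nat aHead 0 ≤ s'.nat aTail 0 ∧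
      (s'.nat aFound 0 = 0 → ∀ i < s'.nat aHead 0, ∀ q < M, cl q = s'.nat aQue i →
        Closed cl lb own (s'.nat aVis) q) ∧
      (s'.nat aFound 0 ≠ 0 → s'.nat aFound 0 = 1 ∧
        Hit M cl lb own (s'.nat aVis) (s'.nat aCur 0)))
      (fun s' => m - s'.nat aHead 0) ?_ ?_ ?_).le (by rw [hh]; simp)
  · refine ⟨⟨⟨by omega, ?_, ?_, ?_⟩, hq⟩, by omega, fun _ i hi => by omega, fun h => absurd hfd h⟩
    · intro c hc h
      obtain rfl := (hv c hc).1 h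
      rw [hvr, ht]; exact ⟨le_rfl, hq⟩
    · intro i hi
      obtain rfl : i = 0 := by omega
      rw [hq, hvr]; exact ⟨hrm, rfl⟩
    · intro c hc h
      obtain rfl := (hv c hc).1 (by omega)
      omega
  · rintro s' hf ⟨⟨hb, hq0⟩, hht, hc, hhit⟩ hcond
    simp only [BExp.holds_and, BExp.holds_nlt, NExp.eval_get, NExp.eval_lit] at hcond
    have hf0 : s'.nat aFound 0 = 0 := by omega
    have eC' : clsOf I s' = cl := by
      rw [← eC]; funext q; simp only [clsOf, hf.nat aY (by decide), hf.nat aPt (by decide)]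
    refine (bfsScan_spec eC' ((hf.nat _ (by decide)).trans eL) ((hf.nat _ (by decide)).trans eO)
      (by rw [hf.nat _ (by decide), eM]) hclm hlbM hval hb hcond.1 hf0 (hc hf0)).seq (T₂ := 1) ?_
    rintro s'' hf' ⟨h1, h2, h3, h4⟩
    have eH : s''.nat aHead = s'.nat aHead := hf'.nat _ (by decide)
    refine (Does.of_wp ?_).le (by decide : _ ≤ 1)
    have htl := hb.tail_le
    have hq0' : s''.nat aQue 0 = r := by
      rw [h2.2, hq0]
    simp only [Prog.wp, Prog.block, NExp.eval_get, NExp.eval_lit, NExp.eval_add,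
      Store.nat_setNat_self, Store.nat_setNat_of_ne, ne_eq, Nat.reduceEqDiff,
      not_false_eq_true, Function.update_self, eH]
    exact ⟨⟨⟨h1, hq0'⟩, by have := h2.1; omega, fun hf1 i hi => h3 hf1 i (by omega), h4⟩, by omega⟩
  · rintro s' hf ⟨⟨hb, hq0⟩, hht, hc, hhit⟩ hcond
    simp only [BExp.holds_and, BExp.holds_nlt, NExp.eval_get, NExp.eval_lit] at hcond
    refine ⟨_, hb, ?_, ?_, hhit⟩
    · rw [← hq0]; exact (hb.que_lt 0 hb.tail_pos).2
    · intro hf0 q hq hvq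
      -- Nothing was found, so the loop ended with an exhausted queue: the place of a visited class
      -- lies before the head, where all classes have been scanned.
      have h1 := hb.vis_le _ (hclm q hq) hvq
      exact hc hf0 (s'.nat aVis (cl q) - 1) (by omega) q hq h1.2.symm

/-- Switch along the augmenting path that has been found. -/
def switch : Prog := .loop (.nlt (.var aFound) (.lit 2)) (.block [
  .nset aOwn (.get aLab (.var aCur)) (.add (.var aCur) (.lit 1)),
  .ite (.nlt (.get aVis (.cls (.var aCur))) (.lit 2))
    (.nass aFound (.lit 2))
    (.nass aCur (.get aPar (.cls (.var aCur))))])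

/-- The variant is `vis` of the class about to receive a component; it starts at most `m` and drops
with every step towards the root. The flag value `2` marks completion, where the variant is `0`. The
surplus ends up at the root `r`. -/
theorem switch_spec {cl lb : ℕ → ℕ} {M r tail : ℕ} {que : ℕ → ℕ} (hcl : clsOf I s = cl)
    (hlb : s.nat aLab = lb) (hrm : r < m) (hclm : ∀ q < M, cl q < m) (hlbM : ∀ q < M, lb q < M)
    (hval : ValidOwn M lb (s.nat aOwn))
    (hb : Bfs m M cl lb (s.nat aOwn) (s.nat aVis) (s.nat aPar) que tail) (hr : s.nat aVis r = 1)
    (hf : s.nat aFound 0 = 1) (hhit : Hit M cl lb (s.nat aOwn) (s.nat aVis) (s.nat aCur 0)) :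
    Does I switch s (5 * m + 1) fun s' =>
      ValidOwn M lb (s'.nat aOwn) ∧ ∀ c, assigned M cl (s'.nat aOwn) c =
        assigned M cl (s.nat aOwn) c + if r = c then 1 else 0 := by
  set vis := s.nat aVis with hvis
  set own₀ := s.nat aOwn with hown
  set par := s.nat aPar with hpar
  refine (Does.while (T := 4) (fun s' =>
      (s'.nat aFound 0 < 2 ∧ Switch m M cl lb own₀ vis par (s'.nat aOwn) (s'.nat aCur 0)) ∨
      (¬ s'.nat aFound 0 < 2 ∧ ValidOwn M lb (s'.nat aOwn) ∧ ∀ c,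
        assigned M cl (s'.nat aOwn) c = assigned M cl own₀ c + if r = c then 1 else 0))
      (fun s' => if s'.nat aFound 0 < 2 then vis (cl (s'.nat aCur 0)) else 0) ?_ ?_ ?_).le ?_
  · refine Or.inl ⟨by omega, hval, hhit.1, hhit.2.2, ?_, ?_, ?_⟩
    · intro c
      simp [← hown, hhit.2.1]
    · intro c hc h2 _
      obtain ⟨-, h3, h4, -⟩ := hb.par c hc h2
      exact ⟨h3, h4⟩
    · intro h; exact absurd hhit.2.1 h
  · intro s' hf' hi hcond
    simp only [BExp.holds_nlt, NExp.eval_get, NExp.eval_lit] at hcond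
    have hsw : Switch m M cl lb own₀ vis par (s'.nat aOwn) (s'.nat aCur 0) := by
      rcases hi with h | h
      · exact h.2
      · exact absurd hcond h.1
    have e1 : s'.nat aLab = lb := (hf'.nat _ (by decide)).trans hlb
    have e2 : s'.nat aVis = vis := hf'.nat _ (by decide)
    have e3 : s'.nat aPar = par := hf'.nat _ (by decide)
    have e4 : ∀ q, I.col (s'.nat aPt (s'.nat aY q)) = cl q := by
      intro q
      rw [hf'.nat aPt (by decide), hf'.nat aY (by decide)]; exact congrFun hcl q
    obtain ⟨q, hq⟩ : ∃ q, s'.nat aCur 0 = q := ⟨_, rfl⟩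
    rw [hq] at hsw
    refine (Does.of_wp ?_).le (by decide : _ ≤ 4)
    simp only [Prog.wp, Prog.block, BExp.holds_nlt, NExp.eval_cls, NExp.eval_get, NExp.eval_lit,
      NExp.eval_add, e1, e2, e3, e4, hq, Store.nat_setNat_self, Store.nat_setNat_of_ne, ne_eq,
      Nat.reduceEqDiff, not_false_eq_true, Function.update_self, if_pos hcond]
    refine ⟨fun h2 => ?_, fun h2 => ?_⟩
    · have hv := hsw.visited
      -- A visited class with `vis` below `2` has `vis` equal to `1`, that is, it is the first in
      -- the queue, and so is `r`.
      have hqr : cl q = r := by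
        have h3 := (hb.vis_le _ (hclm q hsw.lt) hv).2
        have h4 := (hb.vis_le r hrm (by omega)).2
        rw [hr] at h4
        have : vis (cl q) = 1 := by omega
        rw [this] at h3
        exact h3.symm.trans h4
      refine ⟨Or.inr ⟨by simp, hsw.valid.update hsw.lt, fun c => ?_⟩, ?_⟩
      · rw [hsw.count_update hlbM, hqr]
      · simp only [lt_irrefl, if_false]
        exact Nat.pos_of_ne_zero hv
    · have h3 := hsw.next hb hlbM hclm (by omega)
      exact ⟨Or.inl ⟨hcond, h3.1⟩, h3.2⟩
  · intro s' hf' hi hcond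
    simp only [BExp.holds_nlt, NExp.eval_get, NExp.eval_lit] at hcond
    rcases hi with h | h
    · exact absurd h.1 hcond
    · exact h.2
  · rw [if_pos (by omega)]
    have h1 := hb.vis_le _ (hclm _ hhit.1) hhit.2.2
    have h2 := hb.tail_le
    have : vis (cl (s.nat aCur 0)) ≤ m := h1.1.trans h2
    omega

/-- Assign one more component to the class `slot vJ`, or report a failure. -/
def augment : Prog := .block [bfs, .ite (.nlt (.var aFound) (.lit 1)) (.nass aOk (.lit 0)) switch]

theorem augment_spec {Y : Finset ℕ} {key : ℕ → ℝ} {t : ℝ} {M r : ℕ}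
    (hp : PrimOrder I (s.nat aPt) Y M (s.nat aY) key) (hpt : ∀ p ∈ Y, s.nat aPt p < n)
    (hM : s.nat aM 0 = M) (hlb : ∀ q < M, s.nat aLab q = lab key t q)
    (hr : s.nat aSlot (s.nat vJ 0) = r) (hrm : r < m) (hval : ValidOwn M (s.nat aLab) (s.nat aOwn))
    (hle : ∀ c < m, assigned M (clsOf I s) (s.nat aOwn) c ≤ I.quo c)
    (hlt : assigned M (clsOf I s) (s.nat aOwn) r < I.quo r) (hok : s.nat aOk 0 = 1) :
    Does I augment s (40 * m * (M + 1)) fun s' =>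
      (s'.nat aOk 0 = 1 ∧ ValidOwn M (s.nat aLab) (s'.nat aOwn) ∧
        ∀ c, assigned M (clsOf I s) (s'.nat aOwn) c =
          assigned M (clsOf I s) (s.nat aOwn) c + if r = c then 1 else 0) ∨
      (s'.nat aOk 0 = 0 ∧ ¬ Rich I (s.nat aPt) Y t) := by
  have hclm : ∀ q < M, clsOf I s q < m := fun q hq =>
    I.col_lt (hpt _ ((hp.mem _).2 ⟨q, hq, rfl⟩))
  have hlbM : ∀ q < M, s.nat aLab q < M := fun q hq => by
    rw [hlb q hq]; exact (lab_le q).trans_lt hq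
  refine Does.le ((bfs_spec rfl rfl rfl hM hr hrm hclm hlbM hval).seq
    (T₂ := (5 * m + 1) + 1) ?_) (by nlinarith)
  rintro s₁ hf₁ ⟨tail, hb, hvr, hclosed, hhit⟩
  have eO : s₁.nat aOwn = s.nat aOwn := hf₁.nat _ (by decide)
  have eL : s₁.nat aLab = s.nat aLab := hf₁.nat _ (by decide)
  have eC : clsOf I s₁ = clsOf I s := by
    funext q; simp only [clsOf, hf₁.nat aY (by decide), hf₁.nat aPt (by decide)]
  have eK : s₁.nat aOk 0 = 1 := by rw [hf₁.nat _ (by decide), hok]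
  refine Does.ite ?_ ?_
  · intro hc
    simp only [BExp.holds_nlt, NExp.eval_get, NExp.eval_lit] at hc
    have hcl := hclosed (by omega)
    have hnr : ¬ Rich I (s.nat aPt) Y t := by
      -- The classes visited by the failed search violate Hall's condition; among them is the root,
      -- which still lacks a component.
      refine hp.not_rich hlb (R := (Finset.range m).filter fun c => s₁.nat aVis c ≠ 0)
        (own := s.nat aOwn) (Finset.filter_subset _ _) ?_ ?_ ?_
      · intro q hq h
        rw [Finset.mem_filter] at h
        have h' := hcl q hq h.2
        refine ⟨h'.1, Finset.mem_filter.2 ⟨Finset.mem_range.2 ?_, h'.2⟩⟩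
        exact hclm _ (hval _ (hlbM q hq) h'.1).1
      · intro c hc
        exact hle c (Finset.mem_range.1 (Finset.mem_filter.1 hc).1)
      · exact ⟨r, Finset.mem_filter.2 ⟨Finset.mem_range.2 hrm, by omega⟩, hlt⟩
    refine Does.le (Does.of_wp (p := .nass aOk (.lit 0)) ?_) (by simp [Prog.cost])
    simp only [Prog.wp, NExp.eval_lit, Store.nat_setNat_self, Function.update_self]
    exact Or.inr ⟨trivial, hnr⟩
  · intro hc
    simp only [BExp.holds_nlt, NExp.eval_get, NExp.eval_lit] at hc
    have hh := hhit (by omega)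
    refine (switch_spec (r := r) (M := M) (tail := tail) eC eL hrm hclm hlbM (by rw [eO]; exact hval)
      (by rw [eO]; exact hb) hvr hh.1 (by rw [eO]; exact hh.2)).mono le_rfl ?_
    rintro s₂ hf₂ ⟨h1, h2⟩
    rw [eO] at h2
    exact Or.inl ⟨by rw [hf₂.nat _ (by decide), eK], h1, h2⟩

/-- `slot 0, …, slot (k - 1)` contains each class as often as its quota says. -/
def IsSlots (I : Instance n m) (slot : ℕ → ℕ) : Prop :=
  (∀ j < I.k, slot j < m) ∧
    ∀ c < m, ((Finset.range I.k).filter fun j => slot j = c).card = I.quo c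

/-- Assign components to all classes, or report a failure. -/
def assignAll : Prog := .block [
  .nass aOk (.lit 1),
  .for vI (.var aM) (.nset aOwn (.var vI) (.lit 0)),
  .for vJ (.var aK) (.ite (.nlt (.lit 0) (.var aOk)) augment .skip)]

theorem assignAll_spec {Y : Finset ℕ} {key : ℕ → ℝ} {t : ℝ} {M : ℕ}
    (hp : PrimOrder I (s.nat aPt) Y M (s.nat aY) key) (hpt : ∀ p ∈ Y, s.nat aPt p < n)
    (hM : s.nat aM 0 = M) (hlb : ∀ q < M, s.nat aLab q = lab key t q)
    (hk : s.nat aK 0 = I.k) (hslot : IsSlots I (s.nat aSlot)) :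
    Does I assignAll s (60 * (I.k * m + 1) * (M + 1)) fun s' =>
      (s'.nat aOk 0 = 1 ∧ ValidOwn M (s.nat aLab) (s'.nat aOwn) ∧
        ∀ c < m, assigned M (clsOf I s) (s'.nat aOwn) c = I.quo c) ∨
      (s'.nat aOk 0 = 0 ∧ ¬ Rich I (s.nat aPt) Y t) := by
  have hkm : I.k ≤ I.k * m := by
    rcases Nat.eq_zero_or_pos I.k with h | h
    · omega
    · have := hslot.1 0 h
      exact Nat.le_mul_of_pos_right _ (by omega)
  have h1 : Does I (.nass aOk (.lit 1)) s 1 (fun s' => s'.nat aOk 0 = 1) :=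
    Does.of_wp (by simp [Prog.wp])
  refine Does.le (h1.seq (T₂ := (M * (1 + 2) + 2) + (I.k * (40 * m * (M + 1) + 1 + 2) + 2)) ?_)
    (by nlinarith)
  intro s₁ hf₁ hok
  have h2 : Does I (.for vI (.var aM) (.nset aOwn (.var vI) (.lit 0))) s₁ (M * (1 + 2) + 2)
      (fun s' => ∀ c < M, s'.nat aOwn c = 0) := by
    refine Does.for (fun j s' => ∀ c < j, s'.nat aOwn c = 0) (by decide)
      (fun j s x h => by simpa using h) ?_ (by omega) ?_ (fun _ _ h => h)
    · intro s' hf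
      simp [hf.nat aM (by decide), hf₁.nat aM (by decide), hM]
    intro j hj s' hf hv hi
    refine (Does.of_wp ?_).le (by decide : _ ≤ 1)
    simp only [Prog.wp, NExp.eval_get, NExp.eval_lit, hv, Store.nat_setNat_self,
      Function.update_apply]
    intro c hc
    split_ifs with h
    · rfl
    · exact hi c (by omega)
  refine h2.seq ?_
  intro s₂ hf₂ hown
  have eA : ∀ a ∈ [aPt, aY, aLab, aM, aK, aSlot], s₂.nat a = s.nat a := by
    intro a ha
    simp only [List.mem_cons, List.not_mem_nil, or_false] at ha
    rcases ha with rfl | rfl | rfl | rfl | rfl | rfl <;>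
      exact (hf₂.nat _ (by decide)).trans (hf₁.nat _ (by decide))
  have eok : s₂.nat aOk 0 = 1 := by rw [hf₂.nat _ (by decide), hok]
  refine Does.for (fun j s' =>
      (s'.nat aOk 0 = 1 ∧ ValidOwn M (s.nat aLab) (s'.nat aOwn) ∧
        ∀ c < m, assigned M (clsOf I s) (s'.nat aOwn) c =
          ((Finset.range j).filter fun j => s.nat aSlot j = c).card) ∨
      (s'.nat aOk 0 = 0 ∧ ¬ Rich I (s.nat aPt) Y t)) (by decide)
      (fun j s x h => by simpa using h) ?_ ?_ ?_ ?_
  · intro s' hf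
    simp [hf.nat aK (by decide), eA aK (by simp), hk]
  · refine Or.inl ⟨eok, fun l hl h => absurd (hown l hl) h, fun c _ => ?_⟩
    rw [Finset.range_zero, Finset.filter_empty, Finset.card_empty]
    refine Finset.card_eq_zero.2 (Finset.filter_eq_empty_iff.2 fun l hl h => ?_)
    exact h.1 (hown l (Finset.mem_range.1 hl))
  · intro j hj s' hf hv hi
    have fA : ∀ a ∈ [aPt, aY, aLab, aM, aK, aSlot], s'.nat a = s.nat a := by
      intro a ha
      rw [← eA a ha]
      simp only [List.mem_cons, List.not_mem_nil, or_false] at ha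
      rcases ha with rfl | rfl | rfl | rfl | rfl | rfl <;> exact hf.nat _ (by decide)
    have fPt := fA aPt (by simp)
    have fY := fA aY (by simp)
    have fL := fA aLab (by simp)
    have fM := fA aM (by simp)
    have fS := fA aSlot (by simp)
    have fC : clsOf I s' = clsOf I s := by funext q; simp only [clsOf, fPt, fY]
    refine Does.ite ?_ ?_
    · intro hc
      simp only [BExp.holds_nlt, NExp.eval_get, NExp.eval_lit] at hc
      rcases hi with ⟨ok, hval, hcnt⟩ | ⟨ok, -⟩
      swap
      · omega
      have hcard : ∀ c, ((Finset.range (j + 1)).filter fun j => s.nat aSlot j = c).card =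
          ((Finset.range j).filter fun j => s.nat aSlot j = c).card +
            if s.nat aSlot j = c then 1 else 0 := by
        intro c
        rw [Finset.card_filter, Finset.card_filter, Finset.sum_range_succ]
      -- Slot `j` itself belongs to the quota of its class, so the slots before it leave this class
      -- strictly below its quota, as an augmentation requires.
      have hcardle : ∀ c < m, ((Finset.range (j + 1)).filter fun j => s.nat aSlot j = c).card ≤
          I.quo c := by
        intro c hc
        rw [← hslot.2 c hc]
        exact Finset.card_le_card (Finset.filter_subset_filter _
          (Finset.range_subset_range.2 (by omega)))
      have hspec := augment_spec (s := s') (t := t) (r := s.nat aSlot j) (by rw [fPt, fY]; exact hp)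
        (by rw [fPt]; exact hpt) (by rw [fM]; exact hM) (by rw [fL]; exact hlb)
        (by rw [hv, fS]) (hslot.1 j hj) (by rw [fL]; exact hval)
        (fun c hc => by
          have h1 := hcardle c hc
          have h2 := hcard c
          rw [fC, hcnt c hc]; omega)
        (by
          have h1 := hcardle _ (hslot.1 j hj)
          have h2 := hcard (s.nat aSlot j)
          rw [if_pos rfl] at h2
          rw [fC, hcnt _ (hslot.1 j hj)]; omega) ok
      refine hspec.mono le_rfl ?_
      intro s'' hf'' h
      rw [fL, fC, fPt] at h
      refine h.imp ?_ id
      rintro ⟨h1, h2, h3⟩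
      exact ⟨h1, h2, fun c hc => by rw [h3 c, hcard c, hcnt c hc]⟩
    · intro hc
      simp only [BExp.holds_nlt, NExp.eval_get, NExp.eval_lit] at hc
      rcases hi with ⟨ok, -⟩ | hi
      · omega
      · exact Does.le (Does.of_wp (p := .skip) (Or.inr hi)) (by
          simp only [Prog.cost]
          exact Nat.succ_le_of_lt (by
            have hm : 0 < m := (Nat.zero_le _).trans_lt (hslot.1 j hj)
            positivity))
  · rintro s' hf (⟨h1, h2, h3⟩ | h)
    · exact Or.inl ⟨h1, h2, fun c hc => by rw [h3 c hc, hslot.2 c hc]⟩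
    · exact Or.inr h

end Match

/-! ### Testing a threshold -/

section Test

variable {n m : ℕ} {I : Instance n m} {s : Store}

/-- The positions `own l - 1` represent pairwise different components and fill all quotas. -/
structure Solved (I : Instance n m) (pt : ℕ → ℕ) (Y : Finset ℕ) (t : ℝ) (M : ℕ)
    (y lb own : ℕ → ℕ) : Prop where
  lt : ∀ q < M, pt (y q) < n
  mem : ∀ q < M, y q ∈ Y
  far : ∀ q < M, ∀ q' < M, lb q ≠ lb q' → t ≤ I.d (pt (y q)) (pt (y q'))
  reach : ∀ q < M, ∀ q' < M, (near I pt Y t).Reachable (y q) (y q') → lb q = lb q'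
  valid : ValidOwn M lb own
  count : ∀ c < m, assigned M (fun q => I.col (pt (y q))) own c = I.quo c

variable {pt : ℕ → ℕ} {Y : Finset ℕ} {t : ℝ} {M : ℕ} {y lb own : ℕ → ℕ}

/-- With this the test is exact: success proves `Rich` and failure refutes it. In particular a
threshold that has passed once passes again when its solution is written out. -/
theorem Solved.rich (h : Solved I pt Y t M y lb own) : Rich I pt Y t := by
  intro R hR
  have key : ∀ l < M, ∀ l' < M, own l ≠ 0 → own l' ≠ 0 →
      (near I pt Y t).Reachable (y (own l - 1)) (y (own l' - 1)) → l = l' := by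
    intro l hl l' hl' h0 h0' hr
    have h1 := h.valid l hl h0
    have h2 := h.valid l' hl' h0'
    rw [← h1.2, ← h2.2]
    exact h.reach _ h1.1 _ h2.1 hr
  refine ⟨((Finset.range M).filter fun l => own l ≠ 0 ∧ I.col (pt (y (own l - 1))) ∈ R).image
    fun l => y (own l - 1), ?_, ?_, ?_, ?_⟩
  · intro p hp
    simp only [Finset.mem_image, Finset.mem_filter, Finset.mem_range] at hp
    obtain ⟨l, ⟨hl, h0, -⟩, rfl⟩ := hp
    exact h.mem _ (h.valid l hl h0).1
  · intro p hp
    simp only [Finset.mem_image, Finset.mem_filter, Finset.mem_range] at hp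
    obtain ⟨l, ⟨hl, h0, hc⟩, rfl⟩ := hp
    exact hc
  · intro p hp q hq hpq
    simp only [Finset.mem_image, Finset.mem_filter, Finset.mem_range] at hp hq
    obtain ⟨l, ⟨hl, h0, -⟩, rfl⟩ := hp
    obtain ⟨l', ⟨hl', h0', -⟩, rfl⟩ := hq
    rw [key l hl l' hl' h0 h0' hpq]
  · rw [Finset.card_image_of_injOn]
    · rw [← sum_assigned (cl := fun q => I.col (pt (y q)))]
      exact (Finset.sum_congr rfl fun c hc => (h.count c (Finset.mem_range.1 (hR hc))).symm).le
    · intro l hl l' hl' he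
      simp only [Finset.coe_filter, Finset.mem_range, Set.mem_ofPred_eq] at hl hl'
      have he : y (own l - 1) = y (own l' - 1) := he
      exact key l hl.1 l' hl'.1 hl.2.1 hl'.2.1 (by rw [he])

/-- Positivity of `t` enters here: representatives of different components have positive distance,
so they are different elements and not merely different samples. -/
theorem Solved.eq_of_pt (h : Solved I pt Y t M y lb own) (ht : 0 < t) {l l' : ℕ} (hl : l < M)
    (hl' : l' < M) (h0 : own l ≠ 0) (h0' : own l' ≠ 0)
    (he : pt (y (own l - 1)) = pt (y (own l' - 1))) : l = l' := by
  have h1 := h.valid l hl h0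
  have h2 := h.valid l' hl' h0'
  by_contra hne
  have h3 := h.far _ h1.1 _ h2.1 (by rw [h1.2, h2.2]; exact hne)
  rw [he, I.d_self] at h3
  linarith

theorem Solved.isFair (h : Solved I pt Y t M y lb own) (ht : 0 < t) {S : Finset (Fin n)}
    (hS : ∀ u : Fin n, u ∈ S ↔ ∃ l < M, own l ≠ 0 ∧ pt (y (own l - 1)) = u) : I.IsFair S := by
  intro i
  rw [← I.quo_coe, ← h.count i i.2]
  symm
  refine Finset.card_bij (fun l hl => ⟨pt (y (own l - 1)), ?_⟩) ?_ ?_ ?_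
  · rw [Finset.mem_filter, Finset.mem_range] at hl
    exact h.lt _ (h.valid l hl.1 hl.2.1).1
  · intro l hl
    rw [Finset.mem_filter, Finset.mem_range] at hl
    rw [Finset.mem_inter, hS]
    refine ⟨⟨l, hl.1, hl.2.1, rfl⟩, ?_⟩
    simp only [Instance.group, Finset.mem_filter, Finset.mem_univ, true_and, Fin.ext_iff]
    rw [← I.col_coe]
    exact hl.2.2
  · intro l hl l' hl' he
    rw [Finset.mem_filter, Finset.mem_range] at hl hl'
    exact h.eq_of_pt ht hl.1 hl'.1 hl.2.1 hl'.2.1 (by simpa using he)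
  · intro u hu
    rw [Finset.mem_inter, hS] at hu
    obtain ⟨⟨l, hl, h0, he⟩, hg⟩ := hu
    refine ⟨l, ?_, Fin.ext he⟩
    simp only [Instance.group, Finset.mem_filter, Finset.mem_univ, true_and, Fin.ext_iff] at hg
    rw [Finset.mem_filter, Finset.mem_range]
    refine ⟨hl, h0, ?_⟩
    change I.col (pt (y (own l - 1))) = i
    rw [he, I.col_coe, hg]

theorem Solved.le_dist (h : Solved I pt Y t M y lb own) {S : Finset (Fin n)}
    (hS : ∀ u : Fin n, u ∈ S ↔ ∃ l < M, own l ≠ 0 ∧ pt (y (own l - 1)) = u) {u v : Fin n}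
    (hu : u ∈ S) (hv : v ∈ S) (huv : u ≠ v) : t ≤ I.dist u v := by
  obtain ⟨l, hl, h0, hlu⟩ := (hS u).1 hu
  obtain ⟨l', hl', h0', hlv⟩ := (hS v).1 hv
  have h1 := h.valid l hl h0
  have h2 := h.valid l' hl' h0'
  rw [← I.d_coe, ← hlu, ← hlv]
  refine h.far _ h1.1 _ h2.1 ?_
  rw [h1.2, h2.2]
  rintro rfl
  exact huv (Fin.ext (hlu.symm.trans hlv))

/-- Test whether the threshold `rT` can be reached. -/
def test : Prog := .block [cluster, assignAll]

theorem test_spec (hP : s.nat aP 0 ≤ I.k * m) (hpt : ∀ p < s.nat aP 0, s.nat aPt p < n)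
    (hk : s.nat aK 0 = I.k) (hslot : IsSlots I (s.nat aSlot)) :
    Does I test s (100 * (I.k * m + 1) * (I.k * m + 1)) fun s' =>
      s'.nat aM 0 ≤ s.nat aP 0 ∧
      PrimOrder I (s.nat aPt) (net m (s.nat aP 0) (s.real rRad) (s.real rT 0)) (s'.nat aM 0)
        (s'.nat aY) (s'.real rKey) ∧
      ((s'.nat aOk 0 = 1 ∧ Solved I (s.nat aPt) (net m (s.nat aP 0) (s.real rRad) (s.real rT 0))
          (s.real rT 0) (s'.nat aM 0) (s'.nat aY) (s'.nat aLab) (s'.nat aOwn)) ∨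
        (s'.nat aOk 0 = 0 ∧ ¬ Rich I (s.nat aPt)
          (net m (s.nat aP 0) (s.real rRad) (s.real rT 0)) (s.real rT 0))) := by
  refine Does.le ((cluster_spec.le (T := 40 * (I.k * m + 1) * (I.k * m + 1)) (by gcongr)).seq
    (T₂ := 60 * (I.k * m + 1) * (I.k * m + 1)) ?_) (by nlinarith)
  rintro s₁ hf₁ ⟨hM, hp, hl⟩
  have e1 : s₁.nat aPt = s.nat aPt := hf₁.nat _ (by decide)
  have hpt' : ∀ p ∈ net m (s.nat aP 0) (s.real rRad) (s.real rT 0), s.nat aPt p < n :=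
    fun p h => hpt p (mem_net.1 h).1
  refine (assignAll_spec (s := s₁) (by rw [e1]; exact hp) (by rw [e1]; exact hpt') rfl hl
    (by rw [hf₁.nat _ (by decide), hk]) (by rw [hf₁.nat aSlot (by decide)]; exact hslot)).mono
    (by gcongr; omega) ?_
  intro s₂ hf₂ h
  rw [hf₂.nat aM (by decide), hf₂.nat aY (by decide), hf₂.real rKey (by decide),
    hf₂.nat aLab (by decide)]
  rw [e1] at h
  refine ⟨hM, hp, h.imp ?_ id⟩
  rintro ⟨h1, h2, h3⟩
  refine ⟨h1, ⟨fun q hq => hpt' _ ((hp.mem _).2 ⟨q, hq, rfl⟩),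
    fun q hq => (hp.mem _).2 ⟨q, hq, rfl⟩, ?_, ?_, h2, ?_⟩⟩
  · intro q hq q' hq' hne
    by_contra hlt
    rw [hl q hq, hl q' hq'] at hne
    exact hne (hp.lab_eq_of_adj hq hq' (not_le.1 hlt))
  · intro q hq q' hq' hr
    rw [hl q hq, hl q' hq']
    exact (hp.reachable_iff hq hq').1 hr
  · have e2 : clsOf I s₁ = fun q => I.col (s.nat aPt (s₁.nat aY q)) := by
      funext q; simp only [clsOf, e1]
    rw [e2] at h3
    exact h3

/-- Write the elements that have been found to the output. -/
def writeOut : Prog :=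
  .for vI (.var aM) (.ite (.nlt (.lit 0) (.get aOwn (.var vI)))
    (.nset 0 (.get aPt (.get aY (.sub (.get aOwn (.var vI)) (.lit 1)))) (.lit 1)) .skip)

theorem writeOut_spec (h0 : ∀ u, s.nat 0 u = 0) :
    Does I writeOut s (5 * s.nat aM 0 + 2) fun s' => ∀ u, s'.nat 0 u = 1 ↔
      ∃ l < s.nat aM 0, s.nat aOwn l ≠ 0 ∧ s.nat aPt (s.nat aY (s.nat aOwn l - 1)) = u := by
  refine (Does.for (N := s.nat aM 0) (T := 3) (fun L s' => ∀ u, s'.nat 0 u = 1 ↔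
      ∃ l < L, s.nat aOwn l ≠ 0 ∧ s.nat aPt (s.nat aY (s.nat aOwn l - 1)) = u)
      (by decide) (fun j s x h => by simpa using h) ?_ ?_ ?_ (fun _ _ h => h)).le (by omega)
  · intro s' hf
    simp [hf.nat aM (by decide)]
  · simp [h0]
  · intro L hL s' hf hv hi
    have e1 : s'.nat aOwn = s.nat aOwn := hf.nat _ (by decide)
    have e2 : s'.nat aPt = s.nat aPt := hf.nat _ (by decide)
    have e3 : s'.nat aY = s.nat aY := hf.nat _ (by decide)
    refine (Does.of_wp ?_).le (by decide : _ ≤ 3)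
    simp only [Prog.wp, BExp.holds_nlt, NExp.eval_get, NExp.eval_lit, NExp.eval_sub, hv, e1, e2,
      e3, Store.nat_setNat_self]
    refine ⟨fun hc u => ?_, fun hc u => ?_⟩
    · rw [Function.update_apply]
      split_ifs with h
      · subst h
        simp only [true_iff]
        exact ⟨L, by omega, by omega, rfl⟩
      · rw [hi u]
        constructor
        · rintro ⟨l, hl, h1⟩; exact ⟨l, by omega, h1⟩
        · rintro ⟨l, hl, h1, h2⟩
          refine ⟨l, ?_, h1, h2⟩
          by_contra hlt
          obtain rfl : l = L := by omega
          exact h h2.symm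
    · rw [hi u]
      constructor
      · rintro ⟨l, hl, h1⟩; exact ⟨l, by omega, h1⟩
      · rintro ⟨l, hl, h1, h2⟩
        refine ⟨l, ?_, h1, h2⟩
        by_contra hlt
        obtain rfl : l = L := by omega
        omega

end Test

/-! ### Searching among candidates -/

section Search

/-- The candidates strictly between `lo` and `hi`. -/
noncomputable def inside (N : ℕ) (cand : ℕ → ℝ) (lo hi : ℝ) : Finset ℕ :=
  (Finset.range N).filter fun a => lo < cand a ∧ cand a < hi

theorem mem_inside {N : ℕ} {cand : ℕ → ℝ} {lo hi : ℝ} {a : ℕ} :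
    a ∈ inside N cand lo hi ↔ a < N ∧ lo < cand a ∧ cand a < hi := by simp [inside]

open Classical in
theorem card_inside_succ (N : ℕ) (cand : ℕ → ℝ) (lo hi : ℝ) :
    (inside (N + 1) cand lo hi).card =
      (inside N cand lo hi).card + if lo < cand N ∧ cand N < hi then 1 else 0 := by
  unfold inside
  rw [Finset.card_filter, Finset.card_filter, Finset.sum_range_succ]

/-- At most half of the candidates between `lo` and `hi` are below `c`, and at most half of them
are above `c`. -/
def Median (N : ℕ) (cand : ℕ → ℝ) (lo hi c : ℝ) : Prop :=
  2 * (inside N cand lo c).card ≤ (inside N cand lo hi).card ∧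
    2 * (inside N cand c hi).card ≤ (inside N cand lo hi).card

/-- Take the smallest candidate with at most half of the range above it. If more than half lay below
it, the largest of those would have all of them among the values not above it, hence at most half
above, contradicting minimality. -/
theorem exists_median {N : ℕ} {cand : ℕ → ℝ} {lo hi : ℝ} (h : (inside N cand lo hi).Nonempty) :
    ∃ a ∈ inside N cand lo hi, Median N cand lo hi (cand a) := by
  classical
  set F := inside N cand lo hi with hF
  set G := F.filter fun a => 2 * (inside N cand (cand a) hi).card ≤ F.card with hG
  have hGne : G.Nonempty := by
    obtain ⟨a, ha, hmax⟩ := F.exists_max_image cand h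
    refine ⟨a, Finset.mem_filter.2 ⟨ha, ?_⟩⟩
    have : inside N cand (cand a) hi = ∅ := by
      rw [Finset.eq_empty_iff_forall_notMem]
      intro b hb
      rw [mem_inside] at hb
      have hbF : b ∈ F := mem_inside.2 ⟨hb.1, (mem_inside.1 ha).2.1.trans hb.2.1, hb.2.2⟩
      linarith [hmax b hbF, hb.2.1]
    simp [this]
  obtain ⟨a, ha, hmin⟩ := G.exists_min_image cand hGne
  have haG := Finset.mem_filter.1 ha
  have haF := mem_inside.1 haG.1
  refine ⟨a, haG.1, ?_, haG.2⟩
  by_contra hlt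
  push Not at hlt
  have hL : (inside N cand lo (cand a)).Nonempty := by
    rw [← Finset.card_pos]; omega
  obtain ⟨b, hb, hmax⟩ := (inside N cand lo (cand a)).exists_max_image cand hL
  have hb' := mem_inside.1 hb
  have hbF : b ∈ F := mem_inside.2 ⟨hb'.1, hb'.2.1, hb'.2.2.trans haF.2.2⟩
  have hsub : inside N cand lo (cand a) ⊆ F := fun x hx =>
    mem_inside.2 ⟨(mem_inside.1 hx).1, (mem_inside.1 hx).2.1, (mem_inside.1 hx).2.2.trans haF.2.2⟩
  have h1 : inside N cand (cand b) hi ⊆ F \ inside N cand lo (cand a) := by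
    intro x hx
    have hx' := mem_inside.1 hx
    refine Finset.mem_sdiff.2 ⟨mem_inside.2 ⟨hx'.1, hb'.2.1.trans hx'.2.1, hx'.2.2⟩, fun hxa => ?_⟩
    linarith [hmax x hxa, hx'.2.1]
  have h2 := Finset.card_le_card h1
  rw [Finset.card_sdiff_of_subset hsub] at h2
  have hcF := congrArg Finset.card hF
  have hbG : b ∈ G := Finset.mem_filter.2 ⟨hbF, by omega⟩
  linarith [hmin b hbG, hb'.2.2]

variable {n m : ℕ} {I : Instance n m} {s : Store}

/-- The candidate `x` lies strictly between `lo` and `hi`. -/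
def BExp.inRange (x : NExp) : BExp :=
  .and (.rlt (.var rLo) (.get rCand x)) (.rlt (.get rCand x) (.var rHi))

/-- Count the candidates below and above the candidate `vA`. -/
def countCands : Prog := .block [
  .block [.nass aLess (.lit 0), .nass aMore (.lit 0), .nass aTot (.lit 0)],
  .for vB (.var aNc) (.ite (.inRange (.var vB))
    (.block [
      .nass aTot (.add (.var aTot) (.lit 1)),
      .ite (.rlt (.get rCand (.var vB)) (.get rCand (.var vA)))
        (.nass aLess (.add (.var aLess) (.lit 1))) .skip,
      .ite (.rlt (.get rCand (.var vA)) (.get rCand (.var vB)))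
        (.nass aMore (.add (.var aMore) (.lit 1))) .skip])
    .skip)]

theorem countCands_spec {lo hi c : ℝ} {N : ℕ} {cand : ℕ → ℝ} (hlo : s.real rLo 0 = lo)
    (hhi : s.real rHi 0 = hi) (hN : s.nat aNc 0 = N) (hcand : s.real rCand = cand)
    (hc : cand (s.nat vA 0) = c) (h1 : lo < c) (h2 : c < hi) :
    Does I countCands s (15 * N + 5) fun s' =>
      s'.nat aLess 0 = (inside N cand lo c).card ∧ s'.nat aMore 0 = (inside N cand c hi).card ∧
      s'.nat aTot 0 = (inside N cand lo hi).card := by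
  have hinit : Does I (.block [.nass aLess (.lit 0), .nass aMore (.lit 0), .nass aTot (.lit 0)]) s 3
      (fun s' => s'.nat aLess 0 = 0 ∧ s'.nat aMore 0 = 0 ∧ s'.nat aTot 0 = 0) :=
    (Does.of_wp (by simp [Prog.wp, Prog.block])).le (by decide)
  refine Does.le (hinit.seq (T₂ := N * (13 + 2) + 2) ?_) (by omega)
  rintro s₁ hf₁ ⟨i1, i2, i3⟩
  refine Does.for (fun B s' => s'.nat aLess 0 = (inside B cand lo c).card ∧
      s'.nat aMore 0 = (inside B cand c hi).card ∧ s'.nat aTot 0 = (inside B cand lo hi).card)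
      (by decide) (fun j s x h => by simpa using h) ?_ ?_ ?_ (fun _ _ h => h)
  · intro s' hf
    simp [hf.nat aNc (by decide), hf₁.nat aNc (by decide), hN]
  · simp [i1, i2, i3, inside]
  · rintro B hB s' hf hv ⟨j1, j2, j3⟩
    have er : s'.real = s.real := by
      funext a
      rw [hf.real a (by simp [Prog.realWrites, Prog.for, Prog.block]),
        hf₁.real a (by simp [Prog.realWrites, Prog.block])]
    have eA : s'.nat vA = s.nat vA := (hf.nat _ (by decide)).trans (hf₁.nat _ (by decide))
    refine (Does.of_wp ?_).le (by decide : _ ≤ 13)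
    simp only [Prog.wp, Prog.block, BExp.inRange, BExp.holds_and, BExp.holds_rlt, RExp.eval_get,
      NExp.eval_get, NExp.eval_lit, NExp.eval_add, hv, er, eA, hc, hlo, hhi, hcand,
      Store.nat_setNat_self, Store.nat_setNat_of_ne, Store.real_setNat, ne_eq, Nat.reduceEqDiff,
      not_false_eq_true, Function.update_self, j1, j2, j3, card_inside_succ]
    refine ⟨fun hr => ⟨fun hl => ⟨fun hm => ?_, fun hm => ?_⟩,
      fun hl => ⟨fun hm => ?_, fun hm => ?_⟩⟩, fun hr => ?_⟩
    · linarith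
    · rw [if_pos ⟨hr.1, hl⟩, if_neg fun h => hm h.1, if_pos hr]; simp
    · rw [if_neg fun h => hl h.2, if_pos ⟨hm, hr.2⟩, if_pos hr]; simp
    · rw [if_neg fun h => hl h.2, if_neg fun h => hm h.1, if_pos hr]; simp
    · rw [if_neg fun h => hr ⟨h.1, h.2.trans h2⟩, if_neg fun h => hr ⟨h1.trans h.1, h.2⟩,
        if_neg hr]; simp

/-- Choose a median of the candidates between `lo` and `hi`. -/
def selectPivot : Prog := .block [
  .nass aHas (.lit 0),
  .for vA (.var aNc) (.ite (.inRange (.var vA))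
    (.block [countCands,
      .ite (.and (.not (.nlt (.var aTot) (.add (.var aLess) (.var aLess))))
          (.not (.nlt (.var aTot) (.add (.var aMore) (.var aMore)))))
        (.block [.nass aHas (.lit 1), .rass rPiv (.get rCand (.var vA))]) .skip])
    .skip)]

/-- Trying every candidate and counting is quadratic, which does not exceed the bound for the test
that follows. By `exists_median`, finding no pivot means that the range is empty. -/
theorem selectPivot_spec {lo hi : ℝ} {N : ℕ} {cand : ℕ → ℝ} (hlo : s.real rLo 0 = lo)
    (hhi : s.real rHi 0 = hi) (hN : s.nat aNc 0 = N) (hcand : s.real rCand = cand) :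
    Does I selectPivot s (20 * (N + 1) * (N + 1)) fun s' =>
      (s'.nat aHas 0 = 1 ∧ (inside N cand lo hi).card ≠ 0 ∧
        lo < s'.real rPiv 0 ∧ s'.real rPiv 0 < hi ∧ Median N cand lo hi (s'.real rPiv 0)) ∨
      (s'.nat aHas 0 = 0 ∧ inside N cand lo hi = ∅) := by
  have hinit : Does I (.nass aHas (.lit 0)) s 1 (fun s' => s'.nat aHas 0 = 0) :=
    Does.of_wp (by simp [Prog.wp])
  refine Does.le (hinit.seq (T₂ := N * (15 * N + 10 + 1 + 2) + 2) ?_) (by nlinarith)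
  rintro s₁ hf₁ i1
  refine Does.for (fun A s' => (s'.nat aHas 0 = 1 ∧ (inside N cand lo hi).card ≠ 0 ∧
        lo < s'.real rPiv 0 ∧ s'.real rPiv 0 < hi ∧ Median N cand lo hi (s'.real rPiv 0)) ∨
      (s'.nat aHas 0 = 0 ∧ ∀ a < A, lo < cand a → cand a < hi → ¬ Median N cand lo hi (cand a)))
      (by decide) (fun j s x h => by simpa using h) ?_ ?_ ?_ ?_
  · intro s' hf
    simp [hf.nat aNc (by decide), hf₁.nat aNc (by decide), hN]
  · exact Or.inr ⟨i1, by omega⟩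
  · rintro A hA s' hf hv hi'
    have e1 : s'.real rLo 0 = lo := by
      rw [hf.real _ (by decide), hf₁.real _ (by decide), hlo]
    have e2 : s'.real rHi 0 = hi := by
      rw [hf.real _ (by decide), hf₁.real _ (by decide), hhi]
    have e3 : s'.nat aNc 0 = N := by
      rw [hf.nat _ (by decide), hf₁.nat _ (by decide), hN]
    have e4 : s'.real rCand = cand := by
      rw [hf.real _ (by decide), hf₁.real _ (by decide), hcand]
    refine Does.ite ?_ ?_
    · intro hr
      simp only [BExp.inRange, BExp.holds_and, BExp.holds_rlt, RExp.eval_get, NExp.eval_get,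
        NExp.eval_lit, hv, e1, e2, e4] at hr
      refine Does.le ((countCands_spec e1 e2 e3 e4 (by rw [hv]) hr.1 hr.2).seq (T₂ := 4) ?_)
        (by omega)
      rintro s'' hf'' ⟨j1, j2, j3⟩
      have f1 : s''.nat aHas = s'.nat aHas := hf''.nat _ (by decide)
      have f2 : s''.real = s'.real := by
        funext a
        exact hf''.real a (by simp [Prog.realWrites, Prog.for, Prog.block, countCands])
      have f3 : s''.nat vA 0 = A := by rw [hf''.nat _ (by decide), hv]
      refine (Does.of_wp ?_).le (by decide : _ ≤ 4)
      simp only [Prog.wp, Prog.block, BExp.holds_and, BExp.holds_not, BExp.holds_nlt,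
        RExp.eval_get, NExp.eval_get, NExp.eval_lit, NExp.eval_add, j1, j2, j3,
        Store.nat_setNat_self, Store.nat_setNat_of_ne, Store.real_setNat, Store.nat_setReal,
        Store.real_setReal_self, ne_eq, Nat.reduceEqDiff, not_false_eq_true,
        Function.update_self, f3, f2, f1, e4]
      refine ⟨fun hc => Or.inl ⟨trivial, ?_, hr.1, hr.2, ?_⟩, fun hc => ?_⟩
      · exact Finset.card_ne_zero_of_mem (mem_inside.2 ⟨hA, hr⟩)
      · exact ⟨by omega, by omega⟩
      · refine hi'.imp id fun h => ⟨h.1, fun a ha hl hh hmed => ?_⟩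
        by_cases haA : a = A
        · subst haA
          exact hc ⟨by have := hmed.1; omega, by have := hmed.2; omega⟩
        · exact h.2 a (by omega) hl hh hmed
    · intro hr
      simp only [BExp.inRange, BExp.holds_and, BExp.holds_rlt, RExp.eval_get, NExp.eval_get,
        NExp.eval_lit, hv, e1, e2, e4] at hr
      refine Does.le (Does.of_wp (p := .skip) ?_) (by simp [Prog.cost])
      refine hi'.imp id fun h => ⟨h.1, fun a ha hl hh hmed => ?_⟩
      by_cases haA : a = A
      · subst haA
        exact hr ⟨hl, hh⟩
      · exact h.2 a (by omega) hl hh hmed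
  · rintro s' hf (h | h)
    · exact Or.inl h
    · refine Or.inr ⟨h.1, ?_⟩
      by_contra hne
      obtain ⟨a, ha, hmed⟩ := exists_median (Finset.nonempty_iff_ne_empty.2 hne)
      have ha' := mem_inside.1 ha
      exact h.2 a ha'.1 ha'.2.1 ha'.2.2 hmed

/-- Binary search among the candidates. -/
def search : Prog := .block [
  .nass aGo (.lit 1),
  .loop (.nlt (.lit 0) (.var aGo)) (.block [selectPivot,
    .ite (.nlt (.lit 0) (.var aHas))
      (.block [.rass rT (.var rPiv), test,
        .ite (.nlt (.lit 0) (.var aOk)) (.rass rLo (.var rPiv)) (.rass rHi (.var rPiv))])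
      (.nass aGo (.lit 0))])]

/-- The threshold `t` passes the test. -/
def Passes (I : Instance n m) (P : ℕ) (pt : ℕ → ℕ) (rad : ℕ → ℝ) (t : ℝ) : Prop :=
  Rich I pt (net m P rad t) t

/-- The threshold `lo` can be reached (or is `0`), and `hi` cannot. -/
structure Bracket (I : Instance n m) (P : ℕ) (pt : ℕ → ℕ) (rad : ℕ → ℝ) (lo hi : ℝ) : Prop where
  nonneg : 0 ≤ lo
  lt : lo < hi
  pass : lo = 0 ∨ Passes I P pt rad lo
  fail : ¬ Passes I P pt rad hi

set_option maxRecDepth 4000 in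
-- A passing pivot becomes `lo`, a failing one `hi`; either way at most half of the candidates
-- remain inside. The variant is the binary length of their number, plus one for the final round,
-- which finds no pivot.
theorem search_spec {N P : ℕ} {cand : ℕ → ℝ} {pt : ℕ → ℕ} {rad : ℕ → ℝ} {lo hi : ℝ}
    (hP : s.nat aP 0 = P) (hPk : P ≤ I.k * m) (hpt : s.nat aPt = pt) (hptn : ∀ p < P, pt p < n)
    (hrad : s.real rRad = rad) (hk : s.nat aK 0 = I.k) (hslot : IsSlots I (s.nat aSlot))
    (hN : s.nat aNc 0 = N) (hNk : N ≤ I.k * m) (hcand : s.real rCand = cand)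
    (hlo : s.real rLo 0 = lo) (hhi : s.real rHi 0 = hi) (hb : Bracket I P pt rad lo hi) :
    Does I search s (130 * (Nat.size (I.k * m) + 2) * ((I.k * m + 1) * (I.k * m + 1))) fun s' =>
      lo ≤ s'.real rLo 0 ∧ s'.real rHi 0 ≤ hi ∧
      Bracket I P pt rad (s'.real rLo 0) (s'.real rHi 0) ∧
      inside N cand (s'.real rLo 0) (s'.real rHi 0) = ∅ := by
  set X := (I.k * m + 1) * (I.k * m + 1) with hX
  have hX1 : 1 ≤ X := Nat.mul_pos (by omega) (by omega)
  have hinit : Does I (.nass aGo (.lit 1)) s 1 (fun s' => s'.nat aGo 0 = 1) :=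
    Does.of_wp (by simp [Prog.wp])
  refine Does.le (hinit.seq (T₂ := (Nat.size (I.k * m) + 1) * (125 * X + 1) + 1) ?_) (by nlinarith)
  intro s₁ hf₁ hgo
  have hcardle : ∀ lo hi, (inside N cand lo hi).card ≤ I.k * m := by
    intro lo hi
    refine ((Finset.card_le_card (Finset.filter_subset _ _)).trans ?_)
    simpa using hNk
  refine (Does.while (T := 125 * X) (fun s' => lo ≤ s'.real rLo 0 ∧ s'.real rHi 0 ≤ hi ∧
      Bracket I P pt rad (s'.real rLo 0) (s'.real rHi 0) ∧
      (s'.nat aGo 0 = 0 → inside N cand (s'.real rLo 0) (s'.real rHi 0) = ∅))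
      (fun s' => if s'.nat aGo 0 = 0 then 0 else
        Nat.size (inside N cand (s'.real rLo 0) (s'.real rHi 0)).card + 1) ?_ ?_ ?_).le ?_
  · rw [hf₁.real _ (by decide), hf₁.real _ (by decide), hlo, hhi, hgo]
    exact ⟨le_rfl, le_rfl, hb, by omega⟩
  · rintro s₂ hf₂ ⟨h1, h2, h3, -⟩ hcond
    simp only [BExp.holds_nlt, NExp.eval_get, NExp.eval_lit] at hcond
    have e1 : s₂.nat aNc 0 = N := by rw [hf₂.nat _ (by decide), hf₁.nat _ (by decide), hN]
    have e2 : s₂.real rCand = cand := by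
      rw [hf₂.real _ (by decide), hf₁.real _ (by decide), hcand]
    rw [if_neg (by omega)]
    refine Does.le ((selectPivot_spec (s := s₂) rfl rfl e1 e2).seq
      (T₂ := (1 + (100 * (I.k * m + 1) * (I.k * m + 1) + 3)) + 1) ?_) ?_
    swap
    · have : 20 * (N + 1) * (N + 1) ≤ 20 * X := by
        rw [hX, mul_assoc]; gcongr
      have h100 : 100 * (I.k * m + 1) * (I.k * m + 1) = 100 * X := by rw [hX, mul_assoc]
      omega
    intro s₃ hf₃ hsel
    have eLo : s₃.real rLo = s₂.real rLo := hf₃.real _ (by decide)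
    have eHi : s₃.real rHi = s₂.real rHi := hf₃.real _ (by decide)
    have eGo : s₃.nat aGo = s₂.nat aGo := hf₃.nat _ (by decide)
    refine Does.ite ?_ ?_
    · intro hhas
      simp only [BExp.holds_nlt, NExp.eval_get, NExp.eval_lit] at hhas
      rcases hsel with ⟨-, hne, hl, hh, hmed⟩ | ⟨hz, -⟩
      swap
      · omega
      set piv := s₃.real rPiv 0 with hpiv
      have hset : Does I (.rass rT (.var rPiv)) s₃ 1 (fun s' => s'.real rT 0 = piv) :=
        Does.of_wp (by simp [Prog.wp, hpiv])
      refine hset.seq ?_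
      intro s₄ hf₄ hT
      have g1 : s₄.nat aP 0 = P := by
        rw [hf₄.nat _ (by decide), hf₃.nat _ (by decide), hf₂.nat _ (by decide),
          hf₁.nat _ (by decide), hP]
      have g2 : s₄.nat aPt = pt := by
        rw [hf₄.nat _ (by decide), hf₃.nat _ (by decide), hf₂.nat _ (by decide),
          hf₁.nat _ (by decide), hpt]
      have g3 : s₄.nat aK 0 = I.k := by
        rw [hf₄.nat _ (by decide), hf₃.nat _ (by decide), hf₂.nat _ (by decide),
          hf₁.nat _ (by decide), hk]
      have g4 : s₄.nat aSlot = s.nat aSlot := by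
        rw [hf₄.nat _ (by decide), hf₃.nat _ (by decide), hf₂.nat _ (by decide),
          hf₁.nat _ (by decide)]
      have g5 : s₄.real rRad = rad := by
        rw [hf₄.real _ (by decide), hf₃.real _ (by decide), hf₂.real _ (by decide),
          hf₁.real _ (by decide), hrad]
      refine (test_spec (s := s₄) (by rw [g1]; exact hPk) (by rw [g1, g2]; exact hptn) g3
        (by rw [g4]; exact hslot)).seq (T₂ := 3) ?_
      rintro s₅ hf₅ ⟨-, -, hres⟩
      rw [g1, g2, g5, hT] at hres
      have k1 : s₅.real rLo = s₂.real rLo := by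
        rw [hf₅.real _ (by decide), hf₄.real _ (by decide), eLo]
      have k2 : s₅.real rHi = s₂.real rHi := by
        rw [hf₅.real _ (by decide), hf₄.real _ (by decide), eHi]
      have k3 : s₅.real rPiv 0 = piv := by
        rw [hf₅.real _ (by decide), hf₄.real _ (by decide)]
      have k4 : ¬ s₅.nat aGo 0 = 0 := by
        rw [hf₅.nat _ (by decide), hf₄.nat _ (by decide), eGo]; omega
      -- Halving a positive number shortens its binary expansion; positivity is `hne`.
      have hsize : ∀ a, 2 * a ≤ (inside N cand (s₂.real rLo 0) (s₂.real rHi 0)).card →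
          Nat.size a < Nat.size (inside N cand (s₂.real rLo 0) (s₂.real rHi 0)).card := by
        intro a ha
        rw [Nat.lt_size]
        rcases Nat.eq_zero_or_pos a with rfl | ha0
        · simp only [Nat.size_zero, pow_zero]; omega
        · have h5 : 0 < Nat.size a := Nat.size_pos.2 ha0
          have h6 : 2 ^ (Nat.size a - 1) ≤ a := Nat.lt_size.1 (by omega)
          have h7 : 2 ^ Nat.size a = 2 * 2 ^ (Nat.size a - 1) := by
            rw [← pow_succ']; congr 1; omega
          omega
      refine (Does.of_wp ?_).le (by decide : _ ≤ 3)
      simp only [Prog.wp, Prog.block, BExp.holds_nlt, RExp.eval_get, NExp.eval_get, NExp.eval_lit,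
        Store.nat_setReal, Store.real_setReal_self, Store.real_setReal_of_ne, ne_eq,
        Nat.reduceEqDiff, not_false_eq_true, Function.update_self, k1, k2, k3, if_neg k4]
      refine ⟨fun hok => ?_, fun hok => ?_⟩
      · rcases hres with ⟨-, hsol⟩ | ⟨hz, -⟩
        swap
        · omega
        exact ⟨⟨h1.trans hl.le, h2, ⟨(h3.nonneg.trans hl.le), hh, Or.inr hsol.rich, h3.fail⟩,
          fun h => absurd h k4⟩, by have := hsize _ hmed.2; omega⟩
      · rcases hres with ⟨hz, -⟩ | ⟨-, hnr⟩
        · omega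
        exact ⟨⟨h1, hh.le.trans h2, ⟨h3.nonneg, hl, h3.pass, hnr⟩,
          fun h => absurd h k4⟩, by have := hsize _ hmed.1; omega⟩
    · intro hhas
      simp only [BExp.holds_nlt, NExp.eval_get, NExp.eval_lit] at hhas
      rcases hsel with ⟨hz, -⟩ | ⟨-, hemp⟩
      · omega
      refine Does.le (Does.of_wp (p := .nass aGo (.lit 0)) ?_) (by simp [Prog.cost])
      simp only [Prog.wp, NExp.eval_lit, Store.nat_setNat_self, Store.real_setNat,
        Function.update_self, if_true, eLo, eHi]
      exact ⟨⟨h1, h2, h3, fun _ => hemp⟩, by omega⟩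
  · rintro s₂ hf₂ ⟨h1, h2, h3, h4⟩ hcond
    simp only [BExp.holds_nlt, NExp.eval_get, NExp.eval_lit] at hcond
    exact ⟨h1, h2, h3, h4 (by omega)⟩
  · rw [if_neg (by omega)]
    have := Nat.size_le_size (hcardle (s₁.real rLo 0) (s₁.real rHi 0))
    gcongr

end Search

/-! ### Farthest point sampling -/

section Greedy

variable {n m : ℕ} {I : Instance n m}

/-- State of farthest point sampling in the class `c` after `j` rounds: `μ u` is the distance of
`u` to the points chosen so far (or the initial value `m * top`). -/
structure Good (I : Instance n m) (top : ℝ) (c j P : ℕ) (pt : ℕ → ℕ) (rad μ : ℕ → ℝ) : Prop where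
  card_le : ((Finset.range P).filter fun p => I.col (pt p) = c).card ≤ j
  le : ∀ u < n, I.col u = c → ∀ p < P, I.col (pt p) = c → μ u ≤ I.d u (pt p)
  att : ∀ u < n, I.col u = c → μ u = m * top ∨ ∃ p < P, I.col (pt p) = c ∧ μ u = I.d u (pt p)
  sep : ∀ t, ∀ p ∈ net m P rad t, ∀ q ∈ net m P rad t, p ≠ q → I.col (pt p) = c →
    I.col (pt q) = c → m * t ≤ I.d (pt p) (pt q)
  cover : ∀ t ≤ top, j ≤ ((net m P rad t).filter fun p => I.col (pt p) = c).card ∨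
    ∀ u < n, I.col u = c → ∃ p ∈ net m P rad t, I.col (pt p) = c ∧ I.d u (pt p) < m * t

variable {top : ℝ} {c j P : ℕ} {pt : ℕ → ℕ} {rad μ : ℕ → ℝ}

theorem mem_net_update {t x : ℝ} {p : ℕ} :
    p ∈ net m (P + 1) (Function.update rad P x) t ↔
      p ∈ net m P rad t ∨ p = P ∧ (m : ℝ) * t ≤ x := by
  rw [mem_net, mem_net, Function.update_apply]
  by_cases h : p = P
  · subst h; simp
  · rw [if_neg h]
    simp only [h, false_and, or_false, show p < P + 1 ↔ p < P by omega]

theorem Good.mono_empty (h : Good I top c j P pt rad μ) (hc : ∀ u < n, I.col u ≠ c) :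
    Good I top c (j + 1) P pt rad μ :=
  ⟨h.card_le.trans (by omega), h.le, h.att, h.sep,
    fun _ _ => Or.inr fun u hu hcu => absurd hcu (hc u hu)⟩

theorem Good.congr {ν : ℕ → ℝ} (h : Good I top c j P pt rad μ)
    (hν : ∀ u < n, I.col u = c → μ u = ν u) : Good I top c j P pt rad ν :=
  ⟨h.card_le, fun u hu hc => hν u hu hc ▸ h.le u hu hc, fun u hu hc => hν u hu hc ▸ h.att u hu hc,
    h.sep, h.cover⟩

theorem Good.add_other (h : Good I top c j P pt rad μ) {w : ℕ} (hw : I.col w ≠ c) (x : ℝ) :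
    Good I top c j (P + 1) (Function.update pt P w) (Function.update rad P x) μ := by
  have hpt : ∀ p, I.col (Function.update pt P w p) = c → p < P + 1 →
      p < P ∧ Function.update pt P w p = pt p := by
    intro p hc hp
    have hne : p ≠ P := by
      rintro rfl
      rw [Function.update_self] at hc
      exact hw hc
    exact ⟨by omega, Function.update_of_ne hne _ _⟩
  have hpt' : ∀ p < P, Function.update pt P w p = pt p := fun p hp =>
    Function.update_of_ne (by omega) _ _
  refine ⟨?_, ?_, ?_, ?_, ?_⟩
  · refine (Finset.card_le_card ?_).trans h.card_le
    intro p hp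
    rw [Finset.mem_filter, Finset.mem_range] at hp ⊢
    have := hpt p hp.2 hp.1
    exact ⟨this.1, by rw [← this.2]; exact hp.2⟩
  · intro u hu hc p hp hpc
    have := hpt p hpc hp
    rw [this.2] at hpc ⊢
    exact h.le u hu hc p this.1 hpc
  · intro u hu hc
    refine (h.att u hu hc).imp id ?_
    rintro ⟨p, hp, h1⟩
    exact ⟨p, by omega, by rw [hpt' p hp]; exact h1⟩
  · intro t p hp q hq hne hpc hqc
    have h1 := hpt p hpc (mem_net.1 hp).1
    have h2 := hpt q hqc (mem_net.1 hq).1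
    rw [mem_net_update] at hp hq
    rw [h1.2] at hpc ⊢
    rw [h2.2] at hqc ⊢
    exact h.sep t p (hp.resolve_right (by omega)) q (hq.resolve_right (by omega)) hne hpc hqc
  · intro t ht
    have hmem : ∀ p ∈ net m P rad t, p ∈ net m (P + 1) (Function.update rad P x) t ∧
        Function.update pt P w p = pt p := fun p hp =>
      ⟨mem_net_update.2 (Or.inl hp), hpt' p (mem_net.1 hp).1⟩
    refine (h.cover t ht).imp (fun h1 => h1.trans (Finset.card_le_card ?_)) ?_
    · intro h1 u hu hc
      obtain ⟨p, hp, h2⟩ := h1 u hu hc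
      have := hmem p hp
      exact ⟨p, this.1, by rw [this.2]; exact h2⟩
    · intro p hp
      rw [Finset.mem_filter] at hp ⊢
      have := hmem p hp.1
      exact ⟨this.1, by rw [this.2]; exact hp.2⟩

/-- The radius of `w` is at most its distance to every earlier point of the class, which gives
separation in every net that contains `w`. For covering: if `w` is too close to enter the net, every
element of the class is at least as close to the points chosen so far. -/
theorem Good.add_self (h : Good I top c j P pt rad μ) {w : ℕ} (hwn : w < n) (hw : I.col w = c)
    (hmax : ∀ u < n, I.col u = c → μ u ≤ μ w) :
    Good I top c (j + 1) (P + 1) (Function.update pt P w) (Function.update rad P (μ w))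
      (fun u => min (μ u) (I.d u w)) := by
  have hpt : ∀ p < P, Function.update pt P w p = pt p := fun p hp =>
    Function.update_of_ne (by omega) _ _
  refine ⟨?_, ?_, ?_, ?_, ?_⟩
  · refine (Finset.card_le_card (t := insert P ((Finset.range P).filter fun p => I.col (pt p) = c))
      ?_).trans ((Finset.card_insert_le _ _).trans (Nat.succ_le_succ h.card_le))
    intro p hp
    rw [Finset.mem_filter, Finset.mem_range] at hp
    rw [Finset.mem_insert, Finset.mem_filter, Finset.mem_range]
    by_cases hpP : p = P
    · exact Or.inl hpP
    · refine Or.inr ⟨by omega, ?_⟩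
      rw [← hpt p (by omega)]; exact hp.2
  · intro u hu hc p hp hpc
    by_cases hpP : p = P
    · subst hpP; rw [Function.update_self]; exact min_le_right _ _
    · rw [hpt p (by omega)] at hpc ⊢
      exact (min_le_left _ _).trans (h.le u hu hc p (by omega) hpc)
  · intro u hu hc
    rcases min_choice (μ u) (I.d u w) with hm | hm
    · rw [hm]
      refine (h.att u hu hc).imp id ?_
      rintro ⟨p, hp, h1⟩
      exact ⟨p, by omega, by rw [hpt p hp]; exact h1⟩
    · rw [hm]
      exact Or.inr ⟨P, by omega, by rw [Function.update_self]; exact ⟨hw, rfl⟩⟩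
  · intro t p hp q hq hne hpc hqc
    rw [mem_net_update] at hp hq
    rcases hp with hp | ⟨rfl, hp⟩ <;> rcases hq with hq | ⟨rfl, hq⟩
    · rw [hpt p (mem_net.1 hp).1] at hpc ⊢
      rw [hpt q (mem_net.1 hq).1] at hqc ⊢
      exact h.sep t p hp q hq hne hpc hqc
    · rw [hpt p (mem_net.1 hp).1] at hpc ⊢
      rw [Function.update_self, I.d_comm]
      exact hq.trans (h.le w hwn hw p (mem_net.1 hp).1 hpc)
    · rw [hpt q (mem_net.1 hq).1] at hqc ⊢
      rw [Function.update_self]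
      exact hp.trans (h.le w hwn hw q (mem_net.1 hq).1 hqc)
    · exact absurd rfl hne
  · intro t ht
    have hmem : ∀ p ∈ net m P rad t, p ∈ net m (P + 1) (Function.update rad P (μ w)) t ∧
        Function.update pt P w p = pt p := fun p hp =>
      ⟨mem_net_update.2 (Or.inl hp), hpt p (mem_net.1 hp).1⟩
    rcases h.cover t ht with h1 | h1
    · rcases le_or_gt ((m : ℝ) * t) (μ w) with hr | hr
      · left
        have hP : P ∉ (net m P rad t).filter fun p => I.col (pt p) = c := fun hP => by
          have := (mem_net.1 (Finset.mem_filter.1 hP).1).1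
          omega
        have h2 : insert P ((net m P rad t).filter fun p => I.col (pt p) = c) ⊆
            (net m (P + 1) (Function.update rad P (μ w)) t).filter
              fun p => I.col (Function.update pt P w p) = c := by
          intro p hp
          rw [Finset.mem_insert, Finset.mem_filter] at hp
          rw [Finset.mem_filter]
          rcases hp with rfl | hp
          · exact ⟨mem_net_update.2 (Or.inr ⟨rfl, hr⟩), by rw [Function.update_self]; exact hw⟩
          · have := hmem p hp.1
            exact ⟨this.1, by rw [this.2]; exact hp.2⟩
        have h3 := Finset.card_le_card h2
        rw [Finset.card_insert_of_notMem hP] at h3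
        omega
      · right
        -- The class has at most `j` samples and at least `j` of them are in the net, so all are.
        -- Thus the sample at which `μ u` is attained is a net point.
        have hall : (net m P rad t).filter (fun p => I.col (pt p) = c) =
            (Finset.range P).filter fun p => I.col (pt p) = c := by
          refine Finset.eq_of_subset_of_card_le ?_ (h.card_le.trans h1)
          exact Finset.filter_subset_filter _ (Finset.filter_subset _ _)
        intro u hu hc
        have hlt : μ u < m * t := (hmax u hu hc).trans_lt hr
        rcases h.att u hu hc with h2 | ⟨p, hp, hpc, hpd⟩
        -- The initial value `m * top` is excluded, as it is not below `m t` for `t ≤ top`.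
        · have : (m : ℝ) * t ≤ m * top := mul_le_mul_of_nonneg_left ht (Nat.cast_nonneg m)
          linarith
        · have hp' : p ∈ (net m P rad t).filter fun p => I.col (pt p) = c := by
            rw [hall, Finset.mem_filter, Finset.mem_range]; exact ⟨hp, hpc⟩
          have := hmem p (Finset.mem_filter.1 hp').1
          exact ⟨p, this.1, by rw [this.2, ← hpd]; exact ⟨hpc, hlt⟩⟩
    · right
      intro u hu hc
      obtain ⟨p, hp, h2⟩ := h1 u hu hc
      have := hmem p hp
      exact ⟨p, this.1, by rw [this.2]; exact h2⟩

/-- The points chosen by farthest point sampling. -/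
structure Sampled (I : Instance n m) (top : ℝ) (P : ℕ) (pt : ℕ → ℕ) (rad : ℕ → ℝ) : Prop where
  lt : ∀ p < P, pt p < n
  good : ∃ μ, ∀ c < m, Good I top c I.k P pt rad μ

theorem Sampled.sep (h : Sampled I top P pt rad) {t : ℝ} (ht : 0 < t) :
    Sep I pt (net m P rad t) t := by
  obtain ⟨μ, hg⟩ := h.good
  refine ⟨ht, fun p hp => h.lt p (mem_net.1 hp).1, ?_⟩
  intro p hp q hq hne hc
  exact (hg _ (I.col_lt (h.lt q (mem_net.1 hq).1))).sep t p hp q hq hne hc rfl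

theorem Sampled.covers (h : Sampled I top P pt rad) {t : ℝ} (ht : t ≤ top) :
    Covers I pt (net m P rad t) t := by
  obtain ⟨μ, hg⟩ := h.good
  exact fun c hc => (hg c hc).cover t ht

end Greedy

/-! ### The program for farthest point sampling -/

section Greedy

variable {n m : ℕ} {I : Instance n m} {s : Store}

/-- Compute an upper bound for all distances. -/
def bound : Prog := .block [
  .rass rTop (.ofNat (.lit 0)),
  .for vI .numElems (.rass rTop (.add (.var rTop) (.dist (.var vI) (.lit 0)))),
  .rass rTop (.add (.ofNat (.lit 1)) (.add (.var rTop) (.var rTop)))]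

/-- By the triangle inequality through the element `0`, twice the sum of the distances to `0` bounds
every distance; the added `1` makes the bound strict and positive. -/
theorem bound_spec :
    Does I bound s (3 * n + 4) fun s' => 0 < s'.real rTop 0 ∧
      ∀ u < n, ∀ v < n, I.d u v < s'.real rTop 0 := by
  have hinit : Does I (.rass rTop (.ofNat (.lit 0))) s 1 (fun s' => s'.real rTop 0 = 0) :=
    Does.of_wp (by simp [Prog.wp])
  refine Does.le (hinit.seq (T₂ := (n * (1 + 2) + 2) + 1) ?_) (by omega)
  intro s₁ hf₁ h0
  have hloop : Does I (.for vI .numElems (.rass rTop (.add (.var rTop) (.dist (.var vI) (.lit 0)))))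
      s₁ (n * (1 + 2) + 2) (fun s' => 0 ≤ s'.real rTop 0 ∧ ∀ u < n, I.d u 0 ≤ s'.real rTop 0) := by
    refine Does.for (fun U s' => 0 ≤ s'.real rTop 0 ∧ ∀ u < U, I.d u 0 ≤ s'.real rTop 0)
      (by decide) (fun j s x h => by simpa using h) (fun s' _ => rfl) ⟨h0.ge, by omega⟩ ?_
      (fun _ _ h => h)
    rintro U hU s' hf hv ⟨h1, h2⟩
    refine (Does.of_wp ?_).le (by decide : _ ≤ 1)
    simp only [Prog.wp, RExp.eval_add, RExp.eval_get, RExp.eval_dist, NExp.eval_get, NExp.eval_lit,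
      hv, Store.real_setReal_self, Function.update_self]
    have hd := I.d_nonneg U 0
    refine ⟨by linarith, fun u hu => ?_⟩
    by_cases h : u = U
    · subst h; linarith
    · linarith [h2 u (by omega)]
  refine hloop.seq ?_
  rintro s₂ hf₂ ⟨h1, h2⟩
  refine (Does.of_wp ?_).le (by decide : _ ≤ 1)
  simp only [Prog.wp, Prog.block, RExp.eval_add, RExp.eval_get, RExp.eval_ofNat, NExp.eval_lit,
    Store.real_setReal_self, Function.update_self, Nat.cast_one]
  refine ⟨by linarith, fun u hu v hv => ?_⟩
  have h3 := I.d_triangle (u := u) (v := v) (w := 0) (by omega)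
  have h4 := h2 u hu
  have h5 := h2 v hv
  rw [I.d_comm] at h5
  linarith

/-- `best` records an element of the class `c` with the largest value of `μ` among the first `U`
elements. -/
def BestOk (I : Instance n m) (U : ℕ) (μ : ℕ → ℝ) (best : ℕ → ℕ) (c : ℕ) : Prop :=
  (best c = 0 ∧ ∀ u < U, I.col u ≠ c) ∨
    (best c ≠ 0 ∧ best c - 1 < U ∧ I.col (best c - 1) = c ∧
      ∀ u < U, I.col u = c → μ u ≤ μ (best c - 1))

/-- Determine the farthest element of each class. -/
def farthest : Prog := .block [
  .for vI .numClasses (.nset aBest (.var vI) (.lit 0)),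
  .for vI .numElems (.ite (.and (.nlt (.lit 0) (.get aBest (.color (.var vI))))
      (.not (.rlt (.get rMin (.sub (.get aBest (.color (.var vI))) (.lit 1)))
        (.get rMin (.var vI)))))
    .skip
    (.nset aBest (.color (.var vI)) (.add (.var vI) (.lit 1))))]

theorem farthest_spec :
    Does I farthest s (5 * (n + m + 1)) fun s' =>
      ∀ c < m, BestOk I n (s.real rMin) (s'.nat aBest) c := by
  have hinit : Does I (.for vI .numClasses (.nset aBest (.var vI) (.lit 0))) s (m * (1 + 2) + 2)
      (fun s' => ∀ c < m, s'.nat aBest c = 0) := by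
    refine Does.for (fun j s' => ∀ c < j, s'.nat aBest c = 0) (by decide)
      (fun j s x h => by simpa using h) (fun s' _ => rfl) (by omega) ?_ (fun _ _ h => h)
    intro j hj s' hf hv hi
    refine (Does.of_wp ?_).le (by decide : _ ≤ 1)
    simp only [Prog.wp, NExp.eval_get, NExp.eval_lit, hv, Store.nat_setNat_self,
      Function.update_apply]
    intro c hc
    split_ifs with h
    · rfl
    · exact hi c (by omega)
  refine Does.le (hinit.seq (T₂ := n * (3 + 2) + 2) ?_) (by omega)
  intro s₁ hf₁ h0
  have er₁ : s₁.real rMin = s.real rMin := hf₁.real _ (by decide)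
  refine Does.for (fun U s' => ∀ c < m, BestOk I U (s.real rMin) (s'.nat aBest) c)
    (by decide) (fun j s x h => by simpa using h) (fun s' _ => rfl)
    (fun c hc => Or.inl ⟨h0 c hc, by omega⟩) ?_ (fun _ _ h => h)
  intro U hU s' hf hv hi
  have er : s'.real rMin = s.real rMin := (hf.real _ (by decide)).trans er₁
  refine (Does.of_wp ?_).le (by decide : _ ≤ 3)
  simp only [Prog.wp, BExp.holds_and, BExp.holds_nlt, BExp.holds_not, BExp.holds_rlt,
    RExp.eval_get, NExp.eval_get, NExp.eval_lit, NExp.eval_color, NExp.eval_add, NExp.eval_sub, hv,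
    er, Store.nat_setNat_self, not_lt]
  set b := s'.nat aBest
  refine ⟨fun hc c hcm => ?_, fun hc c hcm => ?_⟩
  · by_cases hUc : I.col U = c
    · subst hUc
      rcases hi _ hcm with ⟨h1, -⟩ | ⟨h1, h2, h3, h4⟩
      · omega
      · refine Or.inr ⟨h1, by omega, h3, fun u hu hcu => ?_⟩
        by_cases huU : u = U
        · rw [huU]; exact hc.2
        · exact h4 u (by omega) hcu
    · refine (hi c hcm).imp ?_ ?_
      · rintro ⟨h1, h2⟩
        refine ⟨h1, fun u hu => ?_⟩
        by_cases huU : u = U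
        · rw [huU]; exact hUc
        · exact h2 u (by omega)
      · rintro ⟨h1, h2, h3, h4⟩
        refine ⟨h1, by omega, h3, fun u hu hcu => ?_⟩
        by_cases huU : u = U
        · exact absurd (huU ▸ hcu) hUc
        · exact h4 u (by omega) hcu
  · unfold BestOk
    by_cases hUc : I.col U = c
    · subst hUc
      rw [Function.update_self]
      refine Or.inr ⟨by omega, by omega, rfl, fun u hu hcu => ?_⟩
      simp only [Nat.add_sub_cancel]
      by_cases huU : u = U
      · rw [huU]
      · rcases hi _ hcm with ⟨h1, h2⟩ | ⟨h1, h2, h3, h4⟩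
        · exact absurd hcu (h2 u (by omega))
        · refine (h4 u (by omega) hcu).trans ?_
          by_contra hlt
          exact hc ⟨by omega, (not_le.1 hlt).le⟩
    · rw [Function.update_of_ne (Ne.symm hUc)]
      refine (hi c hcm).imp ?_ ?_
      · rintro ⟨h1, h2⟩
        refine ⟨h1, fun u hu => ?_⟩
        by_cases huU : u = U
        · rw [huU]; exact hUc
        · exact h2 u (by omega)
      · rintro ⟨h1, h2, h3, h4⟩
        refine ⟨h1, by omega, h3, fun u hu hcu => ?_⟩
        by_cases huU : u = U
        · exact absurd (huU ▸ hcu) hUc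
        · exact h4 u (by omega) hcu

/-- Add the farthest elements to the list of points. -/
def addPoints : Prog :=
  .for vI .numClasses (.ite (.nlt (.lit 0) (.get aBest (.var vI)))
    (.block [
      .nset aPt (.var aP) (.sub (.get aBest (.var vI)) (.lit 1)),
      .rset rRad (.var aP) (.get rMin (.sub (.get aBest (.var vI)) (.lit 1))),
      .nass aP (.add (.var aP) (.lit 1))])
    .skip)

/-- Within the loop the classes below `i` have completed round `j + 1`, the others only round `j`. A
class with fewer than `k` elements repeats some of them; a repetition has radius `0` and enters no
net with `t > 0`. -/
theorem addPoints_spec {top : ℝ} {j : ℕ}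
    (hbest : ∀ c < m, BestOk I n (s.real rMin) (s.nat aBest) c)
    (hP : s.nat aP 0 ≤ j * m) (hpt : ∀ p < s.nat aP 0, s.nat aPt p < n)
    (hgood : ∀ c < m, Good I top c j (s.nat aP 0) (s.nat aPt) (s.real rRad) (s.real rMin)) :
    Does I addPoints s (7 * m + 2) fun s' =>
      s'.nat aP 0 ≤ (j + 1) * m ∧ (∀ p < s'.nat aP 0, s'.nat aPt p < n) ∧
      ∀ c < m, Good I top c (j + 1) (s'.nat aP 0) (s'.nat aPt) (s'.real rRad)
        (fun u => min (s.real rMin u) (I.d u (s.nat aBest (I.col u) - 1))) := by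
  refine (Does.for (N := m) (T := 5) (fun i s' =>
      s'.nat aP 0 ≤ j * m + i ∧ (∀ p < s'.nat aP 0, s'.nat aPt p < n) ∧
      (∀ c < i, Good I top c (j + 1) (s'.nat aP 0) (s'.nat aPt) (s'.real rRad)
        (fun u => min (s.real rMin u) (I.d u (s.nat aBest (I.col u) - 1)))) ∧
      ∀ c < m, i ≤ c → Good I top c j (s'.nat aP 0) (s'.nat aPt) (s'.real rRad) (s.real rMin))
      (by decide) (fun j s x h => by simpa using h) (fun s' _ => rfl) ?_ ?_ ?_).le (by omega)
  · exact ⟨by omega, hpt, by omega, fun c hc _ => hgood c hc⟩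
  · rintro i hi s' hf hv ⟨h1, h2, h3, h4⟩
    have e1 : s'.nat aBest = s.nat aBest := hf.nat _ (by decide)
    have e2 : s'.real rMin = s.real rMin := hf.real _ (by decide)
    refine (Does.of_wp ?_).le (by decide : _ ≤ 5)
    simp only [Prog.wp, Prog.block, BExp.holds_nlt, RExp.eval_get, NExp.eval_get, NExp.eval_lit,
      NExp.eval_add, NExp.eval_sub, hv, e1, e2, Store.nat_setNat_self, Store.nat_setNat_of_ne,
      Store.nat_setReal, Store.real_setNat, Store.real_setReal_self, ne_eq, Nat.reduceEqDiff,
      not_false_eq_true, Function.update_self]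
    rcases hbest i hi with ⟨hb, hemp⟩ | ⟨hb, hbn, hbc, hmax⟩
    · refine ⟨fun h => by omega, fun _ => ⟨by omega, h2, fun c hc => ?_, fun c hc hic =>
        h4 c hc (by omega)⟩⟩
      by_cases hci : c = i
      · subst hci
        exact ((h4 c hi le_rfl).mono_empty hemp).congr fun u hu hcu => absurd hcu (hemp u hu)
      · exact h3 c (by omega)
    · refine ⟨fun _ => ⟨by omega, fun p hp => ?_, fun c hc => ?_, fun c hc hic => ?_⟩,
        fun h => by omega⟩
      · rw [Function.update_apply]
        split_ifs with h
        · exact hbn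
        · exact h2 p (by omega)
      · by_cases hci : c = i
        · subst hci
          exact ((h4 c hi le_rfl).add_self hbn hbc hmax).congr fun u hu hcu => by rw [hcu]
        · exact (h3 c (by omega)).add_other (by omega) _
      · exact (h4 c hc (by omega)).add_other (by omega) _
  · rintro s' hf ⟨h1, h2, h3, -⟩
    exact ⟨by rw [Nat.succ_mul]; exact h1, h2, h3⟩

/-- Update the distances to the chosen points. -/
def updateMin : Prog :=
  .for vI .numElems (.ite (.rlt
      (.dist (.var vI) (.sub (.get aBest (.color (.var vI))) (.lit 1))) (.get rMin (.var vI)))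
    (.rset rMin (.var vI) (.dist (.var vI) (.sub (.get aBest (.color (.var vI))) (.lit 1)))) .skip)

theorem updateMin_spec :
    Does I updateMin s (5 * n + 2) fun s' => ∀ u < n, s'.real rMin u =
      min (s.real rMin u) (I.d u (s.nat aBest (I.col u) - 1)) := by
  refine (Does.for (N := n) (T := 3) (fun U s' => ∀ u, s'.real rMin u = if u < U then
      min (s.real rMin u) (I.d u (s.nat aBest (I.col u) - 1)) else s.real rMin u)
      (by decide) (fun j s x h => by simpa using h) (fun s' _ => rfl) ?_ ?_ ?_).le (by omega)
  · simp
  · intro U hU s' hf hv hi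
    have e1 : s'.nat aBest = s.nat aBest := hf.nat _ (by decide)
    have e2 : s'.real rMin U = s.real rMin U := by simp [hi]
    refine (Does.of_wp ?_).le (by decide : _ ≤ 3)
    simp only [Prog.wp, BExp.holds_rlt, RExp.eval_get, RExp.eval_dist, NExp.eval_get,
      NExp.eval_lit, NExp.eval_sub, NExp.eval_color, hv, e1, e2, Store.real_setReal_self]
    refine ⟨fun hc u => ?_, fun hc u => ?_⟩
    · by_cases h : u = U
      · subst h; rw [Function.update_self, if_pos (by omega), min_eq_right hc.le]
      · rw [Function.update_of_ne h, hi]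
        simp only [show u < U + 1 ↔ u < U by omega]
    · by_cases h : u = U
      · subst h; rw [e2, if_pos (by omega), min_eq_left (not_lt.1 hc)]
      · rw [hi]
        simp only [show u < U + 1 ↔ u < U by omega]
  · intro s' hf h u hu
    rw [h u, if_pos hu]

/-- Farthest point sampling in all classes. -/
def sample : Prog := .block [
  .nass aP (.lit 0),
  .for vI .numElems (.rset rMin (.var vI) (.mul (.ofNat .numClasses) (.var rTop))),
  .for vJ (.var aK) (.block [farthest, addPoints, updateMin])]

theorem sample_spec (hk : s.nat aK 0 = I.k) :
    Does I sample s (20 * (I.k + 1) * (n + m + 1)) fun s' =>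
      s'.nat aP 0 ≤ I.k * m ∧
      Sampled I (s.real rTop 0) (s'.nat aP 0) (s'.nat aPt) (s'.real rRad) := by
  have hinit : Does I (.nass aP (.lit 0)) s 1 (fun s' => s'.nat aP 0 = 0) :=
    Does.of_wp (by simp [Prog.wp])
  refine Does.le (hinit.seq
    (T₂ := (n * (1 + 2) + 2) + (I.k * ((12 * (n + m + 1)) + 2) + 2)) ?_) (by nlinarith)
  intro s₁ hf₁ h0
  have hmin : Does I (.for vI .numElems (.rset rMin (.var vI) (.mul (.ofNat .numClasses)
      (.var rTop)))) s₁ (n * (1 + 2) + 2)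
      (fun s' => ∀ u < n, s'.real rMin u = m * s.real rTop 0) := by
    refine Does.for (fun U s' => ∀ u < U, s'.real rMin u = m * s.real rTop 0) (by decide)
      (fun j s x h => by simpa using h) (fun s' _ => rfl) (by omega) ?_ (fun _ _ h => h)
    intro U hU s' hf hv hi
    refine (Does.of_wp ?_).le (by decide : _ ≤ 1)
    have e1 : s'.real rTop = s.real rTop := (hf.real _ (by decide)).trans (hf₁.real _ (by decide))
    simp only [Prog.wp, RExp.eval_mul, RExp.eval_ofNat, RExp.eval_get, NExp.eval_numClasses,
      NExp.eval_get, NExp.eval_lit, hv, e1, Store.real_setReal_self, Function.update_apply]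
    intro u hu
    split_ifs with h
    · rfl
    · exact hi u (by omega)
  refine hmin.seq ?_
  intro s₂ hf₂ hμ
  refine Does.for (fun j s' => s'.nat aP 0 ≤ j * m ∧ (∀ p < s'.nat aP 0, s'.nat aPt p < n) ∧
      ∀ c < m, Good I (s.real rTop 0) c j (s'.nat aP 0) (s'.nat aPt) (s'.real rRad)
        (s'.real rMin)) (by decide) (fun j s x h => by simpa using h) ?_ ?_ ?_ ?_
  · intro s' hf
    simp [hf.nat aK (by decide), hf₂.nat aK (by decide), hf₁.nat aK (by decide), hk]
  · have hP : s₂.nat aP 0 = 0 := by rw [hf₂.nat _ (by decide), h0]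
    rw [hP]
    refine ⟨by omega, by omega, fun c hc => ⟨by simp, by omega, fun u hu _ => Or.inl (hμ u hu), ?_,
      fun _ _ => Or.inl (by omega)⟩⟩
    intro t p hp
    have := (mem_net.1 hp).1
    omega
  · rintro j hj s' hf hv ⟨h1, h2, h3⟩
    refine Does.le (farthest_spec.seq (T₂ := (7 * m + 2) + (5 * n + 2)) ?_) (by omega)
    intro s₃ hf₃ hb
    have a1 : s₃.real rMin = s'.real rMin := hf₃.real _ (by decide)
    have a2 : s₃.nat aP = s'.nat aP := hf₃.nat _ (by decide)
    have a3 : s₃.nat aPt = s'.nat aPt := hf₃.nat _ (by decide)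
    have a4 : s₃.real rRad = s'.real rRad := hf₃.real _ (by decide)
    refine (addPoints_spec (s := s₃) (top := s.real rTop 0) (j := j) (by rw [a1]; exact hb)
      (by rw [a2]; exact h1) (by rw [a2, a3]; exact h2)
      (by rw [a1, a2, a3, a4]; exact h3)).seq ?_
    rintro s₄ hf₄ ⟨g1, g2, g3⟩
    refine updateMin_spec.mono le_rfl ?_
    intro s₅ hf₅ hm
    rw [hf₅.nat aP (by decide), hf₅.nat aPt (by decide), hf₅.real rRad (by decide)]
    refine ⟨g1, g2, fun c hc => (g3 c hc).congr fun u hu _ => ?_⟩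
    rw [hm u hu, hf₄.real rMin (by decide), hf₄.nat aBest (by decide)]
  · rintro s' hf ⟨h1, h2, h3⟩
    exact ⟨h1, h2, _, h3⟩

end Greedy

/-! ### Slots and the default solution -/

section Setup

variable {n m : ℕ} {I : Instance n m} {s : Store}

/-- List the classes with multiplicities given by the quotas. -/
def setup : Prog := .for vI .numClasses (.for vJ (.quota (.var vI))
  (.block [.nset aSlot (.var aK) (.var vI), .nass aK (.add (.var aK) (.lit 1))]))

theorem card_filter_update (slot : ℕ → ℕ) (N i c : ℕ) :
    ((Finset.range (N + 1)).filter fun j => Function.update slot N i j = c).card =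
      ((Finset.range N).filter fun j => slot j = c).card + if i = c then 1 else 0 := by
  rw [Finset.card_filter, Finset.card_filter, Finset.sum_range_succ, Function.update_self]
  congr 1
  refine Finset.sum_congr rfl fun j hj => ?_
  rw [Function.update_of_ne (Finset.mem_range.1 hj).ne]

theorem quo_le_k (I : Instance n m) {i : ℕ} (hi : i < m) : I.quo i ≤ I.k := by
  rw [← I.sum_quo]
  exact Finset.single_le_sum (f := I.quo) (fun _ _ => Nat.zero_le _) (Finset.mem_range.2 hi)

theorem setup_spec (hk : s.nat aK 0 = 0) :
    Does I setup s (4 * (I.k * m + m + 1)) fun s' =>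
      s'.nat aK 0 = I.k ∧ IsSlots I (s'.nat aSlot) := by
  refine (Does.for (N := m) (T := I.k * (2 + 2) + 2) (fun i s' =>
      s'.nat aK 0 = ∑ c ∈ Finset.range i, I.quo c ∧ (∀ j < s'.nat aK 0, s'.nat aSlot j < i) ∧
      ∀ c < i, ((Finset.range (s'.nat aK 0)).filter fun j => s'.nat aSlot j = c).card = I.quo c)
      (by decide) (fun j s x h => by simpa using h) (fun s' _ => rfl) ?_ ?_ ?_).le
      (by nlinarith)
  · simp [hk]
  · rintro i hi s' hf hv ⟨h1, h2, h3⟩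
    refine Does.le (Does.for (N := I.quo i) (T := 2) (fun r s'' =>
        s''.nat aK 0 = ∑ c ∈ Finset.range i, I.quo c + r ∧
        (∀ j < s''.nat aK 0, s''.nat aSlot j < i + 1) ∧
        ∀ c < i + 1, ((Finset.range (s''.nat aK 0)).filter fun j => s''.nat aSlot j = c).card =
          if c = i then r else I.quo c)
        (by decide) (fun j s x h => by simpa using h) ?_ ?_ ?_ ?_)
        (by have := quo_le_k I hi; gcongr)
    · intro s'' hf''
      simp [hf''.nat vI (by decide), hv]
    · refine ⟨h1, fun j hj => (h2 j hj).trans (by omega), fun c hc => ?_⟩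
      split_ifs with h
      · subst h
        refine Finset.card_eq_zero.2 (Finset.filter_eq_empty_iff.2 fun j hj h => ?_)
        have := h2 j (Finset.mem_range.1 hj)
        omega
      · exact h3 c (by omega)
    · rintro r hr s'' hf'' hv'' ⟨g1, g2, g3⟩
      have e1 : s''.nat vI 0 = i := by rw [hf''.nat _ (by decide), hv]
      refine (Does.of_wp ?_).le (by decide : _ ≤ 2)
      simp only [Prog.wp, Prog.block, NExp.eval_get, NExp.eval_lit, NExp.eval_add, e1,
        Store.nat_setNat_self, Store.nat_setNat_of_ne, ne_eq,
        not_false_eq_true, Function.update_self, OfNat.one_ne_ofNat, OfNat.ofNat_ne_one]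
      refine ⟨by omega, fun j hj => ?_, fun c hc => ?_⟩
      · rw [Function.update_apply]
        split_ifs with h
        · omega
        · exact g2 j (by omega)
      · rw [card_filter_update, g3 c hc]
        by_cases h : c = i
        · simp [h]
        · rw [if_neg h, if_neg h, if_neg (Ne.symm h), add_zero]
    · rintro s'' hf'' ⟨g1, g2, g3⟩
      refine ⟨by rw [g1, Finset.sum_range_succ], g2, fun c hc => ?_⟩
      rw [g3 c hc]
      split_ifs with h
      · rw [h]
      · rfl
  · rintro s' hf ⟨h1, h2, h3⟩
    rw [I.sum_quo] at h1
    rw [h1] at h2 h3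
    exact ⟨h1, h2, h3⟩

/-- Choose elements greedily until all quotas are filled. -/
def fallback : Prog :=
  .for vI .numElems (.ite (.nlt (.get aCnt (.color (.var vI))) (.quota (.color (.var vI))))
    (.block [
      .nset 0 (.var vI) (.lit 1),
      .nset aCnt (.color (.var vI)) (.add (.get aCnt (.color (.var vI))) (.lit 1))])
    .skip)

theorem card_filter_range (p : ℕ → Prop) [DecidablePred p] :
    ((Finset.range n).filter p).card = (Finset.univ.filter fun u : Fin n => p u).card := by
  rw [Finset.card_filter, Finset.card_filter, Finset.sum_range]

theorem fallback_spec (h0 : ∀ u, s.nat 0 u = 0) (hc : ∀ c, s.nat aCnt c = 0)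
    (hq : ∀ i, I.quota i ≤ (I.group i).card) :
    Does I fallback s (6 * n + 2) fun s' => I.IsFair (s'.output n) := by
  refine (Does.for (N := n) (T := 4) (fun U s' =>
      (∀ u, U ≤ u → s'.nat 0 u = 0) ∧ ∀ c < m,
      (s'.nat aCnt c = ((Finset.range U).filter fun u => I.col u = c ∧ s'.nat 0 u = 1).card ∧
        s'.nat aCnt c ≤ I.quo c) ∧
      (s'.nat aCnt c = I.quo c ∨ ∀ u < U, I.col u = c → s'.nat 0 u = 1))
      (by decide) (fun j s x h => by simpa using h) (fun s' _ => rfl) ?_ ?_ ?_).le (by omega)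
  · exact ⟨fun u _ => h0 u, fun c _ => ⟨⟨by simp [hc], by simp [hc]⟩, Or.inr (by omega)⟩⟩
  · rintro U hU s' hf hv ⟨hz, hi⟩
    refine (Does.of_wp ?_).le (by decide : _ ≤ 4)
    simp only [Prog.wp, Prog.block, BExp.holds_nlt, NExp.eval_get, NExp.eval_lit, NExp.eval_add,
      NExp.eval_color, NExp.eval_quota, hv, Store.nat_setNat_self, Store.nat_setNat_of_ne, ne_eq,
      not_false_eq_true, OfNat.ofNat_ne_zero, OfNat.zero_ne_ofNat]
    have hsucc : ∀ (o : ℕ → ℕ) (c : ℕ),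
        ((Finset.range (U + 1)).filter fun u => I.col u = c ∧ o u = 1).card =
        ((Finset.range U).filter fun u => I.col u = c ∧ o u = 1).card +
          if I.col U = c ∧ o U = 1 then 1 else 0 := by
      intro o c
      rw [Finset.card_filter, Finset.card_filter, Finset.sum_range_succ]
    refine ⟨fun hlt => ⟨fun u hu => ?_, fun c hcm => ?_⟩, fun hlt => ⟨fun u hu => hz u (by omega),
      fun c hcm => ?_⟩⟩
    · rw [Function.update_of_ne (by omega)]; exact hz u (by omega)
    · obtain ⟨⟨h1, h2⟩, h3⟩ := hi c hcm
      have hold : ((Finset.range U).filter fun u => I.col u = c ∧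
          Function.update (s'.nat 0) U 1 u = 1).card =
          ((Finset.range U).filter fun u => I.col u = c ∧ s'.nat 0 u = 1).card := by
        congr 1
        refine Finset.filter_congr fun u hu => ?_
        rw [Function.update_of_ne (Finset.mem_range.1 hu).ne]
      rw [hsucc, hold, Function.update_self, ← h1]
      by_cases hUc : I.col U = c
      · subst hUc
        rw [Function.update_self, if_pos ⟨rfl, rfl⟩]
        refine ⟨⟨rfl, by omega⟩, ?_⟩
        rcases h3 with h3 | h3
        · omega
        · refine Or.inr fun u hu hcu => ?_
          rw [Function.update_apply]
          split_ifs with h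
          · rfl
          · exact h3 u (by omega) hcu
      · rw [Function.update_of_ne (Ne.symm hUc), if_neg fun h => hUc h.1]
        refine ⟨⟨rfl, h2⟩, h3.imp id fun h3 u hu hcu => ?_⟩
        have huU : u ≠ U := by rintro rfl; exact hUc hcu
        rw [Function.update_of_ne huU]
        exact h3 u (by omega) hcu
    · obtain ⟨⟨h1, h2⟩, h3⟩ := hi c hcm
      rw [hsucc, ← h1, if_neg (by rw [hz U le_rfl]; simp)]
      refine ⟨⟨rfl, h2⟩, ?_⟩
      by_cases hUc : I.col U = c
      · subst hUc; left; omega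
      · refine h3.imp id fun h3 u hu hcu => ?_
        have huU : u ≠ U := by rintro rfl; exact hUc hcu
        exact h3 u (by omega) hcu
  · rintro s' hf ⟨-, hi⟩ i
    obtain ⟨⟨h1, h2⟩, h3⟩ := hi i i.2
    have hS : (s'.output n ∩ I.group i).card =
        ((Finset.range n).filter fun u => I.col u = i ∧ s'.nat 0 u = 1).card := by
      rw [card_filter_range]
      congr 1
      ext u
      simp only [Store.output, Instance.group, Finset.mem_inter, Finset.mem_filter,
        Finset.mem_univ, true_and, I.col_coe, Fin.ext_iff]
      exact and_comm
    rw [hS, ← h1]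
    rw [I.quo_coe] at h2 h3
    rcases h3 with h3 | h3
    · exact h3
    -- The whole class has been taken, and it has at least as many elements as its quota.
    · refine le_antisymm h2 ((hq i).trans ?_)
      rw [← hS] at h1
      rw [h1]
      refine Finset.card_le_card fun u hu => Finset.mem_inter.2 ⟨?_, hu⟩
      simp only [Instance.group, Finset.mem_filter, Finset.mem_univ, true_and] at hu
      simp only [Store.output, Finset.mem_filter, Finset.mem_univ, true_and]
      exact h3 u u.2 (by rw [I.col_coe, hu])

end Setup

/-! ### The optimal threshold -/

section Optimum

variable {n m : ℕ} {I : Instance n m}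

/-- At the threshold `top` all net points are adjacent, so there is only one component, while `k ≥
2` are needed. -/
theorem not_passes_top {P : ℕ} {pt : ℕ → ℕ} {rad : ℕ → ℝ} {top : ℝ} (hk : 1 < I.k)
    (hlt : ∀ p < P, pt p < n) (htop : ∀ u < n, ∀ v < n, I.d u v < top) :
    ¬ Passes I P pt rad top := by
  intro h
  obtain ⟨S, hSY, -, hi, hc⟩ := h (Finset.range m) (Finset.Subset.refl _)
  rw [I.sum_quo] at hc
  obtain ⟨p, hp, q, hq, hpq⟩ := Finset.one_lt_card.1 (hk.trans_le hc)
  have hp' := hlt p (mem_net.1 (hSY hp)).1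
  have hq' := hlt q (mem_net.1 (hSY hq)).1
  exact hpq (hi p hp q hq (SimpleGraph.Adj.reachable
    ⟨hpq, hSY hp, hSY hq, htop _ hp' _ hq'⟩))

/-- A sample is in the net exactly for `t ≤ rad p / m`. With no such value strictly between `lo` and
`hi`, the net is constant on `(lo, hi]`, including the right end. -/
theorem net_eq_of_inside {P : ℕ} {rad : ℕ → ℝ} {lo hi t : ℝ} (hm : 0 < m)
    (h : inside P (fun p => rad p / m) lo hi = ∅) (h1 : lo < t) (h2 : t ≤ hi) :
    net m P rad t = net m P rad hi := by
  have hm' : (0 : ℝ) < m := by exact_mod_cast hm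
  ext p
  rw [mem_net, mem_net]
  refine and_congr_right fun hp => ⟨fun hr => ?_, fun hr => ?_⟩
  · by_contra hlt
    have : p ∈ inside P (fun p => rad p / m) lo hi := by
      refine mem_inside.2 ⟨hp, h1.trans_le ?_, ?_⟩
      · rw [le_div_iff₀ hm']; linarith
      · rw [div_lt_iff₀ hm']; linarith
    rw [h] at this
    simp at this
  · exact (mul_le_mul_of_nonneg_left h2 hm'.le).trans hr

/-- On `(lo, hi]` neither the net nor the set of keys below `t` changes, so the failure at `hi` is a
failure everywhere. -/
theorem not_passes_between {P M : ℕ} {pt y : ℕ → ℕ} {rad key : ℕ → ℝ} {lo₁ hi₁ lo hi t : ℝ}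
    (hm : 0 < m) (hrad : inside P (fun p => rad p / m) lo₁ hi₁ = ∅)
    (hp : PrimOrder I pt (net m P rad hi₁) M y key) (hlo : lo₁ ≤ lo) (hhi : hi ≤ hi₁)
    (hkey : inside M key lo hi = ∅) (hfail : ¬ Passes I P pt rad hi) (h1 : lo < t) (h2 : t ≤ hi) :
    ¬ Passes I P pt rad t := by
  intro h
  refine hfail ?_
  unfold Passes at h ⊢
  rw [net_eq_of_inside hm hrad (by linarith) (by linarith)] at h ⊢
  refine hp.rich_congr (fun j hj _ => ⟨fun hk => hk.trans_le h2, fun hk => ?_⟩) h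
  by_contra hge
  have : j ∈ inside M key lo hi := mem_inside.2 ⟨hj, by linarith, hk⟩
  rw [hkey] at this
  simp at this

/-- A fair set of diversity above `(3m - 1) lo` would still have diversity at least `(3m - 1) t` for
some `t` slightly above `lo`, and `rich_of_fair` would make this `t` pass. -/
theorem opt_le_of_not_passes {P : ℕ} {pt : ℕ → ℕ} {rad : ℕ → ℝ} {top lo hi : ℝ} (hm : 0 < m)
    (hs : Sampled I top P pt rad) (h0 : 0 ≤ lo) (hlh : lo < hi) (htop : hi ≤ top)
    (hfail : ∀ t, lo < t → t ≤ hi → ¬ Passes I P pt rad t) :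
    I.opt ≤ ENNReal.ofReal ((3 * m - 1) * lo) := by
  have hm' : (1 : ℝ) ≤ m := by exact_mod_cast hm
  have hm3 : (0 : ℝ) < 3 * m - 1 := by linarith
  refine iSup_le fun S => iSup_le fun hS => ?_
  by_contra hlt
  push Not at hlt
  have hd : ∀ u ∈ S, ∀ v ∈ S, u ≠ v → (3 * (m : ℝ) - 1) * lo < I.dist u v := by
    intro u hu v hv huv
    have h1 : I.div S ≤ ENNReal.ofReal (I.dist u v) :=
      (iInf₂_le u hu).trans ((iInf₂_le v hv).trans (iInf_le _ huv))
    exact (ENNReal.ofReal_lt_ofReal_iff_of_nonneg (by positivity)).1 (hlt.trans_le h1)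
  -- Finitely many strict inequalities at `lo` persist on a right neighbourhood of `lo`.
  have hev : ∀ᶠ t in nhdsWithin lo (Set.Ioi lo), ∀ u ∈ S, ∀ v ∈ S, u ≠ v →
      (3 * (m : ℝ) - 1) * t ≤ I.dist u v := by
    rw [Filter.eventually_all_finset]
    intro u hu
    rw [Filter.eventually_all_finset]
    intro v hv
    by_cases huv : u = v
    · exact Filter.Eventually.of_forall fun t h => absurd huv h
    · have h1 : lo < I.dist u v / (3 * m - 1) := by
        rw [lt_div_iff₀ hm3, mul_comm]; exact hd u hu v hv huv
      filter_upwards [Ioo_mem_nhdsGT h1] with t ht _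
      have := ht.2.le
      rw [le_div_iff₀ hm3] at this
      linarith
  obtain ⟨t, ht, htl, hth⟩ := (hev.and (Ioo_mem_nhdsGT hlh)).exists
  exact hfail t htl hth.le (rich_of_fair (hs.sep (h0.trans_lt htl)) (hs.covers (hth.le.trans htop))
    hS ht)

theorem card_eq_k_of_isFair {S : Finset (Fin n)} (hS : I.IsFair S) : S.card = I.k := by
  rw [← I.sum_quo, ← card_fair hS (Finset.Subset.refl _), Finset.filter_true_of_mem]
  exact fun u _ => Finset.mem_range.2 (I.col_lt u.2)

theorem div_eq_top_of_card {S : Finset (Fin n)} (hS : S.card ≤ 1) : I.div S = ⊤ := by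
  rw [Finset.card_le_one] at hS
  simp only [Instance.div, iInf_eq_top]
  exact fun u hu v hv huv => absurd (hS u hu v hv) huv

end Optimum

/-! ### The algorithm -/

section Main

variable {n m : ℕ} {I : Instance n m} {s : Store}

/-- Search among the radii of the points. -/
def searchRadii : Prog := .block [
  .block [.rass rLo (.ofNat (.lit 0)), .rass rHi (.var rTop), .nass aNc (.var aP)],
  .for vI (.var aP) (.rset rCand (.var vI) (.div (.get rRad (.var vI)) (.ofNat .numClasses))),
  search]

/-- Search among the keys for the threshold `rHi`. -/
def searchKeys : Prog := .block [
  .rass rT (.var rHi),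
  test,
  .nass aNc (.var aM),
  .for vI (.var aM) (.rset rCand (.var vI) (.get rKey (.var vI))),
  search]

/-- Time bound for a search. -/
def searchTime (I : Instance n m) : ℕ :=
  130 * (Nat.size (I.k * m) + 2) * ((I.k * m + 1) * (I.k * m + 1))

theorem inside_congr {N : ℕ} {f g : ℕ → ℝ} (h : ∀ a < N, f a = g a) (lo hi : ℝ) :
    inside N f lo hi = inside N g lo hi := by
  ext a
  simp only [mem_inside]
  exact and_congr_right fun ha => by rw [h a ha]

set_option maxRecDepth 4000 in
theorem searchRadii_spec {top : ℝ} {P : ℕ} {pt : ℕ → ℕ} {rad : ℕ → ℝ} (hk : s.nat aK 0 = I.k)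
    (hk1 : 1 < I.k) (hslot : IsSlots I (s.nat aSlot)) (htop : s.real rTop 0 = top)
    (hP : s.nat aP 0 = P) (hPk : P ≤ I.k * m) (hpt : s.nat aPt = pt) (hrad : s.real rRad = rad)
    (hs : Sampled I top P pt rad) (h0 : 0 < top) (hd : ∀ u < n, ∀ v < n, I.d u v < top) :
    Does I searchRadii s (3 * (I.k * m) + 5 + searchTime I) fun s' =>
      Bracket I P pt rad (s'.real rLo 0) (s'.real rHi 0) ∧ s'.real rHi 0 ≤ top ∧
      inside P (fun p => rad p / m) (s'.real rLo 0) (s'.real rHi 0) = ∅ := by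
  have hinit : Does I (.block [.rass rLo (.ofNat (.lit 0)), .rass rHi (.var rTop),
      .nass aNc (.var aP)]) s 3
      (fun s' => s'.real rLo 0 = 0 ∧ s'.real rHi 0 = top ∧ s'.nat aNc 0 = P) :=
    (Does.of_wp (by simp [Prog.wp, Prog.block, htop, hP])).le (by decide)
  refine Does.le (hinit.seq (T₂ := (P * (1 + 2) + 2) + searchTime I) ?_) (by omega)
  rintro s₁ hf₁ ⟨i1, i2, i3⟩
  have hfill : Does I (.for vI (.var aP) (.rset rCand (.var vI)
      (.div (.get rRad (.var vI)) (.ofNat .numClasses)))) s₁ (P * (1 + 2) + 2)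
      (fun s' => ∀ p < P, s'.real rCand p = rad p / m) := by
    refine Does.for (fun j s' => ∀ p < j, s'.real rCand p = rad p / m) (by decide)
      (fun j s x h => by simpa using h) ?_ (by omega) ?_ (fun _ _ h => h)
    · intro s' hf
      simp [hf.nat aP (by decide), hf₁.nat aP (by decide), hP]
    · intro j hj s' hf hv hi
      have e1 : s'.real rRad = rad := by
        rw [hf.real _ (by decide), hf₁.real _ (by decide), hrad]
      refine (Does.of_wp ?_).le (by decide : _ ≤ 1)
      simp only [Prog.wp, RExp.eval_div, RExp.eval_get, RExp.eval_ofNat, NExp.eval_numClasses,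
        NExp.eval_get, NExp.eval_lit, hv, e1, Store.real_setReal_self, Function.update_apply]
      intro p hp
      split_ifs with h
      · rw [h]
      · exact hi p (by omega)
  refine hfill.seq ?_
  intro s₂ hf₂ hc
  refine (search_spec (s := s₂) (N := P) (P := P) (pt := pt) (rad := rad) (lo := 0) (hi := top)
    ?_ hPk ?_ hs.lt ?_ ?_ ?_ ?_ hPk rfl ?_ ?_ ?_).mono le_rfl ?_
  · rw [hf₂.nat _ (by decide), hf₁.nat _ (by decide), hP]
  · rw [hf₂.nat _ (by decide), hf₁.nat _ (by decide), hpt]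
  · rw [hf₂.real _ (by decide), hf₁.real _ (by decide), hrad]
  · rw [hf₂.nat _ (by decide), hf₁.nat _ (by decide), hk]
  · rw [hf₂.nat aSlot (by decide), hf₁.nat aSlot (by decide)]; exact hslot
  · rw [hf₂.nat _ (by decide), i3]
  · rw [hf₂.real _ (by decide), i1]
  · rw [hf₂.real _ (by decide), i2]
  · exact ⟨le_rfl, h0, Or.inl rfl, not_passes_top hk1 hs.lt hd⟩
  · rintro s₃ hf₃ ⟨-, h2, h3, h4⟩
    exact ⟨h3, h2, by rw [← h4]; exact inside_congr (fun p hp => (hc p hp).symm) _ _⟩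

set_option maxRecDepth 4000 in
-- The test at `hi`, known to fail, is run only for its by-product: the Prim keys of the net shared
-- by all thresholds in `(lo, hi]`. They are copied to `rCand` because the tests of the search
-- overwrite `rKey`.
theorem searchKeys_spec {P : ℕ} {pt : ℕ → ℕ} {rad : ℕ → ℝ} (hk : s.nat aK 0 = I.k)
    (hm : 0 < m) (hslot : IsSlots I (s.nat aSlot))
    (hP : s.nat aP 0 = P) (hPk : P ≤ I.k * m) (hpt : s.nat aPt = pt) (hptn : ∀ p < P, pt p < n)
    (hrad : s.real rRad = rad) (hb : Bracket I P pt rad (s.real rLo 0) (s.real rHi 0))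
    (hin : inside P (fun p => rad p / m) (s.real rLo 0) (s.real rHi 0) = ∅) :
    Does I searchKeys s
      (100 * (I.k * m + 1) * (I.k * m + 1) + 3 * (I.k * m) + 4 + searchTime I) fun s' =>
      Bracket I P pt rad (s'.real rLo 0) (s'.real rHi 0) ∧ s'.real rHi 0 ≤ s.real rHi 0 ∧
      ∀ t, s'.real rLo 0 < t → t ≤ s'.real rHi 0 → ¬ Passes I P pt rad t := by
  have hset : Does I (.rass rT (.var rHi)) s 1 (fun s' => s'.real rT 0 = s.real rHi 0) :=
    Does.of_wp (by simp [Prog.wp])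
  refine Does.le (hset.seq (T₂ := 100 * (I.k * m + 1) * (I.k * m + 1) +
    (1 + ((I.k * m * (1 + 2) + 2) + searchTime I))) ?_) (by omega)
  intro s₁ hf₁ hT
  have a1 : s₁.nat aP 0 = P := by rw [hf₁.nat _ (by decide), hP]
  have a2 : s₁.nat aPt = pt := by rw [hf₁.nat _ (by decide), hpt]
  have a3 : s₁.real rRad = rad := by rw [hf₁.real _ (by decide), hrad]
  have a4 : s₁.nat aSlot = s.nat aSlot := hf₁.nat _ (by decide)
  have a5 : s₁.nat aK 0 = I.k := by rw [hf₁.nat _ (by decide), hk]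
  refine (test_spec (s := s₁) (by rw [a1]; exact hPk) (by rw [a1, a2]; exact hptn) a5
    (by rw [a4]; exact hslot)).seq ?_
  rintro s₂ hf₂ ⟨hM, hp, -⟩
  rw [a1] at hM
  rw [a1, a2, a3, hT] at hp
  set M := s₂.nat aM 0 with hMdef
  have hnc : Does I (.nass aNc (.var aM)) s₂ 1 (fun s' => s'.nat aNc 0 = M) :=
    Does.of_wp (by simp [Prog.wp, hMdef])
  refine hnc.seq ?_
  intro s₃ hf₃ hN
  have hfill : Does I (.for vI (.var aM) (.rset rCand (.var vI) (.get rKey (.var vI)))) s₃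
      (M * (1 + 2) + 2) (fun s' => ∀ p < M, s'.real rCand p = s₂.real rKey p) := by
    refine Does.for (fun j s' => ∀ p < j, s'.real rCand p = s₂.real rKey p) (by decide)
      (fun j s x h => by simpa using h) ?_ (by omega) ?_ (fun _ _ h => h)
    · intro s' hf
      simp [hf.nat aM (by decide), hf₃.nat aM (by decide), hMdef]
    · intro j hj s' hf hv hi
      have e1 : s'.real rKey = s₂.real rKey := by
        rw [hf.real _ (by decide), hf₃.real _ (by decide)]
      refine (Does.of_wp ?_).le (by decide : _ ≤ 1)
      simp only [Prog.wp, RExp.eval_get, NExp.eval_get, NExp.eval_lit, hv, e1,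
        Store.real_setReal_self, Function.update_apply]
      intro p hp
      split_ifs with h
      · rw [h]
      · exact hi p (by omega)
  refine (hfill.le (by gcongr; omega)).seq ?_
  intro s₄ hf₄ hc
  refine (search_spec (s := s₄) (N := M) (P := P) (pt := pt) (rad := rad) (lo := s.real rLo 0)
    (hi := s.real rHi 0) ?_ hPk ?_ hptn ?_ ?_ ?_ ?_ (hM.trans hPk) rfl ?_ ?_ hb).mono le_rfl ?_
  · rw [hf₄.nat _ (by decide), hf₃.nat _ (by decide), hf₂.nat _ (by decide), a1]
  · rw [hf₄.nat _ (by decide), hf₃.nat _ (by decide), hf₂.nat _ (by decide), a2]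
  · rw [hf₄.real _ (by decide), hf₃.real _ (by decide), hf₂.real _ (by decide), a3]
  · rw [hf₄.nat _ (by decide), hf₃.nat _ (by decide), hf₂.nat _ (by decide), a5]
  · rw [hf₄.nat aSlot (by decide), hf₃.nat aSlot (by decide), hf₂.nat aSlot (by decide), a4]
    exact hslot
  · rw [hf₄.nat _ (by decide), hN]
  · rw [hf₄.real _ (by decide), hf₃.real _ (by decide), hf₂.real _ (by decide),
      hf₁.real _ (by decide)]
  · rw [hf₄.real _ (by decide), hf₃.real _ (by decide), hf₂.real _ (by decide),
      hf₁.real _ (by decide)]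
  · rintro s₅ hf₅ ⟨h1, h2, h3, h4⟩
    refine ⟨h3, h2, fun t ht1 ht2 => not_passes_between hm hin hp h1 h2 ?_ h3.fail ht1 ht2⟩
    rw [← h4]
    exact inside_congr (fun p hp => (hc p hp).symm) _ _

/-- Compute the best threshold. -/
def optimize : Prog := .block [bound, sample, searchRadii, searchKeys]

/-- Time bound for the computation of the best threshold. -/
def optimizeTime (I : Instance n m) : ℕ :=
  (3 * n + 4) + (20 * (I.k + 1) * (n + m + 1) + ((3 * (I.k * m) + 5 + searchTime I) +
    (100 * (I.k * m + 1) * (I.k * m + 1) + 3 * (I.k * m) + 4 + searchTime I)))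

set_option maxRecDepth 4000 in
theorem optimize_spec (hk : s.nat aK 0 = I.k) (hk1 : 1 < I.k) (hslot : IsSlots I (s.nat aSlot)) :
    Does I optimize s (optimizeTime I) fun s' =>
      s'.nat aP 0 ≤ I.k * m ∧ (∀ p < s'.nat aP 0, s'.nat aPt p < n) ∧ 0 ≤ s'.real rLo 0 ∧
      (s'.real rLo 0 = 0 ∨ Passes I (s'.nat aP 0) (s'.nat aPt) (s'.real rRad) (s'.real rLo 0)) ∧
      I.opt ≤ ENNReal.ofReal ((3 * m - 1) * s'.real rLo 0) := by
  have hm : 0 < m := (Nat.zero_le _).trans_lt (hslot.1 0 (by omega))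
  refine bound_spec.seq ?_
  rintro s₁ hf₁ ⟨h0, hd⟩
  refine (sample_spec (by rw [hf₁.nat _ (by decide), hk])).seq ?_
  rintro s₂ hf₂ ⟨hPk, hs⟩
  have b1 : s₂.nat aK 0 = I.k := by rw [hf₂.nat _ (by decide), hf₁.nat _ (by decide), hk]
  have b2 : s₂.nat aSlot = s.nat aSlot := by rw [hf₂.nat _ (by decide), hf₁.nat _ (by decide)]
  refine (searchRadii_spec (s := s₂) (top := s₁.real rTop 0) b1 hk1 (by rw [b2]; exact hslot)
    (by rw [hf₂.real _ (by decide)]) rfl hPk rfl rfl hs h0 hd).seq ?_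
  rintro s₃ hf₃ ⟨hb, hle, hin⟩
  have c1 : s₃.nat aP = s₂.nat aP := hf₃.nat _ (by decide)
  have c2 : s₃.nat aPt = s₂.nat aPt := hf₃.nat _ (by decide)
  have c3 : s₃.real rRad = s₂.real rRad := hf₃.real _ (by decide)
  refine (searchKeys_spec (s := s₃) (by rw [hf₃.nat _ (by decide), b1]) hm
    (by rw [hf₃.nat aSlot (by decide), b2]; exact hslot) (by rw [c1]) hPk c2 hs.lt c3 hb hin).mono
    le_rfl ?_
  rintro s₄ hf₄ ⟨hb', hle', hfail⟩
  rw [hf₄.nat aP (by decide), hf₄.nat aPt (by decide), hf₄.real rRad (by decide), c1, c2, c3]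
  exact ⟨hPk, hs.lt, hb'.nonneg, hb'.pass,
    opt_le_of_not_passes hm hs hb'.nonneg hb'.lt (hle'.trans hle) hfail⟩

/-- The approximation algorithm. -/
def fairFlow : Prog := .block [
  setup,
  .ite (.nlt (.lit 1) (.var aK)) optimize .skip,
  .ite (.rlt (.ofNat (.lit 0)) (.var rLo)) (.block [.rass rT (.var rLo), test, writeOut]) fallback]

/-- Time bound for writing the solution. -/
def outputTime (I : Instance n m) : ℕ :=
  (1 + (100 * (I.k * m + 1) * (I.k * m + 1) + (5 * (I.k * m) + 2))) + (6 * n + 2) + 1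

theorem le_div_of_forall {S : Finset (Fin n)} {t : ℝ}
    (h : ∀ u ∈ S, ∀ v ∈ S, u ≠ v → t ≤ I.dist u v) : ENNReal.ofReal t ≤ I.div S :=
  le_iInf₂ fun u hu => le_iInf₂ fun v hv => le_iInf fun huv =>
    ENNReal.ofReal_le_ofReal (h u hu v hv huv)

/-- For `m ≥ 1` the truncated subtraction in `ℝ≥0∞` agrees with the real one. -/
theorem ofReal_three_mul_sub_one (m : ℕ) (hm : 0 < m) (x : ℝ) :
    ENNReal.ofReal ((3 * m - 1) * x) = ENNReal.ofReal x * (3 * (m : ℝ≥0∞) - 1) := by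
  have hm' : (1 : ℝ) ≤ m := by exact_mod_cast hm
  rw [ENNReal.ofReal_mul (by linarith), ENNReal.ofReal_sub _ zero_le_one,
    ENNReal.ofReal_mul (by norm_num), ENNReal.ofReal_natCast, ENNReal.ofReal_one, mul_comm]
  norm_num

set_option maxRecDepth 8000 in
theorem fairFlow_spec (hq : ∀ i, I.quota i ≤ (I.group i).card) :
    Does I fairFlow Store.init (4 * (I.k * m + m + 1) +
      ((if 1 < I.k then optimizeTime I else 0) + 2 + outputTime I)) fun s =>
      I.IsFair (s.output n) ∧ I.opt / (3 * (m : ℝ≥0∞) - 1) ≤ I.div (s.output n) := by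
  refine (setup_spec rfl).seq ?_
  rintro s₁ hf₁ ⟨hk, hslot⟩
  have hz₁ : s₁.nat 0 = Store.init.nat 0 := hf₁.nat _ (by decide)
  have hcnt₁ : s₁.nat aCnt = Store.init.nat aCnt := hf₁.nat _ (by decide)
  have hstage : Does I (.ite (.nlt (.lit 1) (.var aK)) optimize .skip) s₁
      ((if 1 < I.k then optimizeTime I else 0) + 2) (fun s' =>
        -- In the first case any fair set is good enough: its diversity is infinite or the optimum
        -- is `0`.
        (s'.real rLo 0 = 0 ∧ (I.k ≤ 1 ∨ I.opt = 0)) ∨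
        (0 < s'.real rLo 0 ∧ 1 < I.k ∧ s'.nat aP 0 ≤ I.k * m ∧
          (∀ p < s'.nat aP 0, s'.nat aPt p < n) ∧
          Passes I (s'.nat aP 0) (s'.nat aPt) (s'.real rRad) (s'.real rLo 0) ∧
          I.opt ≤ ENNReal.ofReal ((3 * m - 1) * s'.real rLo 0))) := by
    refine Does.ite (T := (if 1 < I.k then optimizeTime I else 0) + 1) ?_ ?_
    · intro hc
      simp only [BExp.holds_nlt, NExp.eval_get, NExp.eval_lit, hk] at hc
      refine (optimize_spec hk hc hslot).mono (by rw [if_pos hc]; omega) ?_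
      rintro s₂ hf₂ ⟨h1, h2, h3, h4, h5⟩
      rcases h3.lt_or_eq with h | h
      · exact Or.inr ⟨h, hc, h1, h2, h4.resolve_left h.ne', h5⟩
      · rw [← h, mul_zero, ENNReal.ofReal_zero] at h5
        exact Or.inl ⟨h.symm, Or.inr (le_antisymm h5 bot_le)⟩
    · intro hc
      simp only [BExp.holds_nlt, NExp.eval_get, NExp.eval_lit, hk] at hc
      refine Does.le (Does.of_wp (p := .skip) (Or.inl ⟨?_, Or.inl (by omega)⟩)) (by
        simp [Prog.cost])
      rw [hf₁.real _ (by decide)]; rfl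
  refine hstage.seq ?_
  intro s₂ hf₂ h
  have hz : ∀ u, s₂.nat 0 u = 0 := by
    intro u; rw [hf₂.nat 0 (by decide), hz₁]; rfl
  have hcnt : ∀ u, s₂.nat aCnt u = 0 := by
    intro u; rw [hf₂.nat aCnt (by decide), hcnt₁]; rfl
  have hk₂ : s₂.nat aK 0 = I.k := by rw [hf₂.nat _ (by decide), hk]
  have hslot₂ : IsSlots I (s₂.nat aSlot) := by rw [hf₂.nat aSlot (by decide)]; exact hslot
  refine Does.ite ?_ ?_
  · intro hc
    simp only [BExp.holds_rlt, RExp.eval_ofNat, RExp.eval_get, NExp.eval_lit, Nat.cast_zero] at hc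
    rcases h with ⟨h, -⟩ | ⟨-, hk1, hPk, hptn, hpass, hopt⟩
    · linarith
    have hm : 0 < m := (Nat.zero_le _).trans_lt (hslot.1 0 (by omega))
    -- The last test need not have been at `rLo`, so it is repeated there to restore the assignment
    -- that is written out.
    have hset : Does I (.rass rT (.var rLo)) s₂ 1 (fun s' => s'.real rT 0 = s₂.real rLo 0) :=
      Does.of_wp (by simp [Prog.wp])
    refine Does.le (hset.seq
      (T₂ := 100 * (I.k * m + 1) * (I.k * m + 1) + (5 * (I.k * m) + 2)) ?_) (by omega)
    intro s₃ hf₃ hT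
    have a1 : s₃.nat aP = s₂.nat aP := hf₃.nat _ (by decide)
    have a2 : s₃.nat aPt = s₂.nat aPt := hf₃.nat _ (by decide)
    have a3 : s₃.real rRad = s₂.real rRad := hf₃.real _ (by decide)
    refine (test_spec (s := s₃) (by rw [a1]; exact hPk) (by rw [a1, a2]; exact hptn)
      (by rw [hf₃.nat _ (by decide), hk₂]) (by rw [hf₃.nat aSlot (by decide)]; exact hslot₂)).seq ?_
    rintro s₄ hf₄ ⟨hM, -, hres⟩
    rw [a1] at hM
    rw [a1, a2, a3, hT] at hres
    rcases hres with ⟨-, hsol⟩ | ⟨-, hnr⟩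
    swap
    · exact absurd hpass hnr
    refine (writeOut_spec (s := s₄) ?_).mono (by omega) ?_
    · intro u; rw [hf₄.nat 0 (by decide), hf₃.nat 0 (by decide), hz u]
    intro s₅ hf₅ hout
    rw [hf₄.nat aPt (by decide), a2] at hout
    have hS : ∀ u : Fin n, u ∈ s₅.output n ↔ ∃ l < s₄.nat aM 0, s₄.nat aOwn l ≠ 0 ∧
        s₂.nat aPt (s₄.nat aY (s₄.nat aOwn l - 1)) = u := by
      intro u
      rw [← hout u]
      simp [Store.output]
    refine ⟨hsol.isFair hc hS, ENNReal.div_le_of_le_mul (hopt.trans ?_)⟩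
    rw [ofReal_three_mul_sub_one m hm]
    gcongr
    exact le_div_of_forall fun u hu v hv huv => hsol.le_dist hS hu hv huv
  · intro hc
    simp only [BExp.holds_rlt, RExp.eval_ofNat, RExp.eval_get, NExp.eval_lit, Nat.cast_zero] at hc
    rcases h with ⟨-, h⟩ | ⟨h, -⟩
    swap
    · exact absurd h hc
    refine (fallback_spec hz hcnt hq).mono (by omega) ?_
    intro s₃ hf₃ hfair
    refine ⟨hfair, ?_⟩
    rcases h with h | h
    · rw [div_eq_top_of_card (by rw [card_eq_k_of_isFair hfair]; exact h)]
      exact le_top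
    · rw [h, ENNReal.zero_div]
      exact bot_le

end Main

/-! ### Arithmetic of the time bound -/

section Time

variable {n m : ℕ}

/-- With `X = k m` the searches dominate at the order of `size X * X²`; every other term is absorbed
by this or by `k n`. The products are generalised to atoms to make the final comparison linear. -/
theorem time_le (I : Instance n m) (hk : 1 ≤ I.k) (hm : 1 ≤ m) (hn : 1 ≤ n) :
    4 * (I.k * m + m + 1) + ((if 1 < I.k then optimizeTime I else 0) + 2 + outputTime I) ≤
      5000 * (I.k * n + Nat.size (I.k * m) * (I.k * m * (I.k * m))) := by
  have hite : (if 1 < I.k then optimizeTime I else 0) ≤ optimizeTime I := by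
    split_ifs <;> omega
  refine (Nat.add_le_add_left (Nat.add_le_add_right (Nat.add_le_add_right hite _) _) _).trans ?_
  have hkX : I.k ≤ I.k * m := Nat.le_mul_of_pos_right _ hm
  have hmX : m ≤ I.k * m := Nat.le_mul_of_pos_left _ hk
  have hnA : n ≤ I.k * n := Nat.le_mul_of_pos_left _ hk
  unfold optimizeTime outputTime searchTime
  have hs : 20 * (I.k + 1) * (n + m + 1) ≤ 40 * (I.k * n) + 40 * (I.k * m) + 40 * I.k := by
    nlinarith
  generalize I.k * m = X at *
  generalize I.k * n = A at *
  have hX : 1 ≤ X := hm.trans hmX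
  have hL : 1 ≤ Nat.size X := Nat.size_pos.2 hX
  generalize Nat.size X = L at *
  have h1 : (X + 1) * (X + 1) ≤ 4 * (X * X) := by nlinarith
  have h2 : X ≤ X * X := Nat.le_mul_of_pos_left _ hX
  have h3 : X * X ≤ L * (X * X) := Nat.le_mul_of_pos_left _ hL
  have h4 : 130 * (L + 2) * ((X + 1) * (X + 1)) ≤ 1560 * (L * (X * X)) := by
    calc 130 * (L + 2) * ((X + 1) * (X + 1)) ≤ 130 * (3 * L) * (4 * (X * X)) := by
          gcongr; omega
      _ = 1560 * (L * (X * X)) := by ring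
  have h5 : 100 * (X + 1) * (X + 1) ≤ 400 * (X * X) := by
    rw [mul_assoc]; omega
  omega

/-- From `2 ^ (size X - 1) ≤ X` and `2 ≤ X` one gets `size X * log 2 ≤ 2 log X`, and `2 / log 2 <
3`. -/
theorem size_le_log {X : ℕ} (hX : 2 ≤ X) : (Nat.size X : ℝ) ≤ 3 * Real.log X := by
  have hs : 0 < Nat.size X := Nat.size_pos.2 (by omega)
  have h1 : 2 ^ (Nat.size X - 1) ≤ X := Nat.lt_size.1 (by omega)
  have h2 : ((2 : ℝ) ^ (Nat.size X - 1)) ≤ X := by exact_mod_cast h1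
  have h3 := Real.log_le_log (by positivity) h2
  rw [Real.log_pow, Nat.cast_sub hs, Nat.cast_one] at h3
  have h4 : Real.log 2 ≤ Real.log X := Real.log_le_log (by norm_num) (by exact_mod_cast hX)
  have h5 := Real.log_two_gt_d9
  have h6 : (1 : ℝ) ≤ Nat.size X := by exact_mod_cast hs
  nlinarith

theorem bound_of_nat_bound {k n m t : ℕ} (hk : 1 ≤ k) (hm : 1 ≤ m) (hn : 1 ≤ n)
    (ht : t ≤ 5000 * (k * n + Nat.size (k * m) * (k * m * (k * m)))) :
    (t : ℝ) ≤ 15000 * ((k : ℝ) * n + (k : ℝ) ^ 2 * (m : ℝ) ^ 2 * Real.log ((k : ℝ) * m)) := by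
  have ht' : (t : ℝ) ≤ 5000 * ((k : ℝ) * n + (Nat.size (k * m) : ℝ) * (k * m * (k * m))) := by
    exact_mod_cast ht
  have hA : (1 : ℝ) ≤ (k : ℝ) * n := by exact_mod_cast Nat.mul_pos hk hn
  rcases Nat.lt_or_ge (k * m) 2 with hX | hX
  -- For `k m = 1` the logarithm vanishes, but the quadratic term is then `1`, which `k n ≥ 1`
  -- absorbs.
  · have h1 : k * m = 1 := by
      have := Nat.mul_pos hk hm
      omega
    have h2 : (k : ℝ) * m = 1 := by exact_mod_cast h1
    rw [h1, h2, Nat.size_one] at ht'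
    rw [h2, Real.log_one]
    push_cast at ht'
    linarith
  · have h1 := size_le_log hX
    push_cast at h1
    have h2 : (Nat.size (k * m) : ℝ) * (k * m * (k * m)) ≤
        3 * Real.log ((k : ℝ) * m) * (k * m * (k * m)) :=
      mul_le_mul_of_nonneg_right h1 (by positivity)
    nlinarith

end Time

end FairDiv

theorem mainTheorem1 :
    ∃ (prog : FairDiv.Prog) (C : ℝ), ∀ (n m : ℕ) (I : FairDiv.Instance n m),
      (∀ i, I.quota i ≤ (I.group i).card) →
      ∃ (s : FairDiv.Store) (t : ℕ),
        FairDiv.Runs I prog FairDiv.Store.init s t ∧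
        I.IsFair (s.output n) ∧
        I.opt / (3 * (m : ENNReal) - 1) ≤ I.div (s.output n) ∧
        (0 < I.k →
          (t : ℝ) ≤ C * ((I.k : ℝ) * n +
            (I.k : ℝ) ^ 2 * (m : ℝ) ^ 2 * Real.log ((I.k : ℝ) * m))) := by
  refine ⟨FairDiv.fairFlow, 15000, fun n m I hq => ?_⟩
  obtain ⟨s, t, hr, ht, hfair, hdiv⟩ := FairDiv.fairFlow_spec hq
  refine ⟨s, t, hr, hfair, hdiv, fun hk => ?_⟩
  have hcard := FairDiv.card_eq_k_of_isFair hfair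
  -- The output is a fair set with `k ≥ 1` elements, so the universe is nonempty; the class of an
  -- element then gives `m ≥ 1`.
  have hn : 1 ≤ n := by
    have := Finset.card_le_univ (s.output n)
    rw [hcard, Fintype.card_fin] at this
    omega
  have hm : 1 ≤ m := (Nat.zero_le _).trans_lt (I.col_lt hn)
  exact FairDiv.bound_of_nat_bound hk hm hn (ht.trans (FairDiv.time_le I hk hm hn))
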